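/- Let $\mathcal F_\lambda:\ x(1+a)\,dy+\alpha(\lambda)\,y(1+b)\,dx=0$, $\lambda\in(\mathbb R^N,0)$, be an analytic family of real analytic plane foliations near the origin, where $\alpha(0)>0$ and $a,b$ are real analytic germs in $(x,y,\lambda)$ at the origin which vanish for $x=y=0$. Let $r>0$ be sufficiently small, and let $\sigma\subset\{y=c_1\}$, $\tau\subset\{x=c_2\}$, $0<c_1,c_2<r$, be complex cross-sections to the separatrices $\{x=0\}$, $\{y=0\}$, parameterized by $x$ and $y$. Let $\mathcal D_\lambda$ be the Dulac map: for small $x>0$, $\mathcal D_\lambda(x)=y>0$ if the real orbit of $\mathcal F_\lambda$ in the open first quadrant (within $|x|,|y|<r$) through $(x,c_1)$ meets $\tau$ at $(c_2,y)$. Let $h_\sigma^\lambda:(\sigma,0)\to(\sigma,0)$ be the holonomy map of the separatrix $\{x=0\}$ along the loop $y=c_1e^{it}$, $0\le t\le 2\pi$. Let $\pi:\mathbb C_\bullet\to\mathbb C\setminus\{0\}$ be the universal covering, with polar coordinates $(\rho,\varphi)$, $\rho>0$, $\varphi\in\mathbb R$, $\pi(\rho,\varphi)=\rho e^{i\varphi}$,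 and for $k\in\mathbb Z$ put $$C_{\lambda,k}=\{z\in\mathbb C:\ (h_\sigma^\lambda)^k(z)=\bar z\},$$ a germ of a set at the origin. Then there are $\varepsilon_0>0$ and a continuous function $\rho_0:\mathbb R\to(0,\infty)$ such that for all $\lambda\in\mathbb R^N$ with $|\lambda|<\varepsilon_0$ we have $\alpha(\lambda)>0$, the map $\mathcal D_\lambda$ has an analytic continuation to the domain $\{0<\rho<\rho_0(\varphi)\}\subset\mathbb C_\bullet$, and, for every $k\in\mathbb Z$, $C_{\lambda,k}$ is a germ of a real analytic curve of $\mathbb R^2=\mathbb C$, smooth at the origin and tangent there to the line $\mathbb R\,e^{ik\pi/\alpha(\lambda)}$. Moreover, for every continuous $\rho_1:\mathbb R\to(0,\infty)$ there is a continuous function $\rho:\mathbb R\to(0,\infty)$ (denoted $\rho(\varphi)$), $\rho(\varphi)\le\min(\rho_0(\varphi),\rho_1(\varphi))$, such that for all $|\lambda|<\varepsilon_0$ the zero locus $$\mathcal H_\lambda=\{(\rho,\varphi)\in\mathbb C_\bullet:\ \operatorname{Im}\mathcal D_\lambda(\rho,\varphi)=0,\ 0<\rho<\rho(\varphi)\}$$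 is the union of its pairwise distinct connected components $\mathcal H_{\lambda,k}$, $k\in\mathbb Z$, where, for every $k$: $\varphi\to k\pi/\alpha(\lambda)$ as $\rho\to0$ along $\mathcal H_{\lambda,k}$; and $\pi(\mathcal H_{\lambda,k})$ is the connected component of $C_{\lambda,k}\setminus\{0\}$ (in a sufficiently small disc, depending on $\lambda,k$, in which the germ $C_{\lambda,k}$ is represented) which is tangent at the origin to the half-line $\{s\,e^{ik\pi/\alpha(\lambda)}:s>0\}$. -/

import Mathlib

open Filter Topology Set

noncomputable section

/-- The complexification `ℝ^N ⊂ ℂ^N` on parameters. -/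
def complexParam {N : ℕ} (l : Fin N → ℝ) : Fin N → ℂ := fun i => (l i : ℂ)

/-- An analytic family of real analytic foliations
`x (1 + a) dy + α(λ) y (1 + b) dx = 0` near a saddle at the origin whose separatrices are the axes.
The real analytic germs `a`, `b` in `(x, y, λ)` are given through their holomorphic extensions to
a neighbourhood of the origin of `ℂ × ℂ × ℂ^N`, which are real at real points and vanish for
`x = y = 0`. -/
structure SaddleFamily (N : ℕ) where
  /-- the hyperbolic ratio of the saddle -/
  α : (Fin N → ℝ) → ℝ
  a : ℂ × ℂ × (Fin N → ℂ) → ℂ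
  b : ℂ × ℂ × (Fin N → ℂ) → ℂ
  α_analytic : AnalyticAt ℝ α 0
  α_pos : 0 < α 0
  a_analytic : AnalyticAt ℂ a 0
  b_analytic : AnalyticAt ℂ b 0
  a_real : ∀ᶠ p : ℝ × ℝ × (Fin N → ℝ) in 𝓝 0,
    (a ((p.1 : ℂ), (p.2.1 : ℂ), complexParam p.2.2)).im = 0
  b_real : ∀ᶠ p : ℝ × ℝ × (Fin N → ℝ) in 𝓝 0,
    (b ((p.1 : ℂ), (p.2.1 : ℂ), complexParam p.2.2)).im = 0
  a_zero : ∀ᶠ l : Fin N → ℝ in 𝓝 0, a (0, 0, complexParam l) = 0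
  b_zero : ∀ᶠ l : Fin N → ℝ in 𝓝 0, b (0, 0, complexParam l) = 0

namespace SaddleFamily

variable {N : ℕ}

/-- The value at the point `(x, y)` and the vector `(u, v)` of the one-form
`x (1 + a) dy + α(λ) y (1 + b) dx`, for a real parameter `λ = l`. -/
def form (F : SaddleFamily N) (l : Fin N → ℝ) (x y u v : ℂ) : ℂ :=
  x * (1 + F.a (x, y, complexParam l)) * v + (F.α l : ℂ) * y * (1 + F.b (x, y, complexParam l)) * u

/-- `t ↦ (X t, Y t)`, `t ∈ s`, is a differentiable path in the polydisc `|x| < r`, `|y| < r`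
which is everywhere tangent to the (complex) foliation, so it is contained in a leaf. -/
def IsLeafPath (F : SaddleFamily N) (l : Fin N → ℝ) (r : ℝ) (s : Set ℝ) (X Y : ℝ → ℂ) : Prop :=
  ∀ t ∈ s, ‖X t‖ < r ∧ ‖Y t‖ < r ∧ ∃ u v : ℂ,
    HasDerivWithinAt X u s t ∧ HasDerivWithinAt Y v s t ∧ F.form l (X t) (Y t) u v = 0

/-- The real Dulac map from `σ ⊂ {y = c₁}` to `τ ⊂ {x = c₂}` sends `x > 0` to `y`: a real orbit in
the open first quadrant connects `(x, c₁)` to `(c₂, y)`. -/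
def IsDulacValue (F : SaddleFamily N) (l : Fin N → ℝ) (r c₁ c₂ x y : ℝ) : Prop :=
  ∃ X Y : ℝ → ℝ, X 0 = x ∧ Y 0 = c₁ ∧ X 1 = c₂ ∧ Y 1 = y ∧
    (∀ t ∈ Icc (0 : ℝ) 1, 0 < X t ∧ 0 < Y t) ∧
    F.IsLeafPath l r (Icc 0 1) (fun t => (X t : ℂ)) (fun t => (Y t : ℂ))

/-- The graph of the holonomy map `h_σ : (σ, 0) → (σ, 0)` of the separatrix `{x = 0}`, for
`σ ⊂ {y = c₁}` parameterized by `x`: `h_σ z = z'` when the loop `t ↦ c₁ e^{it}`, `0 ≤ t ≤ 2π`, of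
the separatrix (parameterized by `y`) lifts to a leaf path from `(z, c₁)` to `(z', c₁)`. -/
def Holonomy (F : SaddleFamily N) (l : Fin N → ℝ) (r c₁ : ℝ) (z z' : ℂ) : Prop :=
  ∃ X : ℝ → ℂ, X 0 = z ∧ X (2 * Real.pi) = z' ∧
    F.IsLeafPath l r (Icc 0 (2 * Real.pi)) X
      (fun t => (c₁ : ℂ) * Complex.exp ((t : ℂ) * Complex.I))

end SaddleFamily

/-- The graph of the `n`-th iterate of the partial map with graph `R`. -/
def graphIterate (R : ℂ → ℂ → Prop) : ℕ → ℂ → ℂ → Prop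
  | 0, z, w => z = w
  | n + 1, z, w => ∃ u, R z u ∧ graphIterate R n u w

/-- The graph of the `k`-th iterate, `k ∈ ℤ`, of the injective partial map with graph `R`; for
negative `k` these are the iterates of the inverse map, whose graph is the transposed one. -/
def graphZIterate (R : ℂ → ℂ → Prop) (k : ℤ) (z w : ℂ) : Prop :=
  if 0 ≤ k then graphIterate R k.toNat z w else graphIterate R (-k).toNat w z

/-- `C_{λ,k} = {z : h_σ^k (z) = conj z}`; only its germ at the origin is independent of `r`. -/
def SaddleFamily.holonomyLocus {N : ℕ} (F : SaddleFamily N) (l : Fin N → ℝ) (r c₁ : ℝ) (k : ℤ) :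
    Set ℂ :=
  {z | graphZIterate (F.Holonomy l r c₁) k z (starRingEnd ℂ z)}

/-- The universal covering of `ℂ ∖ {0}` is taken to be `Complex.exp : ℂ → ℂ ∖ {0}`: the point with
polar coordinates `(ρ, φ)`, `ρ > 0`, `φ ∈ ℝ`, is `w = log ρ + i φ`.
This is the domain `0 < ρ < ρ(φ)`. -/
def polarDomain (ρ : ℝ → ℝ) : Set ℂ := {w | Real.exp w.re < ρ w.im}

/-- `D` is the analytic continuation of the real Dulac map to the domain `0 < ρ < ρ(φ)` of the
universal covering. -/
def SaddleFamily.IsDulacContinuation {N : ℕ} (F : SaddleFamily N) (l : Fin N → ℝ) (r c₁ c₂ : ℝ)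
    (ρ : ℝ → ℝ) (D : ℂ → ℂ) : Prop :=
  AnalyticOnNhd ℂ D (polarDomain ρ) ∧
    ∀ u : ℝ, Real.exp u < ρ 0 → ∃ y : ℝ, D (u : ℂ) = (y : ℂ) ∧
      F.IsDulacValue l r c₁ c₂ (Real.exp u) y

/-- The zero locus of `Im D` in the domain `0 < ρ < ρ(φ)`. -/
def imZeroLocus (D : ℂ → ℂ) (ρ : ℝ → ℝ) : Set ℂ := {w | w ∈ polarDomain ρ ∧ (D w).im = 0}

/-- Near the origin of `ℂ = ℝ²` the set `C` is a real analytic curve through the origin which is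
smooth there (the zero set of a real analytic function with non-zero differential) and tangent to
the line `ℝ v`, where `v ≠ 0`. -/
def IsSmoothAnalyticCurveAtZero (C : Set ℂ) (v : ℂ) : Prop :=
  ∃ f : ℂ → ℝ, AnalyticAt ℝ f 0 ∧ f 0 = 0 ∧ fderiv ℝ f 0 ≠ 0 ∧ fderiv ℝ f 0 v = 0 ∧
    ∀ᶠ z in 𝓝 (0 : ℂ), z ∈ C ↔ f z = 0

/-- The set `S ⊂ ℂ ∖ {0}` accumulates at the origin, and is tangent there to the half-line
`{s v : s > 0}`, where `|v| = 1`. -/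
def IsTangentToHalfLine (S : Set ℂ) (v : ℂ) : Prop :=
  (0 : ℂ) ∈ closure S ∧ Tendsto (fun z : ℂ => z / (‖z‖ : ℂ)) (𝓝[S] 0) (𝓝 v)

/-- The unit vector `e^{ikπ/α}`. -/
def direction (α : ℝ) (k : ℤ) : ℂ :=
  Complex.exp ((((k : ℝ) * Real.pi / α : ℝ) : ℂ) * Complex.I)

end

/-!
The form `x (1 + a) dy + α y (1 + b) dx` has the same leaves as `x dy + y f dx` with
`f = α (1 + b) / (1 + a)`, where `f` is nearly constant on a small bidisc (`Saddle`,
`SaddleFamily.exists_saddle`). In the logarithmic coordinates `x = exp w`, `y = exp v` the leaves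
satisfy `dv = - G dw` with `G` close to `α`. Following a leaf from `(w, v)` along the straight segment
to `log c₂` gives a first integral `V(w, v)` (`Saddle.firstIntegral`). It is defined as long as
`Re w + |Im w| < log c₂`, since `|y|` decreases along such segments, and it is holomorphic with
`∂V/∂v` close to `1` and `∂V/∂w` close to `α` (`Saddle.exists_hasFDerivAt_firstIntegral`). So
`D = exp V(·, log c₁)` continues the Dulac map, and `Im D = 0` says that `Im V = kπ` for some integer
`k`, which for a given `k` happens for at most one argument `φ` on each circle `|x| = const`.

The foliation is invariant under complex conjugation, hence `h^k(z) = conj z` says that the holonomy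
of `{x = 0}` over `k` half-turns, from `y = c₁` to `y = (-1)^k c₁`, maps `z` to a real point
(`Saddle.flow_two_pi_eq_conj_iff`). This holonomy is holomorphic at `0`, and by the mean value
property of `1 / f(0, y)` its derivative there has argument `-kπ/α` (`Saddle.limitShift_im`); so
`C_{λ,k}`, the preimage of the real axis, is a smooth curve with the asserted tangent. If its value
at `z` is real and positive, then the leaf of `z` contains a real point over a half-line of argument
`kπ` of the `y`-plane, and as `V` is constant on the leaves and real leaves have constant argument of
`y`, it follows that `Im V = kπ` at `z` (`Saddle.logDulac_im_of_flow_im`). The converse holds by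
uniqueness on circles.

Thus the zero locus of `Im D` consists, near the origin, of the lifts of the half-branches of the
curves `C_{λ,k}`, which are graphs over `|x|`. They stay connected in the domain `ρ < ρ(φ)` if `ρ` is
small and flat enough compared with the constants of the branches that enter the domain at argument
`φ` (`Saddle.IsAdapted`). These constants grow exponentially with `φ`, uniformly in the parameter, so
that a function `ρ` of exponential decay times a Lipschitz function serves all parameters at once
(`exists_isAdapted`).
-/

/-! ### Scalar differential equations: global existence and dependence on parameters -/

/-- A bounded, uniformly Lipschitz time-dependent vector field has a solution on all of `ℝ`. -/
theorem exists_global_solution {f : ℝ → ℂ → ℂ} {K L : NNReal}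
    (hcont : ∀ y, Continuous fun t => f t y) (hlip : ∀ t, LipschitzWith K (f t))
    (hbdd : ∀ t y, ‖f t y‖ ≤ L) (v : ℂ) :
    ∃ y : ℝ → ℂ, y 0 = v ∧ ∀ t, HasDerivAt y (f t (y t)) t := by
  have key : ∀ n : ℕ, ∃ y : ℝ → ℂ, y 0 = v ∧
      ∀ t ∈ Ioo (-(n + 1 : ℝ)) (n + 1), HasDerivAt y (f t (y t)) t := by
    intro n
    have hn : (0 : ℝ) < n + 1 := by positivity
    have hPL : IsPicardLindelof f (tmin := -(n + 1 : ℝ)) (tmax := n + 1)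
        ⟨0, by constructor <;> linarith⟩ v (L * (n + 1)) 0 L K :=
      { lipschitzOnWith := fun t _ => (hlip t).lipschitzOnWith
        continuousOn := fun x _ => (hcont x).continuousOn
        norm_le := fun t _ x _ => hbdd t x
        mul_max_le := by simp }
    obtain ⟨y, hy0, hy⟩ := hPL.exists_eq_forall_mem_Icc_hasDerivWithinAt₀
    exact ⟨y, hy0, fun t ht =>
      (hy t (Ioo_subset_Icc_self ht)).hasDerivAt (Icc_mem_nhds ht.1 ht.2)⟩
  choose y hy0 hy using key
  have huniq : ∀ n m : ℕ, n ≤ m → EqOn (y n) (y m) (Ioo (-(n + 1 : ℝ)) (n + 1)) := by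
    intro n m hnm
    have hnm' : (n : ℝ) ≤ m := by exact_mod_cast hnm
    have hn : (0 : ℝ) < n + 1 := by positivity
    refine ODE_solution_unique_of_mem_Ioo (v := f) (s := fun _ => univ) (K := K) (t₀ := 0)
      (fun t _ => (hlip t).lipschitzOnWith) ⟨by linarith, hn⟩
      (fun t ht => ⟨hy n t ht, mem_univ _⟩)
      (fun t ht => ⟨hy m t ⟨by linarith [ht.1], by linarith [ht.2]⟩, mem_univ _⟩) ?_
    rw [hy0, hy0]
  refine ⟨fun t => y ⌈|t|⌉₊ t, by simp [hy0], fun t => ?_⟩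
  set N := ⌈|t|⌉₊ + 1 with hN
  have ht : |t| < (N : ℝ) := lt_of_le_of_lt (Nat.le_ceil _) (by rw [hN]; push_cast; linarith)
  have hev : (fun s : ℝ => y ⌈|s|⌉₊ s) =ᶠ[𝓝 t] y N := by
    have : ∀ᶠ s : ℝ in 𝓝 t, |s| < (N : ℝ) := (continuous_abs.tendsto t).eventually (gt_mem_nhds ht)
    filter_upwards [this] with s hs
    refine huniq _ _ (Nat.ceil_le.2 hs.le) ?_
    have := Nat.le_ceil |s|
    have h2 := abs_lt.1 (lt_of_le_of_lt this (lt_add_one _))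
    exact h2
  have ht2 := abs_lt.1 (ht.trans (lt_add_one _))
  have := (hy N t ht2).congr_of_eventuallyEq hev
  have e : y N t = y ⌈|t|⌉₊ t := hev.self_of_nhds.symm
  rwa [e] at this

/-- Grönwall's inequality on the line, in both time directions. -/
theorem norm_le_exp_of_norm_deriv_le {y y' : ℝ → ℂ} {K T : ℝ}
    (hy : ∀ t, |t| ≤ T → HasDerivAt y (y' t) t) (hbound : ∀ t, |t| ≤ T → ‖y' t‖ ≤ K * ‖y t‖)
    {t : ℝ} (ht : |t| ≤ T) : ‖y t‖ ≤ ‖y 0‖ * Real.exp (K * |t|) := by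
  have main : ∀ (z z' : ℝ → ℂ), (∀ t, |t| ≤ T → HasDerivAt z (z' t) t) →
      (∀ t, |t| ≤ T → ‖z' t‖ ≤ K * ‖z t‖) → ∀ t, 0 ≤ t → t ≤ T →
      ‖z t‖ ≤ ‖z 0‖ * Real.exp (K * t) := by
    intro z z' hz hb t h0 hT
    have := norm_le_gronwallBound_of_norm_deriv_right_le (f := z) (f' := z') (δ := ‖z 0‖)
      (K := K) (ε := 0) (a := 0) (b := T)
      (fun x hx => (hz x (by rw [abs_of_nonneg hx.1]; exact hx.2)).continuousAt.continuousWithinAt)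
      (fun x hx => (hz x (by rw [abs_of_nonneg hx.1]; exact hx.2.le)).hasDerivWithinAt) le_rfl
      (fun x hx => by simpa using hb x (by rw [abs_of_nonneg hx.1]; exact hx.2.le)) t ⟨h0, hT⟩
    simpa [gronwallBound_ε0] using this
  rcases le_total 0 t with h | h
  · rw [abs_of_nonneg h] at ht ⊢
    exact main y y' hy hbound t h ht
  · rw [abs_of_nonpos h] at ht ⊢
    have := main (fun s => y (-s)) (fun s => -y' (-s))
      (fun s hs => by
        have := (hy (-s) (by rwa [abs_neg])).scomp s (hasDerivAt_neg s)
        simpa [Function.comp_def] using this)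
      (fun s hs => by simpa using hbound (-s) (by rwa [abs_neg])) (-t) (by linarith) ht
    simpa using this

/-- Differentiable dependence of a scalar differential equation `y' = F(t, μ, y)`, `y(0) = v` on the
parameter `μ` and on the initial value `v`: the derivative of the value at time `1` is given by
variation of constants from the linearised equation `δ' = a δ + b dμ`. -/
theorem hasFDerivAt_solution {F : ℝ → ℂ → ℂ → ℂ} {y : ℂ × ℂ → ℝ → ℂ} {p₀ : ℂ × ℂ} {L : ℝ}
    {a b : ℝ → ℂ} (hL : 0 < L)
    (hy0 : ∀ p, y p 0 = p.2) (hy : ∀ p t, HasDerivAt (y p) (F t p.1 (y p t)) t)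
    (hc : ∀ p, Continuous fun t => F t p.1 (y p t))
    (hlip : ∀ᶠ p in 𝓝 p₀, ∀ t ∈ Icc (0 : ℝ) 1, ∀ z z',
      ‖F t p.1 z - F t p₀.1 z'‖ ≤ L * (‖p.1 - p₀.1‖ + ‖z - z'‖))
    (hF : ∀ t ∈ Icc (0 : ℝ) 1, HasFDerivAt (fun q : ℂ × ℂ => F t q.1 q.2)
      (b t • ContinuousLinearMap.fst ℂ ℂ ℂ + a t • ContinuousLinearMap.snd ℂ ℂ ℂ)
      (p₀.1, y p₀ t))
    (ha : Continuous a) (hb : Continuous b) :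
    HasFDerivAt (fun p => y p 1)
      (Complex.exp (∫ t in (0 : ℝ)..1, a t) • (ContinuousLinearMap.snd ℂ ℂ ℂ +
        (∫ t in (0 : ℝ)..1, Complex.exp (-∫ s in (0 : ℝ)..t, a s) * b t) •
          ContinuousLinearMap.fst ℂ ℂ ℂ)) p₀ := by
  set A : ℝ → ℂ := fun t => ∫ s in (0 : ℝ)..t, a s with hA
  have hA' : ∀ t, HasDerivAt A (a t) t := fun t =>
    intervalIntegral.integral_hasDerivAt_right (ha.intervalIntegrable _ _)
      (ha.stronglyMeasurableAtFilter _ _) ha.continuousAt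
  have hAc : Continuous A := continuous_iff_continuousAt.2 fun t => (hA' t).continuousAt
  have hA0 : A 0 = 0 := by simp [hA]
  have hyc : ∀ p, Continuous (y p) := fun p =>
    continuous_iff_continuousAt.2 fun t => (hy p t).continuousAt
  -- the part of `δ'` that is not accounted for by the linearised equation
  set rem : ℂ × ℂ → ℝ → ℂ := fun p t =>
    F t p.1 (y p t) - F t p₀.1 (y p₀ t) - (b t * (p.1 - p₀.1) + a t * (y p t - y p₀ t)) with hrem
  have hremc : ∀ p, Continuous (rem p) := fun p =>
    ((hc p).sub (hc p₀)).sub ((hb.mul continuous_const).add (ha.mul ((hyc p).sub (hyc p₀))))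
  have hformula : ∀ p, y p 1 - y p₀ 1 -
      (Complex.exp (A 1) • (ContinuousLinearMap.snd ℂ ℂ ℂ +
        (∫ t in (0 : ℝ)..1, Complex.exp (-A t) * b t) •
          ContinuousLinearMap.fst ℂ ℂ ℂ)) (p - p₀) =
      Complex.exp (A 1) * ∫ t in (0 : ℝ)..1, Complex.exp (-A t) * rem p t := by
    intro p
    have hd : ∀ t, HasDerivAt (fun t => Complex.exp (-A t) * (y p t - y p₀ t))
        (Complex.exp (-A t) * b t * (p.1 - p₀.1) + Complex.exp (-A t) * rem p t) t := by
      intro t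
      have h1 : HasDerivAt (fun t => Complex.exp (-A t)) (Complex.exp (-A t) * -a t) t :=
        (hA' t).neg.cexp
      have := h1.mul ((hy p t).sub (hy p₀ t))
      refine this.congr_deriv ?_
      simp only [hrem, Pi.sub_apply]; ring
    have hE : Continuous fun t => Complex.exp (-A t) := Complex.continuous_exp.comp hAc.neg
    have hi1 : IntervalIntegrable (fun t => Complex.exp (-A t) * b t * (p.1 - p₀.1))
        MeasureTheory.volume 0 1 := ((hE.mul hb).mul continuous_const).intervalIntegrable _ _
    have hi2 : IntervalIntegrable (fun t => Complex.exp (-A t) * rem p t)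
        MeasureTheory.volume 0 1 := (hE.mul (hremc p)).intervalIntegrable _ _
    have := intervalIntegral.integral_eq_sub_of_hasDerivAt (a := 0) (b := 1) (fun t _ => hd t)
      (hi1.add hi2)
    rw [intervalIntegral.integral_add hi1 hi2, intervalIntegral.integral_mul_const] at this
    rw [hA0, hy0, hy0] at this
    simp only [neg_zero, Complex.exp_zero, one_mul] at this
    have hne : Complex.exp (A 1) * Complex.exp (-A 1) = 1 := by
      rw [← Complex.exp_add]; simp
    simp only [smul_apply, add_apply,
      ContinuousLinearMap.coe_snd', ContinuousLinearMap.coe_fst', Prod.fst_sub, Prod.snd_sub,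
      smul_eq_mul]
    linear_combination (-Complex.exp (A 1)) * this - (y p 1 - y p₀ 1) * hne
  -- Lipschitz dependence, from Grönwall's inequality
  have hδ : ∀ᶠ p in 𝓝 p₀, ∀ t ∈ Icc (0 : ℝ) 1,
      ‖y p t - y p₀ t‖ ≤ 2 * Real.exp L * ‖p - p₀‖ := by
    filter_upwards [hlip] with p hp t ht
    have h1 : ‖p.1 - p₀.1‖ ≤ ‖p - p₀‖ := norm_fst_le (p - p₀)
    have h2 : ‖p.2 - p₀.2‖ ≤ ‖p - p₀‖ := norm_snd_le (p - p₀)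
    have := norm_le_gronwallBound_of_norm_deriv_right_le (f := fun t => y p t - y p₀ t)
      (f' := fun t => F t p.1 (y p t) - F t p₀.1 (y p₀ t)) (δ := ‖p - p₀‖)
      (K := L) (ε := L * ‖p - p₀‖) (a := 0) (b := 1)
      ((hyc p).sub (hyc p₀)).continuousOn
      (fun x hx => ((hy p x).sub (hy p₀ x)).hasDerivWithinAt) (by simpa [hy0] using h2)
      (fun x hx => (hp x ⟨hx.1, hx.2.le⟩ _ _).trans (by nlinarith)) t ht
    rw [gronwallBound_of_K_ne_0 hL.ne'] at this
    refine this.trans ?_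
    have h3 : Real.exp (L * (t - 0)) ≤ Real.exp L := Real.exp_le_exp.2 (by nlinarith [ht.2])
    rw [mul_div_cancel_left₀ _ hL.ne']
    nlinarith [norm_nonneg (p - p₀)]
  have hpt : ∀ t ∈ Icc (0 : ℝ) 1, Tendsto (fun p => ‖p - p₀‖⁻¹ * ‖rem p t‖) (𝓝 p₀) (𝓝 0) := by
    intro t ht
    have hbig : (fun p => y p t - y p₀ t) =O[𝓝 p₀] fun p => p - p₀ :=
      Asymptotics.IsBigO.of_bound _ (hδ.mono fun p hp => hp t ht)
    have hbig2 : (fun p : ℂ × ℂ => ((p.1, y p t) - (p₀.1, y p₀ t) : ℂ × ℂ)) =O[𝓝 p₀]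
        fun p => p - p₀ := by
      refine Asymptotics.IsBigO.prod_left ?_ hbig
      exact Asymptotics.IsBigO.of_bound 1 (Eventually.of_forall fun p => by
        simpa using norm_fst_le (p - p₀))
    have hten : Tendsto (fun p : ℂ × ℂ => (p.1, y p t)) (𝓝 p₀) (𝓝 (p₀.1, y p₀ t)) := by
      have h0 : Tendsto (fun p : ℂ × ℂ => p - p₀) (𝓝 p₀) (𝓝 0) := by
        have : Tendsto (fun p : ℂ × ℂ => p - p₀) (𝓝 p₀) (𝓝 (p₀ - p₀)) :=
          (continuous_id.sub continuous_const).tendsto p₀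
        simpa using this
      have := (hbig2.trans_tendsto h0).add_const (p₀.1, y p₀ t)
      simpa using this
    have hlo := ((hF t ht).isLittleO.comp_tendsto hten).trans_isBigO hbig2
    have := hlo.norm_norm.tendsto_div_nhds_zero
    refine this.congr fun p => ?_
    simp [hrem, div_eq_inv_mul]
  have hbd : ∀ᶠ p in 𝓝 p₀, ∀ t ∈ Icc (0 : ℝ) 1, ‖p - p₀‖⁻¹ * ‖rem p t‖ ≤
      L * (1 + 2 * Real.exp L) + (‖b t‖ + ‖a t‖ * (2 * Real.exp L)) := by
    filter_upwards [hlip, hδ] with p hp hd t ht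
    have h1 : ‖p.1 - p₀.1‖ ≤ ‖p - p₀‖ := norm_fst_le (p - p₀)
    have h2 := hd t ht
    have h3 := hp t ht (y p t) (y p₀ t)
    rcases (norm_nonneg (p - p₀)).eq_or_lt with h0 | h0
    · rw [← h0]; simp; positivity
    rw [inv_mul_le_iff₀ h0]
    have h4 : ‖rem p t‖ ≤ L * (‖p.1 - p₀.1‖ + ‖y p t - y p₀ t‖) +
        (‖b t‖ * ‖p.1 - p₀.1‖ + ‖a t‖ * ‖y p t - y p₀ t‖) := by
      refine (norm_sub_le _ _).trans (add_le_add h3 ((norm_add_le _ _).trans ?_))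
      rw [norm_mul, norm_mul]
    refine h4.trans ?_
    have h5 := mul_le_mul_of_nonneg_left h1 (norm_nonneg (b t))
    have h6 := mul_le_mul_of_nonneg_left h2 (norm_nonneg (a t))
    have h7 := mul_le_mul_of_nonneg_left (add_le_add h1 h2) hL.le
    nlinarith
  have hE : Continuous fun t => Complex.exp (-A t) := Complex.continuous_exp.comp hAc.neg
  have hlim : Tendsto (fun p => ∫ t in (0 : ℝ)..1, ‖Complex.exp (-A t)‖ * (‖p - p₀‖⁻¹ * ‖rem p t‖))
      (𝓝 p₀) (𝓝 (∫ t in (0 : ℝ)..1, (0 : ℝ))) := by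
    refine intervalIntegral.tendsto_integral_filter_of_dominated_convergence
      (fun t => ‖Complex.exp (-A t)‖ *
        (L * (1 + 2 * Real.exp L) + (‖b t‖ + ‖a t‖ * (2 * Real.exp L)))) ?_ ?_ ?_ ?_
    · exact Eventually.of_forall fun p => Continuous.aestronglyMeasurable
        (hE.norm.mul (continuous_const.mul (hremc p).norm))
    · filter_upwards [hbd] with p hp
      refine Eventually.of_forall fun t ht => ?_
      rw [uIoc_of_le zero_le_one] at ht
      rw [Real.norm_of_nonneg (by positivity)]
      exact mul_le_mul_of_nonneg_left (hp t ⟨ht.1.le, ht.2⟩) (norm_nonneg _)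
    · exact (hE.norm.mul (continuous_const.add
        (hb.norm.add (ha.norm.mul continuous_const)))).intervalIntegrable _ _
    · refine Eventually.of_forall fun t ht => ?_
      rw [uIoc_of_le zero_le_one] at ht
      simpa using (hpt t ⟨ht.1.le, ht.2⟩).const_mul ‖Complex.exp (-A t)‖
  rw [hasFDerivAt_iff_tendsto]
  have hlim2 := hlim.const_mul ‖Complex.exp (A 1)‖
  simp only [intervalIntegral.integral_zero, mul_zero] at hlim2
  refine squeeze_zero (fun p => by positivity) (fun p => ?_) hlim2
  rw [hformula p, norm_mul]
  have h1 : ‖∫ t in (0 : ℝ)..1, Complex.exp (-A t) * rem p t‖ ≤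
      ∫ t in (0 : ℝ)..1, ‖Complex.exp (-A t) * rem p t‖ :=
    intervalIntegral.norm_integral_le_integral_norm zero_le_one
  have h2 : ∫ t in (0 : ℝ)..1, ‖Complex.exp (-A t)‖ * (‖p - p₀‖⁻¹ * ‖rem p t‖) =
      ‖p - p₀‖⁻¹ * ∫ t in (0 : ℝ)..1, ‖Complex.exp (-A t) * rem p t‖ := by
    rw [← intervalIntegral.integral_const_mul]
    congr 1; ext t; rw [norm_mul]; ring
  rw [h2]
  have : 0 ≤ ‖p - p₀‖⁻¹ := by positivity
  have h4 := mul_le_mul_of_nonneg_left h1 (mul_nonneg this (norm_nonneg (Complex.exp (A 1))))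
  linarith

/-! ### The normalised saddle and its logarithmic chart -/

/-- The data of one member of a saddle family in the normalised form `x dy + y f(x, y) dx = 0` on the
bidisc of radius `r`, where `f` is holomorphic, real on real points, `f(0, 0) = α` and `f` is nearly
constant: `K` is a Lipschitz constant and `K_small` gives `|f - α| ≤ α / 32`. The sections are
`{y = c₁}`, `{x = c₂}`. The auxiliary radius `b`, strictly between `c₁, c₂` and `r`, is where
coordinates are cut off in order to obtain globally defined differential equations. -/
structure Saddle where
  /-- the ratio `-(x dy) / (y dx)` along the leaves -/
  f : ℂ × ℂ → ℂ
  α : ℝ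
  r : ℝ
  b : ℝ
  c₁ : ℝ
  c₂ : ℝ
  K : ℝ
  α_pos : 0 < α
  c₁_pos : 0 < c₁
  c₂_pos : 0 < c₂
  c₁_lt : c₁ < b
  c₂_lt : c₂ < b
  b_lt : b < r
  K_pos : 0 < K
  K_small : 64 * K * r ≤ α
  analytic : AnalyticOnNhd ℂ f (Metric.ball 0 r ×ˢ Metric.ball 0 r)
  lip : ∀ x y x' y' : ℂ, ‖x‖ < r → ‖y‖ < r → ‖x'‖ < r → ‖y'‖ < r →
    ‖f (x, y) - f (x', y')‖ ≤ K * (‖x - x'‖ + ‖y - y'‖)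
  conj : ∀ x y : ℂ, ‖x‖ < r → ‖y‖ < r →
    f (starRingEnd ℂ x, starRingEnd ℂ y) = starRingEnd ℂ (f (x, y))
  zero : f (0, 0) = α

namespace Saddle

variable (S : Saddle)

lemma b_pos : 0 < S.b := S.c₁_pos.trans S.c₁_lt

lemma r_pos : 0 < S.r := S.b_pos.trans S.b_lt

/-- The exponential with the modulus of its values cut off at `b`: a globally defined, bounded and
Lipschitz substitute for `exp` that agrees with it where `|exp w| ≤ b`. -/
noncomputable def texp (w : ℂ) : ℂ := Complex.exp ⟨min w.re (Real.log S.b), w.im⟩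

lemma texp_eq {w : ℂ} (h : w.re ≤ Real.log S.b) : S.texp w = Complex.exp w := by
  unfold texp; rw [min_eq_left h]

lemma norm_texp_le_b (w : ℂ) : ‖S.texp w‖ ≤ S.b := by
  unfold texp
  rw [Complex.norm_exp]
  calc Real.exp (min w.re (Real.log S.b)) ≤ Real.exp (Real.log S.b) :=
        Real.exp_le_exp.2 (min_le_right _ _)
    _ = S.b := Real.exp_log S.b_pos

lemma norm_texp_lt (w : ℂ) : ‖S.texp w‖ < S.r := (S.norm_texp_le_b w).trans_lt S.b_lt

lemma norm_texp_le (w : ℂ) : ‖S.texp w‖ ≤ Real.exp w.re := by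
  unfold texp
  rw [Complex.norm_exp]
  exact Real.exp_le_exp.2 (min_le_left _ _)

lemma norm_exp_sub_exp_le {c : ℝ} {w w' : ℂ} (h : w.re ≤ c) (h' : w'.re ≤ c) :
    ‖Complex.exp w - Complex.exp w'‖ ≤ Real.exp c * ‖w - w'‖ := by
  refine (convex_halfSpace_re_le c).norm_image_sub_le_of_norm_deriv_le (𝕜 := ℂ)
    (fun x _ => Complex.differentiableAt_exp) (fun x hx => ?_) h' h
  rw [Complex.deriv_exp, Complex.norm_exp]
  exact Real.exp_le_exp.2 hx

lemma norm_trunc_sub_le (c : ℝ) (w w' : ℂ) :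
    ‖(⟨min w.re c, w.im⟩ : ℂ) - ⟨min w'.re c, w'.im⟩‖ ≤ ‖w - w'‖ := by
  rw [Complex.norm_def, Complex.norm_def]
  refine Real.sqrt_le_sqrt ?_
  simp only [Complex.normSq_apply, Complex.sub_re, Complex.sub_im]
  have := abs_min_sub_min_le_max w.re c w'.re c
  simp only [sub_self, abs_zero] at this
  rw [max_eq_left (abs_nonneg _)] at this
  have := sq_le_sq.2 this
  nlinarith

lemma norm_texp_sub_le {c : ℝ} {w w' : ℂ} (h : w.re ≤ c) (h' : w'.re ≤ c) :
    ‖S.texp w - S.texp w'‖ ≤ Real.exp c * ‖w - w'‖ := by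
  unfold texp
  refine (norm_exp_sub_exp_le (c := c) ((min_le_left _ _).trans h)
    ((min_le_left _ _).trans h')).trans ?_
  exact mul_le_mul_of_nonneg_left (norm_trunc_sub_le _ _ _) (Real.exp_pos _).le

lemma norm_texp_sub_le_b (w w' : ℂ) : ‖S.texp w - S.texp w'‖ ≤ S.b * ‖w - w'‖ := by
  unfold texp
  refine (norm_exp_sub_exp_le (c := Real.log S.b) (min_le_right _ _) (min_le_right _ _)).trans ?_
  rw [Real.exp_log S.b_pos]
  exact mul_le_mul_of_nonneg_left (norm_trunc_sub_le _ _ _) S.b_pos.le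

lemma texp_add_period (w : ℂ) (n : ℤ) :
    S.texp (w + n * (2 * Real.pi * Complex.I)) = S.texp w := by
  unfold texp
  rw [← Complex.exp_periodic.int_mul n ⟨min w.re (Real.log S.b), w.im⟩]
  congr 1
  apply Complex.ext <;> simp

lemma texp_conj (w : ℂ) : S.texp (starRingEnd ℂ w) = starRingEnd ℂ (S.texp w) := by
  unfold texp
  rw [← Complex.exp_conj]
  congr 1

/-- The slope of the leaves in the logarithmic coordinates `x = exp w`, `y = exp v`, in which they
satisfy `dv = - G(w, v) dw`; it is extended to `ℂ × ℂ` by the cut-off exponential. -/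
noncomputable def G (w v : ℂ) : ℂ := S.f (S.texp w, S.texp v)

lemma norm_G_sub_le (w v w' v' : ℂ) : ‖S.G w v - S.G w' v'‖ ≤
    S.K * (‖S.texp w - S.texp w'‖ + ‖S.texp v - S.texp v'‖) :=
  S.lip _ _ _ _ (S.norm_texp_lt _) (S.norm_texp_lt _) (S.norm_texp_lt _) (S.norm_texp_lt _)

lemma norm_f_sub_α_le {x y : ℂ} (hx : ‖x‖ < S.r) (hy : ‖y‖ < S.r) :
    ‖S.f (x, y) - S.α‖ ≤ S.α / 32 := by
  have := S.lip x y 0 0 hx hy (by simpa using S.r_pos) (by simpa using S.r_pos)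
  rw [S.zero, sub_zero, sub_zero] at this
  have h1 := S.K_small
  have h2 := mul_le_mul_of_nonneg_left (add_le_add hx.le hy.le) S.K_pos.le
  nlinarith

lemma norm_G_sub_α_le (w v : ℂ) : ‖S.G w v - S.α‖ ≤ S.α / 32 :=
  S.norm_f_sub_α_le (S.norm_texp_lt _) (S.norm_texp_lt _)

lemma norm_f_le {x y : ℂ} (hx : ‖x‖ < S.r) (hy : ‖y‖ < S.r) : ‖S.f (x, y)‖ ≤ 2 * S.α := by
  have h1 := S.norm_f_sub_α_le hx hy
  have h2 := norm_add_le (S.f (x, y) - S.α) (S.α : ℂ)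
  rw [sub_add_cancel, Complex.norm_of_nonneg S.α_pos.le] at h2
  linarith [S.α_pos]

lemma le_norm_f {x y : ℂ} (hx : ‖x‖ < S.r) (hy : ‖y‖ < S.r) : S.α / 2 ≤ ‖S.f (x, y)‖ := by
  have h1 := S.norm_f_sub_α_le hx hy
  have h2 := norm_sub_norm_le (S.α : ℂ) (S.α - S.f (x, y))
  rw [sub_sub_cancel, Complex.norm_of_nonneg S.α_pos.le, norm_sub_rev] at h2
  linarith [S.α_pos]

lemma f_ne_zero {x y : ℂ} (hx : ‖x‖ < S.r) (hy : ‖y‖ < S.r) : S.f (x, y) ≠ 0 := by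
  intro h
  have := S.le_norm_f hx hy
  rw [h, norm_zero] at this
  linarith [S.α_pos]

lemma norm_inv_f_le {x y : ℂ} (hx : ‖x‖ < S.r) (hy : ‖y‖ < S.r) :
    ‖(S.f (x, y))⁻¹‖ ≤ 2 / S.α := by
  rw [norm_inv, ← inv_div]
  exact inv_anti₀ (by linarith [S.α_pos]) (S.le_norm_f hx hy)

lemma norm_inv_f_sub_le {x y x' y' : ℂ} (hx : ‖x‖ < S.r) (hy : ‖y‖ < S.r) (hx' : ‖x'‖ < S.r)
    (hy' : ‖y'‖ < S.r) : ‖(S.f (x, y))⁻¹ - (S.f (x', y'))⁻¹‖ ≤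
      4 * S.K / S.α ^ 2 * (‖x - x'‖ + ‖y - y'‖) := by
  have e : (S.f (x, y))⁻¹ - (S.f (x', y'))⁻¹ =
      (S.f (x, y))⁻¹ * (S.f (x', y'))⁻¹ * (S.f (x', y') - S.f (x, y)) := by
    have := S.f_ne_zero hx hy
    have := S.f_ne_zero hx' hy'
    field_simp
  rw [e, norm_mul, norm_mul, norm_sub_rev]
  have h1 := mul_le_mul (S.norm_inv_f_le hx hy) (S.norm_inv_f_le hx' hy') (norm_nonneg _)
    (by have := S.α_pos; positivity)
  have h2 := mul_le_mul h1 (S.lip x y x' y' hx hy hx' hy') (norm_nonneg _)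
    (by have := S.α_pos; positivity)
  refine h2.trans_eq ?_
  have := S.α_pos.ne'
  field_simp
  ring

lemma G_ne_zero (w v : ℂ) : S.G w v ≠ 0 := S.f_ne_zero (S.norm_texp_lt _) (S.norm_texp_lt _)

lemma norm_G_le (w v : ℂ) : ‖S.G w v‖ ≤ 2 * S.α := S.norm_f_le (S.norm_texp_lt _) (S.norm_texp_lt _)

lemma norm_G_sub_le_b (w v w' v' : ℂ) : ‖S.G w v - S.G w' v'‖ ≤
    S.K * S.b * (‖w - w'‖ + ‖v - v'‖) := by
  have := mul_le_mul_of_nonneg_left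
    (add_le_add (S.norm_texp_sub_le_b w w') (S.norm_texp_sub_le_b v v')) S.K_pos.le
  linarith [S.norm_G_sub_le w v w' v']

lemma continuous_G : Continuous fun p : ℂ × ℂ => S.G p.1 p.2 := by
  have : LipschitzWith (Real.toNNReal (2 * (S.K * S.b))) fun p : ℂ × ℂ => S.G p.1 p.2 := by
    refine LipschitzWith.of_dist_le_mul fun p q => ?_
    have h0 := mul_pos S.K_pos S.b_pos
    rw [Real.coe_toNNReal _ (by positivity), dist_eq_norm, dist_eq_norm]
    refine (S.norm_G_sub_le_b _ _ _ _).trans ?_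
    have h1 : ‖p.1 - q.1‖ ≤ ‖p - q‖ := norm_fst_le (p - q)
    have h2 : ‖p.2 - q.2‖ ≤ ‖p - q‖ := norm_snd_le (p - q)
    nlinarith
  exact this.continuous

lemma G_add_period (w v : ℂ) (m n : ℤ) :
    S.G (w + m * (2 * Real.pi * Complex.I)) (v + n * (2 * Real.pi * Complex.I)) = S.G w v := by
  unfold G; rw [texp_add_period, texp_add_period]

lemma G_conj (w v : ℂ) :
    S.G (starRingEnd ℂ w) (starRingEnd ℂ v) = starRingEnd ℂ (S.G w v) := by
  unfold G
  rw [texp_conj, texp_conj, S.conj _ _ (S.norm_texp_lt _) (S.norm_texp_lt _)]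

/-- The part of the logarithmic chart where the cut-off is not active. -/
def chart : Set (ℂ × ℂ) := {p | p.1.re < Real.log S.b ∧ p.2.re < Real.log S.b}

lemma isOpen_chart : IsOpen S.chart :=
  (isOpen_lt (Complex.continuous_re.comp continuous_fst) continuous_const).inter
    (isOpen_lt (Complex.continuous_re.comp continuous_snd) continuous_const)

lemma analyticAt_G {p : ℂ × ℂ} (hp : p ∈ S.chart) :
    AnalyticAt ℂ (fun p : ℂ × ℂ => S.G p.1 p.2) p := by
  have hlt : ∀ u : ℝ, u < Real.log S.b → Real.exp u < S.r := fun u hu =>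
    ((Real.lt_log_iff_exp_lt S.b_pos).1 hu).trans S.b_lt
  have h : AnalyticAt ℂ (fun p : ℂ × ℂ => S.f (Complex.exp p.1, Complex.exp p.2)) p := by
    refine AnalyticAt.fun_comp (f := fun p : ℂ × ℂ => (Complex.exp p.1, Complex.exp p.2)) (g := S.f)
      (S.analytic _ ?_) (AnalyticAt.prod analyticAt_fst.cexp analyticAt_snd.cexp)
    simp only [mem_prod, mem_ball_zero_iff, Complex.norm_exp]
    exact ⟨hlt _ hp.1, hlt _ hp.2⟩
  refine h.congr ?_
  filter_upwards [S.isOpen_chart.mem_nhds hp] with q hq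
  unfold G
  rw [S.texp_eq hq.1.le, S.texp_eq hq.2.le]

/-- In the vertical direction the logarithmic slope varies at most at the rate `|y|`. -/
lemma norm_fderiv_G_le {p : ℂ × ℂ} (hp : p ∈ S.chart) :
    ‖fderiv ℂ (fun p : ℂ × ℂ => S.G p.1 p.2) p (0, 1)‖ ≤ 2 * S.K * Real.exp p.2.re := by
  have h1 : HasDerivAt (fun v : ℂ => S.G p.1 v)
      (fderiv ℂ (fun p : ℂ × ℂ => S.G p.1 p.2) p (0, 1)) p.2 := by
    have := (S.analyticAt_G hp).differentiableAt.hasFDerivAt.comp_hasDerivAt p.2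
      (f := fun v : ℂ => (p.1, v)) ((hasDerivAt_const p.2 p.1).prodMk (hasDerivAt_id p.2))
    exact this
  have hK := S.K_pos
  refine h1.le_of_lip' (by positivity) ?_
  have : ∀ᶠ v : ℂ in 𝓝 p.2, v.re < p.2.re + Real.log 2 :=
    Complex.continuous_re.continuousAt.eventually (gt_mem_nhds (by
      have := Real.log_pos one_lt_two
      linarith))
  filter_upwards [this] with v hv
  refine (S.norm_G_sub_le _ _ _ _).trans ?_
  have h2 := S.norm_texp_sub_le hv.le (by have := Real.log_pos one_lt_two; linarith : p.2.re ≤ _)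
  rw [Real.exp_add, Real.exp_log two_pos] at h2
  rw [sub_self, norm_zero, zero_add]
  have := mul_le_mul_of_nonneg_left h2 hK.le
  linarith

end Saddle

/-! ### The first integral given by the section `{x = c₂}` -/

namespace Saddle

variable (S : Saddle)

/-- The logarithm of the height of the section `{y = c₁}`. -/
noncomputable def l₁ : ℝ := Real.log S.c₁

/-- The logarithm of the abscissa of the section `{x = c₂}`. -/
noncomputable def l₂ : ℝ := Real.log S.c₂

lemma l₁_lt : S.l₁ < Real.log S.b := Real.log_lt_log S.c₁_pos S.c₁_lt

lemma l₂_lt : S.l₂ < Real.log S.b := Real.log_lt_log S.c₂_pos S.c₂_lt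

/-- The equation of the leaves over the segment from `w` to `l₂`, parametrised by `s ∈ [0, 1]`. -/
noncomputable def radialField (s : ℝ) (w y : ℂ) : ℂ :=
  -((S.l₂ - w) * S.G (w + s * (S.l₂ - w)) y)

lemma lipschitz_radialField (w : ℂ) (s : ℝ) :
    LipschitzWith (Real.toNNReal (‖S.l₂ - w‖ * (S.K * S.b))) (S.radialField s w) := by
  have hb := S.b_pos
  have hK := S.K_pos
  refine LipschitzWith.of_dist_le_mul fun y z => ?_
  rw [Real.coe_toNNReal _ (by positivity), dist_eq_norm, dist_eq_norm]
  unfold radialField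
  rw [← neg_sub', norm_neg, ← mul_sub, norm_mul, mul_assoc]
  refine mul_le_mul_of_nonneg_left ?_ (norm_nonneg _)
  simpa using S.norm_G_sub_le_b (w + s * (S.l₂ - w)) y (w + s * (S.l₂ - w)) z

lemma continuous_radialField (w : ℂ) {y : ℝ → ℂ} (hy : Continuous y) :
    Continuous fun s => S.radialField s w (y s) := by
  unfold radialField
  have := S.continuous_G.comp (f := fun s : ℝ => (w + s * (S.l₂ - w), y s)) (by fun_prop)
  exact (continuous_const.mul this).neg

lemma exists_transport (p : ℂ × ℂ) :
    ∃ y : ℝ → ℂ, y 0 = p.2 ∧ ∀ s, HasDerivAt y (S.radialField s p.1 (y s)) s := by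
  have hα := S.α_pos
  refine exists_global_solution (L := Real.toNNReal (‖S.l₂ - p.1‖ * (2 * S.α)))
    (fun y => S.continuous_radialField p.1 continuous_const) (S.lipschitz_radialField p.1)
    (fun s y => ?_) p.2
  rw [Real.coe_toNNReal _ (by positivity)]
  unfold radialField
  rw [norm_neg, norm_mul]
  exact mul_le_mul_of_nonneg_left (S.norm_G_le _ _) (norm_nonneg _)

/-- The leaf through `p = (w, v)` over the segment from `w` to `l₂`. -/
noncomputable def transport (p : ℂ × ℂ) : ℝ → ℂ := (S.exists_transport p).choose

lemma transport_zero (p : ℂ × ℂ) : S.transport p 0 = p.2 := (S.exists_transport p).choose_spec.1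

lemma hasDerivAt_transport (p : ℂ × ℂ) (s : ℝ) :
    HasDerivAt (S.transport p) (S.radialField s p.1 (S.transport p s)) s :=
  (S.exists_transport p).choose_spec.2 s

lemma continuous_transport (p : ℂ × ℂ) : Continuous (S.transport p) :=
  continuous_iff_continuousAt.2 fun s => (S.hasDerivAt_transport p s).continuousAt

lemma transport_unique {p : ℂ × ℂ} {y : ℝ → ℂ} (h0 : y 0 = p.2)
    (hy : ∀ s, HasDerivAt y (S.radialField s p.1 (y s)) s) : S.transport p = y :=
  ODE_solution_unique_univ (v := fun s y => S.radialField s p.1 y) (s := fun _ => univ) (t₀ := 0)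
    (fun s => (S.lipschitz_radialField p.1 s).lipschitzOnWith)
    (fun s => ⟨S.hasDerivAt_transport p s, mem_univ _⟩) (fun s => ⟨hy s, mem_univ _⟩)
    (by rw [transport_zero, h0])

/-- The first integral of the foliation that sends a point of the logarithmic chart to the
ordinate (in logarithmic coordinates) at which its leaf, followed over a straight segment, meets the
section `{x = c₂}`. -/
noncomputable def firstIntegral (p : ℂ × ℂ) : ℂ := S.transport p 1

lemma firstIntegral_transport (p : ℂ × ℂ) (s₀ : ℝ) :
    S.firstIntegral (p.1 + s₀ * (S.l₂ - p.1), S.transport p s₀) = S.firstIntegral p := by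
  have : S.transport (p.1 + s₀ * (S.l₂ - p.1), S.transport p s₀) =
      fun s => S.transport p (s₀ + (1 - s₀) * s) := by
    refine S.transport_unique (by simp) fun s => ?_
    have h1 : HasDerivAt (fun s : ℝ => s₀ + (1 - s₀) * s) (1 - s₀) s := by
      simpa using ((hasDerivAt_id s).const_mul (1 - s₀)).const_add s₀
    have h2 := (S.hasDerivAt_transport p (s₀ + (1 - s₀) * s)).scomp s h1
    refine h2.congr_deriv ?_
    unfold radialField
    have e : p.1 + ((s₀ + (1 - s₀) * s : ℝ) : ℂ) * (S.l₂ - p.1) =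
        p.1 + s₀ * (S.l₂ - p.1) + s * (S.l₂ - (p.1 + s₀ * (S.l₂ - p.1))) := by
      push_cast; ring
    rw [e, Complex.real_smul]
    push_cast
    ring
  unfold firstIntegral
  rw [this]
  simp

lemma firstIntegral_add_period (w v : ℂ) (n : ℤ) :
    S.firstIntegral (w, v + n * (2 * Real.pi * Complex.I)) =
      S.firstIntegral (w, v) + n * (2 * Real.pi * Complex.I) := by
  have : S.transport (w, v + n * (2 * Real.pi * Complex.I)) =
      fun s => S.transport (w, v) s + n * (2 * Real.pi * Complex.I) := by
    refine S.transport_unique (by simp [transport_zero]) fun s => ?_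
    refine ((S.hasDerivAt_transport (w, v) s).add_const _).congr_deriv ?_
    unfold radialField
    have := S.G_add_period (w + s * (S.l₂ - w)) (S.transport (w, v) s) 0 n
    simp only [Int.cast_zero, zero_mul, add_zero] at this
    rw [this]
  unfold firstIntegral
  rw [this]

lemma transport_conj (w v : ℂ) :
    S.transport (starRingEnd ℂ w, starRingEnd ℂ v) =
      fun s => starRingEnd ℂ (S.transport (w, v) s) := by
  refine S.transport_unique (by simp [transport_zero]) fun s => ?_
  refine (S.hasDerivAt_transport (w, v) s).star.congr_deriv ?_
  unfold radialField
  have e : starRingEnd ℂ w + s * (S.l₂ - starRingEnd ℂ w) =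
    starRingEnd ℂ (w + s * (S.l₂ - w)) := by simp
  simp only [e, S.G_conj]
  simp

lemma firstIntegral_conj (w v : ℂ) :
    S.firstIntegral (starRingEnd ℂ w, starRingEnd ℂ v) =
      starRingEnd ℂ (S.firstIntegral (w, v)) := by
  unfold firstIntegral
  rw [transport_conj]

/-- On a real leaf in the half-plane `{x > 0}`, in either quadrant, the argument of `y` is
constant. -/
lemma firstIntegral_im (u v : ℝ) (k : ℤ) :
    (S.firstIntegral (u, v + k * Real.pi * Complex.I)).im = k * Real.pi := by
  have h1 := S.firstIntegral_conj u (v + k * Real.pi * Complex.I)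
  have h2 := S.firstIntegral_add_period (starRingEnd ℂ u)
    (starRingEnd ℂ (v + k * Real.pi * Complex.I)) k
  rw [h1] at h2
  have e : starRingEnd ℂ ((v : ℂ) + k * Real.pi * Complex.I) + k * (2 * Real.pi * Complex.I) =
      v + k * Real.pi * Complex.I := by
    simp; ring
  rw [e, Complex.conj_ofReal] at h2
  have := congrArg Complex.im h2
  simp at this
  linarith

/-- The domain on which the first integral is holomorphic: there, the leaves can be followed along
the segment to `l₂`, and `|y|` decreases along it. -/
def sector : Set (ℂ × ℂ) := {p | p.1.re + |p.1.im| < S.l₂ ∧ p.2.re < Real.log S.b}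

lemma transport_re_le {p : ℂ × ℂ} (hp : p ∈ S.sector) {s : ℝ} (hs : 0 ≤ s) :
    (S.transport p s).re ≤ p.2.re - s * (S.α / 2 * (S.l₂ - p.1.re)) := by
  have hd : ∀ s, HasDerivAt (fun s => (S.transport p s).re + s * (S.α / 2 * (S.l₂ - p.1.re)))
      ((S.radialField s p.1 (S.transport p s)).re + 1 * (S.α / 2 * (S.l₂ - p.1.re))) s := fun s =>
    ((Complex.reCLM.hasFDerivAt.comp_hasDerivAt s (S.hasDerivAt_transport p s))).add
      ((hasDerivAt_id s).mul_const _)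
  have hanti : Antitone fun s => (S.transport p s).re + s * (S.α / 2 * (S.l₂ - p.1.re)) := by
    refine antitone_of_hasDerivAt_nonpos hd fun s => ?_
    unfold radialField
    set g := S.G (p.1 + s * (S.l₂ - p.1)) (S.transport p s) with hg
    have hb := S.norm_G_sub_α_le (p.1 + s * (S.l₂ - p.1)) (S.transport p s)
    rw [← hg] at hb
    have h1 := (Complex.abs_re_le_norm _).trans hb
    have h2 := (Complex.abs_im_le_norm _).trans hb
    simp only [Complex.sub_re, Complex.sub_im, Complex.ofReal_re, Complex.ofReal_im, sub_zero]
      at h1 h2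
    have h3 := hp.1
    have h4 := S.α_pos
    simp only [Complex.neg_re, Complex.mul_re, Complex.sub_re, Complex.sub_im, Complex.ofReal_re,
      Complex.ofReal_im, zero_sub]
    have h5 : |p.1.im * g.im| ≤ (S.l₂ - p.1.re) * (S.α / 32) := by
      rw [abs_mul]
      exact mul_le_mul (by linarith) h2 (abs_nonneg _) (by linarith [abs_nonneg p.1.im])
    have h6 := (abs_le.1 h5).1
    have h7 := (abs_le.1 h1).1
    have h8 : 0 < S.l₂ - p.1.re := by linarith [abs_nonneg p.1.im]
    show -((S.l₂ - p.1.re) * g.re - -p.1.im * g.im) + 1 * (S.α / 2 * (S.l₂ - p.1.re)) ≤ 0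
    nlinarith
  have := hanti hs
  simp only [transport_zero, zero_mul, add_zero] at this
  linarith

lemma segment_mem_chart {p : ℂ × ℂ} (hp : p ∈ S.sector) {s : ℝ} (hs : s ∈ Icc (0 : ℝ) 1) :
    (p.1 + s * (S.l₂ - p.1), S.transport p s) ∈ S.chart := by
  have h3 : 0 < S.l₂ - p.1.re := by linarith [abs_nonneg p.1.im, hp.1]
  have h1 := S.transport_re_le hp hs.1
  have h2 := S.l₂_lt
  have hα := S.α_pos
  refine ⟨?_, ?_⟩
  · simp only [Complex.add_re, Complex.mul_re, Complex.ofReal_re, Complex.ofReal_im, zero_mul,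
      sub_zero, Complex.sub_re]
    nlinarith [hs.2]
  · have : 0 ≤ s * (S.α / 2 * (S.l₂ - p.1.re)) := by have := hs.1; positivity
    have := hp.2
    show (S.transport p s).re < _
    linarith

lemma integral_exp_neg_mul_le {m : ℝ} (hm : 0 < m) :
    ∫ s in (0 : ℝ)..1, Real.exp (-(s * m)) ≤ 1 / m := by
  have hd : ∀ s, HasDerivAt (fun s => -(Real.exp (-(s * m)) / m)) (Real.exp (-(s * m))) s := by
    intro s
    have := ((((hasDerivAt_id s).mul_const m).neg.exp).div_const m).neg
    refine this.congr_deriv ?_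
    simp only [Pi.neg_apply, id]
    field_simp
  rw [intervalIntegral.integral_eq_sub_of_hasDerivAt (fun s _ => hd s)
    (Continuous.intervalIntegrable (by fun_prop) _ _)]
  have : 0 < Real.exp (-(1 * m)) / m := by positivity
  simp only [zero_mul, neg_zero, Real.exp_zero]
  linarith

/-- The first integral is holomorphic in both variables. Its differential is a multiple of
`dv + G dw`, and the factor is close to `1`, since `∂G/∂v` is `O(|y|)` and `|y|` decreases
exponentially along the segment to `l₂`. -/
theorem exists_hasFDerivAt_firstIntegral {p : ℂ × ℂ} (hp : p ∈ S.sector) :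
    ∃ m : ℂ, ‖m - 1‖ ≤ 1 / 4 ∧ HasFDerivAt S.firstIntegral
      (m • (ContinuousLinearMap.snd ℂ ℂ ℂ + S.G p.1 p.2 • ContinuousLinearMap.fst ℂ ℂ ℂ)) p := by
  have hα := S.α_pos
  have hK := S.K_pos
  have hb := S.b_pos
  have hd : 0 < S.l₂ - p.1.re := by linarith [abs_nonneg p.1.im, hp.1]
  have hdn : ‖S.l₂ - p.1‖ ≤ 2 * (S.l₂ - p.1.re) := by
    have := Complex.norm_le_abs_re_add_abs_im (S.l₂ - p.1)
    simp only [Complex.sub_re, Complex.sub_im, Complex.ofReal_re, Complex.ofReal_im, zero_sub,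
      abs_neg] at this
    rw [abs_of_pos hd] at this
    linarith [hp.1]
  -- time is clamped to `[0, 1]`, so that the coefficients of the linearised equation are continuous
  -- on all of `ℝ`
  let π : ℝ → ℝ := fun t => (projIcc (0 : ℝ) 1 zero_le_one t : ℝ)
  have hπc : Continuous π := continuous_subtype_val.comp continuous_projIcc
  have hπm : ∀ t, π t ∈ Icc (0 : ℝ) 1 := fun t => (projIcc (0 : ℝ) 1 zero_le_one t).2
  have hπe : ∀ t ∈ Icc (0 : ℝ) 1, π t = t := fun t ht => by
    simp only [π]; rw [projIcc_of_mem _ ht]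
  let q : ℝ → ℂ × ℂ := fun t => (p.1 + π t * (S.l₂ - p.1), S.transport p (π t))
  have hqc : Continuous q := by
    have := (S.continuous_transport p).comp hπc
    exact Continuous.prodMk (by fun_prop) this
  have hqm : ∀ t, q t ∈ S.chart := fun t => S.segment_mem_chart hp (hπm t)
  let Gf : ℂ × ℂ → ℂ := fun p => S.G p.1 p.2
  have hdG : Continuous fun t => fderiv ℂ Gf (q t) := by
    refine continuous_iff_continuousAt.2 fun t => ?_
    exact (S.analyticAt_G (hqm t)).fderiv.continuousAt.comp hqc.continuousAt
  let a : ℝ → ℂ := fun t => -((S.l₂ - p.1) * fderiv ℂ Gf (q t) (0, 1))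
  let b : ℝ → ℂ := fun t =>
    S.G (q t).1 (q t).2 - (S.l₂ - p.1) * (1 - π t) * fderiv ℂ Gf (q t) (1, 0)
  have hac : Continuous a := (continuous_const.mul (hdG.clm_apply continuous_const)).neg
  have hbc : Continuous b := (S.continuous_G.comp hqc).sub
    ((continuous_const.mul (by fun_prop)).mul (hdG.clm_apply continuous_const))
  have hlip : ∀ᶠ p' in 𝓝 p, ∀ t ∈ Icc (0 : ℝ) 1, ∀ z z',
      ‖S.radialField t p'.1 z - S.radialField t p.1 z'‖ ≤
        (2 * S.α + (‖S.l₂ - p.1‖ + 1) * (S.K * S.b)) * (‖p'.1 - p.1‖ + ‖z - z'‖) := by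
    have : ∀ᶠ p' : ℂ × ℂ in 𝓝 p, ‖S.l₂ - p'.1‖ < ‖S.l₂ - p.1‖ + 1 :=
      (Continuous.tendsto (by fun_prop : Continuous fun p' : ℂ × ℂ => ‖S.l₂ - p'.1‖) p).eventually
        (gt_mem_nhds (lt_add_one _))
    filter_upwards [this] with p' hp' t ht z z'
    have e : S.radialField t p'.1 z - S.radialField t p.1 z' =
        (p'.1 - p.1) * S.G (p.1 + t * (S.l₂ - p.1)) z' +
          -((S.l₂ - p'.1) * (S.G (p'.1 + t * (S.l₂ - p'.1)) z -
            S.G (p.1 + t * (S.l₂ - p.1)) z')) := by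
      unfold radialField; ring
    rw [e]
    refine (norm_add_le _ _).trans ?_
    rw [norm_neg, norm_mul, norm_mul]
    have h1 := mul_le_mul_of_nonneg_left (S.norm_G_le (p.1 + t * (S.l₂ - p.1)) z')
      (norm_nonneg (p'.1 - p.1))
    have h2 := S.norm_G_sub_le_b (p'.1 + t * (S.l₂ - p'.1)) z (p.1 + t * (S.l₂ - p.1)) z'
    have h3 : ‖p'.1 + t * (S.l₂ - p'.1) - (p.1 + t * (S.l₂ - p.1))‖ ≤ ‖p'.1 - p.1‖ := by
      have : p'.1 + t * (S.l₂ - p'.1) - (p.1 + t * (S.l₂ - p.1)) =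
        ((1 - t : ℝ) : ℂ) * (p'.1 - p.1) := by push_cast; ring
      rw [this, norm_mul, Complex.norm_of_nonneg (by linarith [ht.2])]
      nlinarith [norm_nonneg (p'.1 - p.1), ht.1]
    have h4 : ‖S.G (p'.1 + t * (S.l₂ - p'.1)) z - S.G (p.1 + t * (S.l₂ - p.1)) z'‖ ≤
        S.K * S.b * (‖p'.1 - p.1‖ + ‖z - z'‖) :=
      h2.trans (mul_le_mul_of_nonneg_left (by linarith) (by positivity))
    have h5 := mul_le_mul hp'.le h4 (norm_nonneg _) (by positivity)
    nlinarith [norm_nonneg (p'.1 - p.1), norm_nonneg (z - z')]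
  have hF : ∀ t ∈ Icc (0 : ℝ) 1, HasFDerivAt (fun q : ℂ × ℂ => S.radialField t q.1 q.2)
      (b t • ContinuousLinearMap.fst ℂ ℂ ℂ + a t • ContinuousLinearMap.snd ℂ ℂ ℂ)
      (p.1, S.transport p t) := by
    intro t ht
    have hqt : q t = (p.1 + t * (S.l₂ - p.1), S.transport p t) := by
      simp only [q]; rw [hπe t ht]
    have h1 : HasFDerivAt (fun z : ℂ × ℂ => (z.1 + t * (S.l₂ - z.1), z.2))
        ((((1 - t : ℝ) : ℂ) • ContinuousLinearMap.fst ℂ ℂ ℂ).prod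
          (ContinuousLinearMap.snd ℂ ℂ ℂ)) (p.1, S.transport p t) := by
      refine HasFDerivAt.prodMk ?_ hasFDerivAt_snd
      have e : (fun z : ℂ × ℂ => z.1 + t * (S.l₂ - z.1)) =
          fun z : ℂ × ℂ => (((1 - t : ℝ) : ℂ) • ContinuousLinearMap.fst ℂ ℂ ℂ) z + t * S.l₂ := by
        ext z
        simp only [smul_apply, ContinuousLinearMap.coe_fst', smul_eq_mul]
        push_cast; ring
      rw [e]
      exact (ContinuousLinearMap.hasFDerivAt _).add_const _
    have h2 : HasFDerivAt Gf (fderiv ℂ Gf (q t)) (p.1 + t * (S.l₂ - p.1), S.transport p t) := by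
      rw [← hqt]
      exact (S.analyticAt_G (hqm t)).differentiableAt.hasFDerivAt
    have h3 := h2.comp (p.1, S.transport p t) h1
    have h4 : HasFDerivAt (fun z : ℂ × ℂ => (S.l₂ : ℂ) - z.1)
        (-ContinuousLinearMap.fst ℂ ℂ ℂ) (p.1, S.transport p t) := by
      simpa using (hasFDerivAt_fst (𝕜 := ℂ) (p := (p.1, S.transport p t))).const_sub (S.l₂ : ℂ)
    have h5 := (h4.mul h3).neg
    refine h5.congr_fderiv ?_
    have hGq : Gf (p.1 + t * (S.l₂ - p.1), S.transport p t) = S.G (q t).1 (q t).2 := by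
      rw [hqt]
    have hlin : fderiv ℂ Gf (q t) (1 - (t : ℂ), 0) = (1 - (t : ℂ)) * fderiv ℂ Gf (q t) (1, 0) := by
      rw [← smul_eq_mul, ← map_smul]; simp
    ext
    · simp only [a, b, hπe t ht, Function.comp_def, hGq]
      simp [hlin]
      ring
    · simp only [a, b, hπe t ht, Function.comp_def, hGq]
      simp
  have hmain := hasFDerivAt_solution (F := fun t w y => S.radialField t w y) (p₀ := p)
    (L := 2 * S.α + (‖S.l₂ - p.1‖ + 1) * (S.K * S.b)) (a := a) (b := b) (by positivity)
    S.transport_zero S.hasDerivAt_transport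
    (fun p => S.continuous_radialField p.1 (S.continuous_transport p)) hlip hF hac hbc
  -- `exp κ` is the derivative with respect to `v`; `|a t| ≤ const · (l₂ - Re w) exp (- m t)` with
  -- `m = α (l₂ - Re w) / 2`, so the length of the segment cancels from the bound of `κ`
  set κ : ℂ := ∫ t in (0 : ℝ)..1, a t with hκ
  set c : ℂ := ∫ t in (0 : ℝ)..1, Complex.exp (-∫ s in (0 : ℝ)..t, a s) * b t
  have hκn : ‖κ‖ ≤ 1 / 8 := by
    set m : ℝ := S.α / 2 * (S.l₂ - p.1.re) with hm
    have hmp : 0 < m := by positivity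
    have h1 : ‖κ‖ ≤ ∫ s in (0 : ℝ)..1, (2 * (S.l₂ - p.1.re) * (2 * S.K * S.b)) *
        Real.exp (-(s * m)) := by
      refine intervalIntegral.norm_integral_le_of_norm_le zero_le_one ?_
        (Continuous.intervalIntegrable (by fun_prop) _ _)
      refine Eventually.of_forall fun t ht => ?_
      have ht' : t ∈ Icc (0 : ℝ) 1 := ⟨ht.1.le, ht.2⟩
      simp only [a]
      rw [norm_neg, norm_mul, mul_assoc]
      refine mul_le_mul hdn ((S.norm_fderiv_G_le (hqm t)).trans ?_) (norm_nonneg _) (by positivity)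
      rw [mul_assoc, mul_assoc, mul_assoc]
      refine mul_le_mul_of_nonneg_left (mul_le_mul_of_nonneg_left ?_ hK.le) two_pos.le
      have h2 := S.transport_re_le hp ht'.1
      have h3 : (q t).2.re ≤ Real.log S.b + -(t * m) := by
        have h4 : p.2.re < Real.log S.b := hp.2
        simp only [q]
        rw [← hm] at h2
        rw [hπe t ht']
        linarith
      calc Real.exp (q t).2.re ≤ Real.exp (Real.log S.b + -(t * m)) := Real.exp_le_exp.2 h3
        _ = S.b * Real.exp (-(t * m)) := by rw [Real.exp_add, Real.exp_log hb]
    rw [intervalIntegral.integral_const_mul] at h1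
    have h2 := mul_le_mul_of_nonneg_left (integral_exp_neg_mul_le hmp)
      (by positivity : 0 ≤ 2 * (S.l₂ - p.1.re) * (2 * S.K * S.b))
    refine (h1.trans h2).trans ?_
    have h3 := S.K_small
    have h4 := mul_lt_mul_of_pos_left S.b_lt hK
    rw [hm, mul_one_div, div_le_iff₀ (by positivity)]
    have h5 : 64 * (S.K * S.b) ≤ S.α := by linarith
    nlinarith
  refine ⟨Complex.exp κ, ?_, ?_⟩
  · have := Complex.norm_exp_sub_one_le (x := κ) (by linarith)
    linarith
  -- along the segment itself the first integral is constant, which determines the other partial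
  have hc : c = S.G p.1 p.2 := by
    have hline : HasDerivAt (fun s : ℝ => (p.1 + s * (S.l₂ - p.1), S.transport p s))
        ((S.l₂ - p.1, S.radialField 0 p.1 (S.transport p 0))) 0 := by
      refine HasDerivAt.prodMk ?_ (S.hasDerivAt_transport p 0)
      simpa using ((Complex.ofRealCLM.hasDerivAt (x := (0 : ℝ))).mul_const
        ((S.l₂ : ℂ) - p.1)).const_add p.1
    have hpt : (p.1 + ((0 : ℝ) : ℂ) * (S.l₂ - p.1), S.transport p 0) = p := by
      simp [transport_zero]
    have hcomp := HasFDerivAt.comp_hasDerivAt_of_eq (0 : ℝ)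
      (hmain.restrictScalars ℝ) hline hpt.symm
    have hconst : ((fun p => S.transport p 1) ∘
        fun s : ℝ => (p.1 + s * (S.l₂ - p.1), S.transport p s)) = fun _ => S.firstIntegral p := by
      ext s; exact S.firstIntegral_transport p s
    rw [hconst] at hcomp
    have h0 := hcomp.unique (hasDerivAt_const (0 : ℝ) (S.firstIntegral p))
    unfold radialField at h0
    simp [transport_zero] at h0
    have hne : (S.l₂ : ℂ) - p.1 ≠ 0 := by
      intro h
      have := congrArg Complex.re h
      simp at this
      linarith
    have : Complex.exp κ * (S.l₂ - p.1) * (c - S.G p.1 p.2) = 0 := by linear_combination h0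
    exact sub_eq_zero.1 ((mul_eq_zero.1 this).resolve_left
      (mul_ne_zero (Complex.exp_ne_zero _) hne))
  rw [← hc]
  exact hmain

/-- The first integral is constant along the leaves. -/
theorem firstIntegral_eq_of_leaf {w w' v v' : ℝ → ℂ} {a b : ℝ}
    (hmem : ∀ t ∈ uIcc a b, (w t, v t) ∈ S.sector)
    (hw : ∀ t ∈ uIcc a b, HasDerivAt w (w' t) t) (hv : ∀ t ∈ uIcc a b, HasDerivAt v (v' t) t)
    (hleaf : ∀ t ∈ uIcc a b, v' t = -S.G (w t) (v t) * w' t) :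
    S.firstIntegral (w a, v a) = S.firstIntegral (w b, v b) := by
  have hd : ∀ t ∈ uIcc a b, HasDerivAt (fun t => S.firstIntegral (w t, v t)) 0 t := by
    intro t ht
    obtain ⟨m, -, hm⟩ := S.exists_hasFDerivAt_firstIntegral (hmem t ht)
    have := (hm.restrictScalars ℝ).comp_hasDerivAt t ((hw t ht).prodMk (hv t ht))
    refine this.congr_deriv ?_
    simp [hleaf t ht]
  have := intervalIntegral.integral_eq_sub_of_hasDerivAt hd (by simp)
  simp only [intervalIntegral.integral_zero] at this
  exact (sub_eq_zero.1 this.symm).symm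

end Saddle

/-! ### The Dulac map -/

namespace Saddle

variable (S : Saddle)

/-- The sector of the logarithmic chart of the section `{y = c₁}` to which the Dulac map is
continued. -/
def wedge : Set ℂ := {w | w.re + |w.im| < S.l₂}

/-- The logarithm of the Dulac map, in the logarithmic coordinate of `{y = c₁}`. -/
noncomputable def logDulac (w : ℂ) : ℂ := S.firstIntegral (w, S.l₁)

lemma mem_sector_of_mem_wedge {w : ℂ} (hw : w ∈ S.wedge) : (w, (S.l₁ : ℂ)) ∈ S.sector :=
  ⟨hw, by simpa using S.l₁_lt⟩

lemma isOpen_wedge : IsOpen S.wedge :=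
  isOpen_lt (Complex.continuous_re.add Complex.continuous_im.abs) continuous_const

lemma convex_wedge : Convex ℝ S.wedge := by
  intro x hx y hy a b ha hb hab
  have hx' : x.re + |x.im| < S.l₂ := hx
  have hy' : y.re + |y.im| < S.l₂ := hy
  show (a • x + b • y).re + |(a • x + b • y).im| < S.l₂
  simp only [Complex.add_re, Complex.add_im, Complex.smul_re, Complex.smul_im, smul_eq_mul]
  have h1 := abs_add_le (a * x.im) (b * y.im)
  rw [abs_mul, abs_mul, abs_of_nonneg ha, abs_of_nonneg hb] at h1
  rcases ha.eq_or_lt with h | h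
  · have : b = 1 := by linarith
    subst h this; simpa using hy'
  · have h2 := mul_lt_mul_of_pos_left hx' h
    have h3 := mul_le_mul_of_nonneg_left hy'.le hb
    have h4 : a * S.l₂ + b * S.l₂ = S.l₂ := by rw [← add_mul, hab, one_mul]
    linarith

/-- The logarithm of the Dulac map is close to multiplication by `α`. -/
lemma exists_hasDerivAt_logDulac {w : ℂ} (hw : w ∈ S.wedge) :
    ∃ m : ℂ, HasDerivAt S.logDulac m w ∧ ‖m - S.α‖ ≤ S.α / 2 := by
  obtain ⟨m, hm1, hm⟩ := S.exists_hasFDerivAt_firstIntegral (S.mem_sector_of_mem_wedge hw)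
  have h1 := hm.comp_hasDerivAt w ((hasDerivAt_id w).prodMk (hasDerivAt_const w (S.l₁ : ℂ)))
  refine ⟨m * S.G w S.l₁, ?_, ?_⟩
  · refine h1.congr_deriv ?_
    simp
  · have e : m * S.G w S.l₁ - S.α = m * (S.G w S.l₁ - S.α) + (m - 1) * S.α := by ring
    rw [e]
    refine (norm_add_le _ _).trans ?_
    rw [norm_mul, norm_mul, Complex.norm_of_nonneg S.α_pos.le]
    have h2 : ‖m‖ ≤ 5 / 4 := by
      have := norm_add_le (m - 1) 1
      rw [sub_add_cancel, norm_one] at this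
      linarith
    have h3 := mul_le_mul h2 (S.norm_G_sub_α_le w S.l₁) (norm_nonneg _) (by norm_num)
    have h4 := mul_le_mul_of_nonneg_right hm1 S.α_pos.le
    linarith [S.α_pos]

lemma norm_logDulac_sub_le {w w' : ℂ} (hw : w ∈ S.wedge) (hw' : w' ∈ S.wedge) :
    ‖S.logDulac w - S.logDulac w' - S.α * (w - w')‖ ≤ S.α / 2 * ‖w - w'‖ := by
  have hd : ∀ z ∈ S.wedge, ∃ m : ℂ, HasDerivAt (fun z => S.logDulac z - S.α * z) m z ∧
      ‖m‖ ≤ S.α / 2 := by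
    intro z hz
    obtain ⟨m, hm, hb⟩ := S.exists_hasDerivAt_logDulac hz
    refine ⟨m - S.α, ?_, hb⟩
    exact (hm.sub ((hasDerivAt_id z).const_mul (S.α : ℂ))).congr_deriv (by rw [mul_one])
  have := S.convex_wedge.norm_image_sub_le_of_norm_deriv_le (𝕜 := ℂ)
    (f := fun z => S.logDulac z - S.α * z) (C := S.α / 2)
    (fun z hz => (hd z hz).choose_spec.1.differentiableAt)
    (fun z hz => by rw [(hd z hz).choose_spec.1.deriv]; exact (hd z hz).choose_spec.2) hw' hw
  rwa [show S.logDulac w - S.α * w - (S.logDulac w' - S.α * w') =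
    S.logDulac w - S.logDulac w' - S.α * (w - w') by ring] at this

lemma analyticOnNhd_logDulac : AnalyticOnNhd ℂ S.logDulac S.wedge :=
  DifferentiableOn.analyticOnNhd (fun _ hw =>
    (S.exists_hasDerivAt_logDulac hw).choose_spec.1.differentiableAt.differentiableWithinAt)
    S.isOpen_wedge

lemma logDulac_ofReal_im (u : ℝ) : (S.logDulac u).im = 0 := by
  simpa [logDulac] using S.firstIntegral_im u S.l₁ 0

lemma abs_logDulac_im_sub_le {u φ φ' : ℝ} (h : (⟨u, φ⟩ : ℂ) ∈ S.wedge)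
    (h' : (⟨u, φ'⟩ : ℂ) ∈ S.wedge) :
    |(S.logDulac ⟨u, φ⟩).im - (S.logDulac ⟨u, φ'⟩).im - S.α * (φ - φ')| ≤
      S.α / 2 * |φ - φ'| := by
  have h1 := S.norm_logDulac_sub_le h h'
  have h2 := (Complex.abs_im_le_norm _).trans h1
  have e : (⟨u, φ⟩ : ℂ) - ⟨u, φ'⟩ = ((φ - φ' : ℝ) : ℂ) * Complex.I := by
    apply Complex.ext <;> simp
  rw [e, norm_mul, Complex.norm_I, Complex.norm_real, mul_one] at h2
  simpa using h2

/-- The imaginary part of the logarithm of the Dulac map is injective on vertical lines. -/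
lemma eq_of_logDulac_im_eq {u φ φ' : ℝ} (h : (⟨u, φ⟩ : ℂ) ∈ S.wedge)
    (h' : (⟨u, φ'⟩ : ℂ) ∈ S.wedge) (he : (S.logDulac ⟨u, φ⟩).im = (S.logDulac ⟨u, φ'⟩).im) :
    φ = φ' := by
  have := S.abs_logDulac_im_sub_le h h'
  rw [he, sub_self, zero_sub, abs_neg, abs_mul, abs_of_pos S.α_pos] at this
  have h0 : |φ - φ'| ≤ 0 := by
    have := S.α_pos
    by_contra hc
    push Not at hc
    nlinarith
  exact sub_eq_zero.1 (abs_nonpos_iff.1 h0)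

lemma abs_logDulac_im_le {w : ℂ} (hw : w ∈ S.wedge) :
    |(S.logDulac w).im| ≤ 3 / 2 * S.α * |w.im| := by
  have hw' : w.re + |w.im| < S.l₂ := hw
  have h0 : (⟨w.re, 0⟩ : ℂ) ∈ S.wedge := by
    show w.re + |(0 : ℝ)| < S.l₂
    rw [abs_zero]; linarith [abs_nonneg w.im]
  have h1 := S.abs_logDulac_im_sub_le (u := w.re) (φ := w.im) (φ' := 0) hw h0
  have h2 := S.logDulac_ofReal_im w.re
  have e : ((w.re : ℝ) : ℂ) = ⟨w.re, 0⟩ := rfl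
  rw [e] at h2
  rw [h2, sub_zero, sub_zero] at h1
  have h3 : |S.α * w.im| = S.α * |w.im| := by rw [abs_mul, abs_of_pos S.α_pos]
  have h4 := abs_add_le ((S.logDulac w).im - S.α * w.im) (S.α * w.im)
  rw [sub_add_cancel] at h4
  have h5 : |(S.logDulac w).im - S.α * w.im| ≤ S.α / 2 * |w.im| := h1
  linarith

end Saddle

/-! ### The holonomy of `{x = 0}` in the logarithmic coordinate -/

namespace Saddle

variable (S : Saddle)

/-- The equation of the leaves over the circle `y = c₁ exp(it)`, in the coordinate `w = log x`. -/
noncomputable def loopField (t : ℝ) (w : ℂ) : ℂ :=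
  -(Complex.I * (S.G w (S.l₁ + t * Complex.I))⁻¹)

lemma norm_loopField_le (t : ℝ) (w : ℂ) : ‖S.loopField t w‖ ≤ 2 / S.α := by
  unfold loopField
  rw [norm_neg, norm_mul, Complex.norm_I, one_mul]
  exact S.norm_inv_f_le (S.norm_texp_lt _) (S.norm_texp_lt _)

lemma norm_loopField_sub_le_texp (t : ℝ) (w w' : ℂ) : ‖S.loopField t w - S.loopField t w'‖ ≤
    4 * S.K / S.α ^ 2 * ‖S.texp w - S.texp w'‖ := by
  unfold loopField G
  rw [← neg_sub', norm_neg, ← mul_sub, norm_mul, Complex.norm_I, one_mul]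
  simpa using S.norm_inv_f_sub_le (S.norm_texp_lt w) (S.norm_texp_lt (S.l₁ + t * Complex.I))
    (S.norm_texp_lt w') (S.norm_texp_lt (S.l₁ + t * Complex.I))

lemma norm_loopField_sub_le (t : ℝ) (w w' : ℂ) : ‖S.loopField t w - S.loopField t w'‖ ≤
    4 * S.K / S.α ^ 2 * S.b * ‖w - w'‖ := by
  have hK := S.K_pos
  rw [mul_assoc]
  exact (S.norm_loopField_sub_le_texp t w w').trans
    (mul_le_mul_of_nonneg_left (S.norm_texp_sub_le_b w w') (by positivity))

lemma lipschitz_loopField (t : ℝ) :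
    LipschitzWith (Real.toNNReal (4 * S.K / S.α ^ 2 * S.b)) (S.loopField t) := by
  have hK := S.K_pos
  have hb := S.b_pos
  refine LipschitzWith.of_dist_le_mul fun w w' => ?_
  rw [Real.coe_toNNReal _ (by positivity), dist_eq_norm, dist_eq_norm]
  exact S.norm_loopField_sub_le t w w'

lemma continuous_loopField {w : ℝ → ℂ} (hw : Continuous w) :
    Continuous fun t => S.loopField t (w t) := by
  unfold loopField
  have := S.continuous_G.comp (f := fun t : ℝ => (w t, S.l₁ + t * Complex.I)) (by fun_prop)
  exact (continuous_const.mul (this.inv₀ fun t => S.G_ne_zero _ _)).neg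

lemma exists_flow (w : ℂ) :
    ∃ W : ℝ → ℂ, W 0 = w ∧ ∀ t, HasDerivAt W (S.loopField t (W t)) t := by
  have hα := S.α_pos
  refine exists_global_solution (L := Real.toNNReal (2 / S.α))
    (fun w => S.continuous_loopField continuous_const) S.lipschitz_loopField (fun t w => ?_) w
  rw [Real.coe_toNNReal _ (by positivity)]
  exact S.norm_loopField_le t w

/-- The holonomy of `{x = 0}` over the arc from `c₁` to `c₁ exp(it)`, in the coordinate
`w = log x`. -/
noncomputable def flow (w : ℂ) : ℝ → ℂ := (S.exists_flow w).choose

lemma flow_zero (w : ℂ) : S.flow w 0 = w := (S.exists_flow w).choose_spec.1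

lemma hasDerivAt_flow (w : ℂ) (t : ℝ) : HasDerivAt (S.flow w) (S.loopField t (S.flow w t)) t :=
  (S.exists_flow w).choose_spec.2 t

lemma continuous_flow (w : ℂ) : Continuous (S.flow w) :=
  continuous_iff_continuousAt.2 fun t => (S.hasDerivAt_flow w t).continuousAt

lemma flow_unique {w : ℂ} {W : ℝ → ℂ} (t₀ : ℝ) (h0 : W t₀ = S.flow w t₀)
    (hW : ∀ t, HasDerivAt W (S.loopField t (W t)) t) : W = S.flow w :=
  ODE_solution_unique_univ (v := S.loopField) (s := fun _ => univ) (t₀ := t₀)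
    (fun t => (S.lipschitz_loopField t).lipschitzOnWith)
    (fun t => ⟨hW t, mem_univ _⟩) (fun t => ⟨S.hasDerivAt_flow w t, mem_univ _⟩) h0

lemma loopField_add_period (t : ℝ) (w : ℂ) (n : ℤ) :
    S.loopField t (w + n * (2 * Real.pi * Complex.I)) = S.loopField t w := by
  unfold loopField
  have := S.G_add_period w (S.l₁ + t * Complex.I) n 0
  simp only [Int.cast_zero, zero_mul, add_zero] at this
  rw [this]

lemma loopField_add_two_pi (t : ℝ) (w : ℂ) (n : ℤ) :
    S.loopField (n * (2 * Real.pi) + t) w = S.loopField t w := by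
  unfold loopField
  have := S.G_add_period w (S.l₁ + t * Complex.I) 0 n
  simp only [Int.cast_zero, zero_mul, add_zero] at this
  rw [← this]
  push_cast
  ring_nf

lemma loopField_conj (t : ℝ) (w : ℂ) :
    S.loopField t (starRingEnd ℂ w) = -starRingEnd ℂ (S.loopField (-t) w) := by
  unfold loopField
  have := S.G_conj w (S.l₁ + (-t : ℝ) * Complex.I)
  rw [show starRingEnd ℂ ((S.l₁ : ℂ) + (-t : ℝ) * Complex.I) = S.l₁ + t * Complex.I by simp] at this
  rw [this]
  simp

lemma flow_add_period (w : ℂ) (n : ℤ) :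
    S.flow (w + n * (2 * Real.pi * Complex.I)) =
      fun t => S.flow w t + n * (2 * Real.pi * Complex.I) := by
  refine (S.flow_unique 0 (by simp [flow_zero]) fun t => ?_).symm
  rw [loopField_add_period]
  exact (S.hasDerivAt_flow w t).add_const _

lemma flow_add_two_pi (w : ℂ) (n : ℤ) (t : ℝ) :
    S.flow w (n * (2 * Real.pi) + t) = S.flow (S.flow w (n * (2 * Real.pi))) t := by
  refine congrFun (S.flow_unique (W := fun t => S.flow w (n * (2 * Real.pi) + t)) 0
    (by simp [flow_zero]) fun t => ?_) t
  have := (S.hasDerivAt_flow w (n * (2 * Real.pi) + t)).comp_const_add (n * (2 * Real.pi)) t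
  rwa [loopField_add_two_pi] at this

lemma flow_conj (w : ℂ) :
    S.flow (starRingEnd ℂ w) = fun t => starRingEnd ℂ (S.flow w (-t)) := by
  refine (S.flow_unique 0 (by simp [flow_zero]) fun t => ?_).symm
  rw [loopField_conj]
  have := ((S.hasDerivAt_flow w (-t)).scomp t (hasDerivAt_neg t)).star
  refine this.congr_deriv ?_
  simp

lemma flow_injective (t : ℝ) : Function.Injective fun w => S.flow w t := by
  intro w w' h
  have := S.flow_unique (w := w') (W := S.flow w) t h (S.hasDerivAt_flow w)
  rw [← S.flow_zero w, ← S.flow_zero w', this]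

/-- The symmetry of the foliation under complex conjugation: `h^k(z) = conj z` holds if and only if
the holonomy over half of the path, `k` half-turns, maps `z` to a real point. -/
lemma flow_two_pi_eq_conj_iff (w : ℂ) (k m : ℤ) :
    S.flow w (k * (2 * Real.pi)) = starRingEnd ℂ w + m * (2 * Real.pi * Complex.I) ↔
      (S.flow w (k * Real.pi)).im = m * Real.pi := by
  have h1 : S.flow w (k * Real.pi) =
      S.flow (S.flow w (k * (2 * Real.pi))) (-(k * Real.pi)) := by
    rw [← flow_add_two_pi]; congr 1; ring
  have h2 : S.flow (starRingEnd ℂ w + m * (2 * Real.pi * Complex.I)) (-(k * Real.pi)) =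
      starRingEnd ℂ (S.flow w (k * Real.pi)) + m * (2 * Real.pi * Complex.I) := by
    rw [flow_add_period, flow_conj]; simp
  have h3 : (S.flow w (k * Real.pi)).im = m * Real.pi ↔ S.flow w (k * Real.pi) =
      starRingEnd ℂ (S.flow w (k * Real.pi)) + m * (2 * Real.pi * Complex.I) := by
    rw [Complex.ext_iff]
    simp
    constructor <;> intro h <;> linarith
  rw [h3, ← h2]
  constructor
  · intro h; rw [h1, h]
  · intro h
    exact S.flow_injective _ (h1.symm.trans h)

lemma norm_flow_sub_flow_le_of_bound {w w' : ℂ} {t C : ℝ}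
    (h : ∀ s, |s| ≤ |t| → ‖S.loopField s (S.flow w s) - S.loopField s (S.flow w' s)‖ ≤ C) :
    ‖(S.flow w t - w) - (S.flow w' t - w')‖ ≤ C * |t| := by
  have hc : Convex ℝ (Icc (-|t|) |t|) := convex_Icc _ _
  have := hc.norm_image_sub_le_of_norm_hasDerivWithin_le
    (f := fun s => S.flow w s - S.flow w' s) (x := 0) (y := t) (C := C)
    (fun s _ => ((S.hasDerivAt_flow w s).sub (S.hasDerivAt_flow w' s)).hasDerivWithinAt)
    (fun s hs => h s (abs_le.2 hs)) ⟨by simp, by simp⟩ ⟨neg_abs_le t, le_abs_self t⟩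
  simp only [flow_zero, sub_zero, Real.norm_eq_abs] at this
  rwa [show S.flow w t - w - (S.flow w' t - w') = S.flow w t - S.flow w' t - (w - w') by ring]

lemma norm_flow_sub_le (w : ℂ) (t : ℝ) : ‖S.flow w t - w‖ ≤ 2 / S.α * |t| := by
  have := convex_univ.norm_image_sub_le_of_norm_hasDerivWithin_le (s := (univ : Set ℝ))
    (f := S.flow w) (x := 0) (y := t) (C := 2 / S.α)
    (fun s _ => (S.hasDerivAt_flow w s).hasDerivWithinAt)
    (fun s _ => S.norm_loopField_le s _) (mem_univ _) (mem_univ _)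
  simpa [flow_zero] using this

lemma flow_re_le (w : ℂ) (t : ℝ) : (S.flow w t).re ≤ w.re + 2 / S.α * |t| := by
  have := ((Complex.abs_re_le_norm _).trans (S.norm_flow_sub_le w t))
  rw [Complex.sub_re] at this
  linarith [le_abs_self ((S.flow w t).re - w.re)]

/-- The holonomy maps are Lipschitz in the coordinate `x = exp w`, with constant
`exp(3|t|/α)`. -/
lemma norm_exp_flow_sub_le {w w' : ℂ} {t : ℝ} (hw : w.re + 2 / S.α * |t| ≤ Real.log S.b)
    (hw' : w'.re + 2 / S.α * |t| ≤ Real.log S.b) :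
    ‖Complex.exp (S.flow w t) - Complex.exp (S.flow w' t)‖ ≤
      ‖Complex.exp w - Complex.exp w'‖ * Real.exp (3 / S.α * |t|) := by
  have hα := S.α_pos
  have hK := S.K_pos
  have hb := S.b_pos
  have hre : ∀ {v : ℂ} {s : ℝ}, v.re + 2 / S.α * |t| ≤ Real.log S.b → |s| ≤ |t| →
      (S.flow v s).re ≤ Real.log S.b := fun {v s} hv hs => by
    have := mul_le_mul_of_nonneg_left hs (by positivity : 0 ≤ 2 / S.α)
    linarith [S.flow_re_le v s]
  have := norm_le_exp_of_norm_deriv_le (T := |t|) (t := t) (K := 3 / S.α)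
    (y := fun s => Complex.exp (S.flow w s) - Complex.exp (S.flow w' s))
    (y' := fun s => Complex.exp (S.flow w s) * S.loopField s (S.flow w s) -
      Complex.exp (S.flow w' s) * S.loopField s (S.flow w' s))
    (fun s _ => (S.hasDerivAt_flow w s).cexp.sub (S.hasDerivAt_flow w' s).cexp) ?_ le_rfl
  · simpa [flow_zero] using this
  intro s hs
  have h1 := S.norm_loopField_le s (S.flow w s)
  have h2 := S.norm_loopField_sub_le_texp s (S.flow w s) (S.flow w' s)
  rw [S.texp_eq (hre hw hs), S.texp_eq (hre hw' hs)] at h2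
  have h3 : ‖Complex.exp (S.flow w' s)‖ ≤ S.b := by
    rw [← S.texp_eq (hre hw' hs)]; exact S.norm_texp_le_b _
  have e : Complex.exp (S.flow w s) * S.loopField s (S.flow w s) -
      Complex.exp (S.flow w' s) * S.loopField s (S.flow w' s) =
      (Complex.exp (S.flow w s) - Complex.exp (S.flow w' s)) * S.loopField s (S.flow w s) +
      Complex.exp (S.flow w' s) * (S.loopField s (S.flow w s) - S.loopField s (S.flow w' s)) := by
    ring
  show ‖_‖ ≤ _ * ‖_‖
  rw [e]
  refine (norm_add_le _ _).trans ?_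
  rw [norm_mul, norm_mul]
  set δ := ‖Complex.exp (S.flow w s) - Complex.exp (S.flow w' s)‖
  have h4 := mul_le_mul_of_nonneg_left h1 (norm_nonneg (Complex.exp (S.flow w s) -
    Complex.exp (S.flow w' s)))
  have h5 := mul_le_mul h3 h2 (norm_nonneg _) hb.le
  have h6 : S.b * (4 * S.K / S.α ^ 2) ≤ 1 / S.α := by
    have h7 := S.K_small
    have h8 := mul_lt_mul_of_pos_left S.b_lt hK
    rw [mul_div_assoc', div_le_div_iff₀ (by positivity) hα]
    nlinarith
  have h7 := mul_le_mul_of_nonneg_right h6 (norm_nonneg (Complex.exp (S.flow w s) -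
    Complex.exp (S.flow w' s)))
  have h8 : 3 / S.α * δ = δ * (2 / S.α) + 1 / S.α * δ := by ring
  linarith

/-- The variation of the displacement of the holonomy maps in the coordinate `w = log x`. -/
lemma norm_displacement_sub_le {w w' : ℂ} {t : ℝ} (hw : w.re + 2 / S.α * |t| ≤ Real.log S.b)
    (hw' : w'.re + 2 / S.α * |t| ≤ Real.log S.b) :
    ‖(S.flow w t - w) - (S.flow w' t - w')‖ ≤
      4 * S.K / S.α ^ 2 * Real.exp (3 / S.α * |t|) * |t| * ‖Complex.exp w - Complex.exp w'‖ := by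
  have hα := S.α_pos
  have hK := S.K_pos
  have := S.norm_flow_sub_flow_le_of_bound (w := w) (w' := w') (t := t)
    (C := 4 * S.K / S.α ^ 2 * Real.exp (3 / S.α * |t|) * ‖Complex.exp w - Complex.exp w'‖) ?_
  · refine this.trans_eq (by ring)
  intro s hs
  have hle := mul_le_mul_of_nonneg_left hs (by positivity : 0 ≤ 2 / S.α)
  have hle' := mul_le_mul_of_nonneg_left hs (by positivity : 0 ≤ 3 / S.α)
  refine (S.norm_loopField_sub_le_texp _ _ _).trans ?_
  rw [S.texp_eq (by linarith [S.flow_re_le w s]), S.texp_eq (by linarith [S.flow_re_le w' s])]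
  have h1 := S.norm_exp_flow_sub_le (w := w) (w' := w') (t := s) (by linarith) (by linarith)
  have h2 := mul_le_mul_of_nonneg_left (Real.exp_le_exp.2 hle')
    (norm_nonneg (Complex.exp w - Complex.exp w'))
  rw [mul_assoc, mul_comm (Real.exp _)]
  exact mul_le_mul_of_nonneg_left (h1.trans h2) (by positivity)

/-- The inverse slope of the leaves along the circle `y = c₁ exp(it)` of the separatrix `{x = 0}`. -/
noncomputable def sepSlope (t : ℝ) : ℂ := (S.f (0, S.texp (S.l₁ + t * Complex.I)))⁻¹

/-- The limit for `x → 0` of the displacement `log x' - log x` of the holonomy over the arc from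
`c₁` to `c₁ exp(it)`. -/
noncomputable def limitShift (t : ℝ) : ℂ := -(Complex.I * ∫ s in (0 : ℝ)..t, S.sepSlope s)

lemma continuous_sepSlope : Continuous S.sepSlope := by
  unfold sepSlope
  have h0 : ‖(0 : ℂ)‖ < S.r := by simpa using S.r_pos
  have hb := S.b_pos
  have hK := S.K_pos
  refine Continuous.inv₀ ?_ fun t => S.f_ne_zero h0 (S.norm_texp_lt _)
  have : LipschitzWith (Real.toNNReal (S.K * S.b)) fun t : ℝ =>
      S.f (0, S.texp (S.l₁ + t * Complex.I)) := by
    refine LipschitzWith.of_dist_le_mul fun s t => ?_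
    rw [Real.coe_toNNReal _ (by positivity), dist_eq_norm]
    refine (S.lip _ _ _ _ h0 (S.norm_texp_lt _) h0 (S.norm_texp_lt _)).trans ?_
    rw [sub_self, norm_zero, zero_add, mul_assoc]
    refine mul_le_mul_of_nonneg_left ((S.norm_texp_sub_le_b _ _).trans_eq ?_) hK.le
    rw [add_sub_add_left_eq_sub, ← sub_mul, norm_mul, Complex.norm_I, mul_one,
      ← Complex.ofReal_sub, Complex.norm_real, Real.dist_eq, Real.norm_eq_abs]
  exact this.continuous

lemma hasDerivAt_limitShift (t : ℝ) :
    HasDerivAt S.limitShift (-(Complex.I * S.sepSlope t)) t := by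
  have := intervalIntegral.integral_hasDerivAt_right
    (S.continuous_sepSlope.intervalIntegrable 0 t)
    (S.continuous_sepSlope.stronglyMeasurableAtFilter _ _) S.continuous_sepSlope.continuousAt
  exact (this.const_mul Complex.I).neg

/-- The displacement in the coordinate `w = log x` converges to `limitShift` as `x → 0`, with an
error `O(|x|)`. -/
lemma norm_displacement_sub_limitShift_le (w : ℂ) (t : ℝ) :
    ‖S.flow w t - w - S.limitShift t‖ ≤
      4 * S.K / S.α ^ 2 * Real.exp (3 / S.α * |t|) * |t| * Real.exp w.re := by
  have hα := S.α_pos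
  have hK := S.K_pos
  have hc : Convex ℝ (Icc (-|t|) |t|) := convex_Icc _ _
  have := hc.norm_image_sub_le_of_norm_hasDerivWithin_le
    (f := fun s => S.flow w s - S.limitShift s) (x := 0) (y := t)
    (C := 4 * S.K / S.α ^ 2 * (Real.exp (3 / S.α * |t|) * Real.exp w.re))
    (fun s _ => ((S.hasDerivAt_flow w s).sub (S.hasDerivAt_limitShift s)).hasDerivWithinAt)
    (fun s hs => ?_) ⟨by simp, by simp⟩ ⟨neg_abs_le t, le_abs_self t⟩
  · have h0 : S.limitShift 0 = 0 := by simp [limitShift]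
    simp only [flow_zero, h0, sub_zero, Real.norm_eq_abs] at this
    rw [show S.flow w t - w - S.limitShift t = S.flow w t - S.limitShift t - w by ring]
    exact this.trans_eq (by ring)
  · have hs' : |s| ≤ |t| := abs_le.2 hs
    unfold loopField sepSlope
    rw [← neg_sub', norm_neg, ← mul_sub, norm_mul, Complex.norm_I, one_mul]
    have h1 := S.norm_inv_f_sub_le (S.norm_texp_lt (S.flow w s))
      (S.norm_texp_lt (S.l₁ + s * Complex.I)) (by simpa using S.r_pos : ‖(0 : ℂ)‖ < S.r)
      (S.norm_texp_lt (S.l₁ + s * Complex.I))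
    refine h1.trans (mul_le_mul_of_nonneg_left ?_ (by positivity))
    rw [sub_self, norm_zero, add_zero, sub_zero, ← Real.exp_add]
    refine (S.norm_texp_le _).trans (Real.exp_le_exp.2 ?_)
    have h2 := mul_le_mul_of_nonneg_left hs' (by positivity : 0 ≤ 2 / S.α)
    have h3 : 2 / S.α * |t| ≤ 3 / S.α * |t| := by gcongr; norm_num
    linarith [S.flow_re_le w s]

/-- The real part of the average of `1/f(0, y)` over `k` half-circles is its value `1/α` at `y = 0`:
by the mean value property for full circles, and since `f` is real. -/
lemma limitShift_im (k : ℤ) : (S.limitShift (k * Real.pi)).im = -(k * Real.pi / S.α) := by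
  have hα := S.α_pos
  set p : ℝ → ℝ := fun t => (S.sepSlope t).re with hp
  have hpc : Continuous p := Complex.continuous_re.comp S.continuous_sepSlope
  have him : ∀ t, (S.limitShift t).im = -∫ s in (0 : ℝ)..t, p s := by
    intro t
    have h1 := intervalIntegral.intervalIntegral_re
      (S.continuous_sepSlope.intervalIntegrable (μ := MeasureTheory.volume) 0 t)
    have h2 : (∫ s in (0 : ℝ)..t, S.sepSlope s).re = ∫ s in (0 : ℝ)..t, p s := h1.symm
    unfold limitShift
    simp [h2]
  have hper : Function.Periodic p (2 * Real.pi) := by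
    intro t
    simp only [hp, sepSlope]
    have := S.texp_add_period (S.l₁ + t * Complex.I) 1
    rw [← this]
    push_cast
    ring_nf
  have heven : ∀ t, p (-t) = p t := by
    intro t
    have h0 : ‖(0 : ℂ)‖ < S.r := by simpa using S.r_pos
    simp only [hp, sepSlope]
    have h1 : S.texp (S.l₁ + (-t : ℝ) * Complex.I) =
        starRingEnd ℂ (S.texp (S.l₁ + t * Complex.I)) := by
      rw [← texp_conj]; simp
    have h2 := S.conj 0 (S.texp (S.l₁ + t * Complex.I)) h0 (S.norm_texp_lt _)
    rw [map_zero] at h2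
    rw [h1, h2, ← map_inv₀, Complex.conj_re]
  have hmean : ∫ t in (0 : ℝ)..2 * Real.pi, p t = 2 * Real.pi / S.α := by
    have hd : DiffContOnCl ℂ (fun y => (S.f (0, y))⁻¹) (Metric.ball 0 |S.c₁|) := by
      rw [abs_of_pos S.c₁_pos]
      refine DifferentiableOn.diffContOnCl ?_
      rw [closure_ball _ S.c₁_pos.ne']
      intro y hy
      have hy' : ‖y‖ < S.r := (mem_closedBall_zero_iff.1 hy).trans_lt (S.c₁_lt.trans S.b_lt)
      have h0 : ‖(0 : ℂ)‖ < S.r := by simpa using S.r_pos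
      have h1 : DifferentiableAt ℂ S.f (0, y) :=
        (S.analytic (0, y) (by simpa using ⟨S.r_pos, hy'⟩)).differentiableAt
      have h2 : DifferentiableAt ℂ (fun y : ℂ => S.f (0, y)) y :=
        DifferentiableAt.comp (g := S.f) (f := fun y : ℂ => ((0 : ℂ), y)) y h1 (by fun_prop)
      exact (h2.inv (S.f_ne_zero h0 hy')).differentiableWithinAt
    have h1 := hd.circleAverage
    rw [S.zero, Real.circleAverage_def] at h1
    have h2 : ∀ t : ℝ, S.texp (S.l₁ + t * Complex.I) = circleMap 0 S.c₁ t := by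
      intro t
      rw [S.texp_eq (by simpa using S.l₁_lt.le), Complex.exp_add, ← Complex.ofReal_exp, l₁,
        Real.exp_log S.c₁_pos, circleMap, zero_add]
    have h3 : ∫ t in (0 : ℝ)..2 * Real.pi, S.sepSlope t = 2 * Real.pi / S.α := by
      simp only [sepSlope, h2]
      rw [Complex.real_smul] at h1
      have hpi : (Real.pi : ℂ) ≠ 0 := by exact_mod_cast Real.pi_ne_zero
      push_cast at h1
      field_simp at h1 ⊢
      linear_combination h1
    have h4 := intervalIntegral.intervalIntegral_re
      (S.continuous_sepSlope.intervalIntegrable (μ := MeasureTheory.volume) 0 (2 * Real.pi))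
    have h5 : (∫ t in (0 : ℝ)..2 * Real.pi, S.sepSlope t).re = ∫ t in (0 : ℝ)..2 * Real.pi, p t :=
      h4.symm
    rw [← h5, h3]
    have : (2 * Real.pi / S.α : ℂ) = ((2 * Real.pi / S.α : ℝ) : ℂ) := by push_cast; ring
    rw [this, Complex.ofReal_re]
  have hint : ∀ a b, IntervalIntegrable p MeasureTheory.volume a b :=
    fun a b => hpc.intervalIntegrable a b
  have hodd : ∫ s in (-(k * Real.pi) : ℝ)..0, p s = ∫ s in (0 : ℝ)..k * Real.pi, p s := by
    have := intervalIntegral.integral_comp_neg (a := 0) (b := k * Real.pi) p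
    simp only [heven, neg_zero] at this
    exact this.symm
  have hfull := hper.intervalIntegral_add_zsmul_eq k (-(k * Real.pi)) hint
  rw [hper.intervalIntegral_add_eq _ 0, zero_add, hmean] at hfull
  have e : -((k : ℝ) * Real.pi) + k • (2 * Real.pi) = k * Real.pi := by
    rw [zsmul_eq_mul]; ring
  rw [e, ← intervalIntegral.integral_add_adjacent_intervals (hint _ 0) (hint 0 _), hodd,
    zsmul_eq_mul] at hfull
  rw [him]
  have : (k : ℝ) * (2 * Real.pi / S.α) = 2 * (k * Real.pi / S.α) := by ring
  linarith

end Saddle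

/-! ### The holonomy as a germ of a holomorphic map -/

namespace Saddle

variable (S : Saddle)

lemma flow_mem_chart {w : ℂ} {θ t : ℝ} (hw : w.re + 2 / S.α * |θ| < Real.log S.b)
    (ht : |t| ≤ |θ|) : (S.flow w t, (S.l₁ + t * Complex.I : ℂ)) ∈ S.chart := by
  have hα := S.α_pos
  refine ⟨?_, by simpa using S.l₁_lt⟩
  have h1 := S.flow_re_le w t
  have h2 := mul_le_mul_of_nonneg_left ht (by positivity : 0 ≤ 2 / S.α)
  show (S.flow w t).re < _
  linarith

/-- The holonomy is holomorphic in the logarithmic coordinate: the case of `hasFDerivAt_solution`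
without dependence on the parameter. -/
lemma differentiableAt_flow {w : ℂ} {θ : ℝ} (hw : w.re + 2 / S.α * |θ| < Real.log S.b) :
    DifferentiableAt ℂ (fun w => S.flow w θ) w := by
  have hα := S.α_pos
  have hK := S.K_pos
  have hb := S.b_pos
  -- time is clamped to `[0, 1]`, so that the coefficients of the linearised equation are continuous
  -- on all of `ℝ`
  let π : ℝ → ℝ := fun t => (projIcc (0 : ℝ) 1 zero_le_one t : ℝ)
  have hπc : Continuous π := continuous_subtype_val.comp continuous_projIcc
  have hπm : ∀ t, π t ∈ Icc (0 : ℝ) 1 := fun t => (projIcc (0 : ℝ) 1 zero_le_one t).2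
  have hπe : ∀ t ∈ Icc (0 : ℝ) 1, π t = t := fun t ht => by
    simp only [π]; rw [projIcc_of_mem _ ht]
  let q : ℝ → ℂ × ℂ := fun t => (S.flow w (θ * π t), S.l₁ + ((θ * π t : ℝ) : ℂ) * Complex.I)
  have hqm : ∀ t, q t ∈ S.chart := fun t => S.flow_mem_chart hw (by
    rw [abs_mul, abs_of_nonneg (hπm t).1]
    exact mul_le_of_le_one_right (abs_nonneg _) (hπm t).2)
  have hqc : Continuous q :=
    Continuous.prodMk ((S.continuous_flow w).comp (by fun_prop)) (by fun_prop)
  let Gf : ℂ × ℂ → ℂ := fun p => S.G p.1 p.2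
  have hdG : Continuous fun t => fderiv ℂ Gf (q t) := by
    refine continuous_iff_continuousAt.2 fun t => ?_
    exact (S.analyticAt_G (hqm t)).fderiv.continuousAt.comp hqc.continuousAt
  let a : ℝ → ℂ := fun t =>
    θ * -(Complex.I * (-fderiv ℂ Gf (q t) (1, 0) / S.G (q t).1 (q t).2 ^ 2))
  have hac : Continuous a := by
    have h1 : Continuous fun t => S.G (q t).1 (q t).2 := S.continuous_G.comp hqc
    exact continuous_const.mul (continuous_const.mul
      ((hdG.clm_apply continuous_const).neg.div (h1.pow 2)
        fun t => pow_ne_zero 2 (S.G_ne_zero _ _))).neg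
  have hmain := hasFDerivAt_solution (F := fun t _ y => θ * S.loopField (θ * t) y)
    (y := fun p t => S.flow p.2 (θ * t)) (p₀ := ((0 : ℂ), w))
    (L := |θ| * (4 * S.K / S.α ^ 2 * S.b) + 1) (a := a) (b := fun _ => 0) (by positivity)
    (fun p => by simp [flow_zero])
    (fun p t => by
      have h1 : HasDerivAt (fun t : ℝ => θ * t) θ t := by
        simpa using (hasDerivAt_id t).const_mul θ
      exact (S.hasDerivAt_flow p.2 (θ * t)).scomp t h1)
    (fun p => by
      have h1 := (S.continuous_loopField (S.continuous_flow p.2)).comp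
        (continuous_const.mul continuous_id : Continuous fun t : ℝ => θ * t)
      exact continuous_const.mul h1)
    (Eventually.of_forall fun p t _ z z' => by
      rw [← mul_sub, norm_mul, Complex.norm_real, Real.norm_eq_abs]
      have h1 := mul_le_mul_of_nonneg_left (S.norm_loopField_sub_le (θ * t) z z') (abs_nonneg θ)
      have h2 : 0 ≤ |θ| * (4 * S.K / S.α ^ 2 * S.b) := by positivity
      nlinarith [norm_nonneg (p.1 - (0 : ℂ)), norm_nonneg (z - z')])
    (fun t ht => by
      have hqt : q t = (S.flow w (θ * t), S.l₁ + ((θ * t : ℝ) : ℂ) * Complex.I) := by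
        simp only [q]; rw [hπe t ht]
      have h1 : HasDerivAt (fun z : ℂ => (z, (q t).2)) (1, 0) (q t).1 :=
        (hasDerivAt_id _).prodMk (hasDerivAt_const _ _)
      have hG : HasFDerivAt Gf (fderiv ℂ Gf (q t)) ((q t).1, (q t).2) :=
        (S.analyticAt_G (hqm t)).differentiableAt.hasFDerivAt
      have h2' : HasDerivAt (Gf ∘ fun z => (z, (q t).2)) (fderiv ℂ Gf (q t) (1, 0)) (q t).1 :=
        hG.comp_hasDerivAt (q t).1 h1
      have h2 : HasDerivAt (fun z => S.G z (q t).2) (fderiv ℂ Gf (q t) (1, 0)) (q t).1 := h2'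
      have h3 := ((h2.inv (S.G_ne_zero _ _)).const_mul Complex.I).neg.const_mul (θ : ℂ)
      have h4 : HasDerivAt (fun z => θ * S.loopField (θ * t) z) (a t) (S.flow w (θ * t)) := by
        rw [hqt] at h3
        have h5 : a t = θ * -(Complex.I * (-fderiv ℂ Gf (q t) (1, 0) / S.G (q t).1 (q t).2 ^ 2)) :=
          rfl
        rw [h5, hqt]
        exact h3
      have h6 := h4.hasFDerivAt.comp ((0 : ℂ), S.flow w (θ * t))
        (hasFDerivAt_snd (𝕜 := ℂ) (p := ((0 : ℂ), S.flow w (θ * t))))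
      refine h6.congr_fderiv ?_
      ext <;> simp)
    hac continuous_const
  have hw' : HasFDerivAt (fun z : ℂ => ((0 : ℂ), z)) (ContinuousLinearMap.inr ℂ ℂ ℂ) w :=
    (ContinuousLinearMap.inr ℂ ℂ ℂ).hasFDerivAt
  have := hmain.comp w hw'
  simp only [mul_one] at this
  exact this.differentiableAt

/-- The holonomy of the separatrix `{x = 0}` over the arc from `c₁` to `c₁ exp(iθ)`, in the
coordinate `x`. -/
noncomputable def arcHolonomy (θ : ℝ) (z : ℂ) : ℂ :=
  if z = 0 then 0 else Complex.exp (S.flow (Complex.log z) θ)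

lemma arcHolonomy_zero (θ : ℝ) : S.arcHolonomy θ 0 = 0 := if_pos rfl

lemma exp_flow_eq_of_exp_eq {w w' : ℂ} (h : Complex.exp w = Complex.exp w') (θ : ℝ) :
    Complex.exp (S.flow w θ) = Complex.exp (S.flow w' θ) := by
  obtain ⟨n, hn⟩ := Complex.exp_eq_exp_iff_exists_int.1 h
  rw [hn, flow_add_period, Complex.exp_eq_exp_iff_exists_int]
  exact ⟨n, rfl⟩

lemma arcHolonomy_exp (θ : ℝ) (w : ℂ) :
    S.arcHolonomy θ (Complex.exp w) = Complex.exp (S.flow w θ) := by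
  rw [arcHolonomy, if_neg (Complex.exp_ne_zero w)]
  exact S.exp_flow_eq_of_exp_eq (Complex.exp_log (Complex.exp_ne_zero w)) θ

/-- The radius of a disc on which the holonomy over arcs of angle at most `θ` is defined. -/
noncomputable def arcRadius (θ : ℝ) : ℝ := S.b * Real.exp (-(2 / S.α * |θ|))

lemma arcRadius_pos (θ : ℝ) : 0 < S.arcRadius θ := mul_pos S.b_pos (Real.exp_pos _)

lemma lt_arcRadius_iff {θ u : ℝ} :
    Real.exp u < S.arcRadius θ ↔ u + 2 / S.α * |θ| < Real.log S.b := by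
  rw [arcRadius, ← Real.exp_log S.b_pos, ← Real.exp_add, Real.exp_lt_exp, Real.log_exp]
  constructor <;> intro h <;> linarith

lemma differentiableAt_arcHolonomy {θ : ℝ} {z : ℂ} (hz : z ≠ 0) (hzr : ‖z‖ < S.arcRadius θ) :
    DifferentiableAt ℂ (S.arcHolonomy θ) z := by
  have hlog : (Complex.log z).re + 2 / S.α * |θ| < Real.log S.b := by
    rw [← S.lt_arcRadius_iff, ← Complex.norm_exp, Complex.exp_log hz]
    exact hzr
  -- a branch of the logarithm that is holomorphic near `z`
  have h1 : DifferentiableAt ℂ (fun z' => Complex.log (z' / z) + Complex.log z) z := by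
    refine DifferentiableAt.add_const _ ?_
    refine DifferentiableAt.clog (by fun_prop) ?_
    rw [div_self hz]; exact Complex.one_mem_slitPlane
  have h2 : Complex.log (z / z) + Complex.log z = Complex.log z := by
    rw [div_self hz, Complex.log_one, zero_add]
  have h3 : DifferentiableAt ℂ (fun z' =>
      Complex.exp (S.flow (Complex.log (z' / z) + Complex.log z) θ)) z := by
    refine DifferentiableAt.cexp ?_
    refine DifferentiableAt.comp (g := fun w => S.flow w θ)
      (f := fun z' => Complex.log (z' / z) + Complex.log z) z ?_ h1
    rw [h2]
    exact S.differentiableAt_flow hlog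
  refine h3.congr_of_eventuallyEq ?_
  filter_upwards [isOpen_ne.mem_nhds hz] with z' hz'
  have hz'' : z' ≠ 0 := hz'
  have h4 : z' = Complex.exp (Complex.log (z' / z) + Complex.log z) := by
    rw [Complex.exp_add, Complex.exp_log (div_ne_zero hz' hz), Complex.exp_log hz]
    field_simp
  conv_lhs => rw [h4]
  exact S.arcHolonomy_exp _ _

lemma hasDerivAt_arcHolonomy_zero (θ : ℝ) :
    HasDerivAt (S.arcHolonomy θ) (Complex.exp (S.limitShift θ)) 0 := by
  rw [hasDerivAt_iff_tendsto_slope]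
  set C := 4 * S.K / S.α ^ 2 * Real.exp (3 / S.α * |θ|) * |θ|
  have h1 : Tendsto (fun z : ℂ => S.flow (Complex.log z) θ - Complex.log z) (𝓝[≠] 0)
      (𝓝 (S.limitShift θ)) := by
    rw [tendsto_iff_norm_sub_tendsto_zero]
    have h2 : Tendsto (fun z : ℂ => C * ‖z‖) (𝓝[≠] 0) (𝓝 0) := by
      have : Tendsto (fun z : ℂ => C * ‖z‖) (𝓝 0) (𝓝 (C * ‖(0 : ℂ)‖)) :=
        (continuous_const.mul continuous_norm).tendsto 0
      rw [norm_zero, mul_zero] at this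
      exact this.mono_left nhdsWithin_le_nhds
    refine squeeze_zero' (Eventually.of_forall fun _ => norm_nonneg _) ?_ h2
    filter_upwards [self_mem_nhdsWithin] with z hz
    have := S.norm_displacement_sub_limitShift_le (Complex.log z) θ
    rwa [← Complex.norm_exp, Complex.exp_log hz] at this
  refine ((Complex.continuous_exp.tendsto _).comp h1).congr' ?_
  filter_upwards [self_mem_nhdsWithin] with z hz
  have hz' : z ≠ 0 := hz
  rw [slope_def_field, arcHolonomy_zero, sub_zero, sub_zero, arcHolonomy, if_neg hz',
    Function.comp_apply, Complex.exp_sub, Complex.exp_log hz']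

lemma analyticAt_arcHolonomy_zero (θ : ℝ) : AnalyticAt ℂ (S.arcHolonomy θ) 0 := by
  refine Complex.analyticAt_of_differentiable_on_punctured_nhds_of_continuousAt ?_
    (S.hasDerivAt_arcHolonomy_zero θ).continuousAt
  filter_upwards [self_mem_nhdsWithin,
    nhdsWithin_le_nhds (Metric.ball_mem_nhds (0 : ℂ) (S.arcRadius_pos θ))] with z hz hzr
  exact S.differentiableAt_arcHolonomy hz (by simpa using hzr)

/-- The preimage of the real axis under the holonomy `T` over `k` half-turns is a smooth curve,
tangent to `exp(ikπ/α)` since `T'(0) = exp s` with `Im s = -kπ/α`. -/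
lemma isSmoothAnalyticCurveAtZero_of_arcHolonomy {C : Set ℂ} {k : ℤ}
    (hC : ∀ᶠ z in 𝓝 (0 : ℂ), z ∈ C ↔ (S.arcHolonomy (k * Real.pi) z).im = 0) :
    IsSmoothAnalyticCurveAtZero C (direction S.α k) := by
  set T := S.arcHolonomy (k * Real.pi) with hT
  set s := S.limitShift (k * Real.pi) with hs
  have hd : HasFDerivAt (fun z => (T z).im)
      (Complex.imCLM.comp ((ContinuousLinearMap.toSpanSingleton ℂ
        (Complex.exp s)).restrictScalars ℝ)) 0 :=
    Complex.imCLM.hasFDerivAt.comp (0 : ℂ)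
      ((S.hasDerivAt_arcHolonomy_zero (k * Real.pi)).hasFDerivAt.restrictScalars ℝ)
  refine ⟨fun z => (T z).im, ?_, by simp [hT, arcHolonomy_zero], ?_, ?_, hC⟩
  · exact (Complex.imCLM.analyticAt _).comp
      ((S.analyticAt_arcHolonomy_zero (k * Real.pi)).restrictScalars)
  · rw [hd.fderiv]
    intro h
    have := congrArg (fun L : ℂ →L[ℝ] ℝ => L (Complex.I * Complex.exp (-s))) h
    simp only [ContinuousLinearMap.comp_apply, Complex.imCLM_apply,
      ContinuousLinearMap.coe_restrictScalars', ContinuousLinearMap.toSpanSingleton_apply,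
      smul_eq_mul, zero_apply] at this
    rw [mul_assoc, ← Complex.exp_add, neg_add_cancel, Complex.exp_zero] at this
    simp at this
  · rw [hd.fderiv]
    simp only [ContinuousLinearMap.comp_apply, Complex.imCLM_apply,
      ContinuousLinearMap.coe_restrictScalars', ContinuousLinearMap.toSpanSingleton_apply,
      smul_eq_mul, direction]
    rw [← Complex.exp_add, Complex.exp_im]
    have him := S.limitShift_im k
    rw [← hs] at him
    simp only [Complex.add_im, Complex.mul_im, Complex.ofReal_re, Complex.ofReal_im,
      Complex.I_re, Complex.I_im, him]
    ring_nf
    simp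

/-- If the holonomy over `k` half-turns maps the point `exp w` to a real one, then its leaf is real,
and the Dulac map is real at `w`. -/
lemma logDulac_im_of_flow_im {w : ℂ} {k : ℤ}
    (hw : w.re + |w.im| + 4 / S.α * |k * Real.pi| < S.l₂) (h : (S.flow w (k * Real.pi)).im = 0) :
    (S.logDulac w).im = k * Real.pi := by
  have hα := S.α_pos
  have hv : ∀ t : ℝ, HasDerivAt (fun t : ℝ => (S.l₁ : ℂ) + t * Complex.I) Complex.I t := by
    intro t
    simpa using ((Complex.ofRealCLM.hasDerivAt (x := t)).mul_const Complex.I).const_add (S.l₁ : ℂ)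
  have := S.firstIntegral_eq_of_leaf (w := S.flow w) (a := 0) (b := k * Real.pi)
    (v := fun t => S.l₁ + t * Complex.I) (fun t ht => ?_) (fun t _ => S.hasDerivAt_flow w t)
    (fun t _ => hv t) (fun t _ => ?_)
  · have e : S.flow w (k * Real.pi) = ((S.flow w (k * Real.pi)).re : ℂ) := by
      apply Complex.ext <;> simp [h]
    rw [flow_zero, e] at this
    have h2 := S.firstIntegral_im (S.flow w (k * Real.pi)).re S.l₁ k
    unfold logDulac
    simp only [Complex.ofReal_zero, zero_mul, add_zero] at this
    rw [this]
    push_cast at h2 ⊢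
    exact h2
  · have ht' : |t| ≤ |k * Real.pi| := by
      have := abs_sub_left_of_mem_uIcc ht
      simpa using this
    have h1 := S.norm_flow_sub_le w t
    have h2 := mul_le_mul_of_nonneg_left ht' (by positivity : 0 ≤ 2 / S.α)
    have h3 := (Complex.abs_im_le_norm _).trans h1
    have h4 := abs_sub_abs_le_abs_sub (S.flow w t).im w.im
    have h5 := S.flow_re_le w t
    rw [Complex.sub_im] at h3
    refine ⟨?_, by simpa using S.l₁_lt⟩
    show (S.flow w t).re + |(S.flow w t).im| < S.l₂
    have h6 : 4 / S.α * |k * Real.pi| = 2 * (2 / S.α * |k * Real.pi|) := by ring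
    linarith
  · unfold loopField
    rw [neg_mul_neg, mul_left_comm, mul_inv_cancel₀ (S.G_ne_zero _ _), mul_one]

end Saddle

/-! ### The foliation of a family in normalised form -/

namespace Saddle

variable (S : Saddle) {N : ℕ} {F : SaddleFamily N} {l : Fin N → ℝ}

/-- `S` is the normalised form of the foliation of the family `F` at the parameter `l`: the two
forms have the same kernels in the bidisc. -/
structure Represents (S : Saddle) (F : SaddleFamily N) (l : Fin N → ℝ) : Prop where
  ratio : F.α l = S.α
  form_iff : ∀ x y u v : ℂ, ‖x‖ < S.r → ‖y‖ < S.r →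
    (F.form l x y u v = 0 ↔ x * v + y * S.f (x, y) * u = 0)

variable {S}

/-- Over the real axis, `exp` of the logarithm of the Dulac map is the real Dulac map. -/
lemma Represents.isDulacValue (h : S.Represents F l) {u : ℝ} (hu : u < S.l₂) :
    Complex.exp (S.logDulac u) = (Real.exp (S.logDulac u).re : ℂ) ∧
    F.IsDulacValue l S.r S.c₁ S.c₂ (Real.exp u) (Real.exp (S.logDulac u).re) := by
  set y := S.transport ((u : ℂ), (S.l₁ : ℂ)) with hy
  have hreal : ∀ t, y t = ((y t).re : ℂ) := by
    intro t
    have h1 := congrFun (S.transport_conj u S.l₁) t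
    rw [Complex.conj_ofReal, Complex.conj_ofReal] at h1
    exact (Complex.conj_eq_iff_re.1 h1.symm).symm
  have hD : S.logDulac u = y 1 := rfl
  have hsec : ((u : ℂ), (S.l₁ : ℂ)) ∈ S.sector := by
    refine ⟨?_, by simpa using S.l₁_lt⟩
    simpa using hu
  have hYe : ∀ t : ℝ, ((Real.exp (y t).re : ℝ) : ℂ) = Complex.exp (y t) := by
    intro t; rw [Complex.ofReal_exp, ← hreal]
  have hXe : ∀ t : ℝ, ((Real.exp (u + t * (S.l₂ - u)) : ℝ) : ℂ) =
      Complex.exp (u + t * (S.l₂ - u)) := by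
    intro t; push_cast; rfl
  refine ⟨by rw [hD, hYe], fun t => Real.exp (u + t * (S.l₂ - u)), fun t => Real.exp (y t).re,
    by simp, ?_, ?_, by rw [hD], fun t _ => ⟨Real.exp_pos _, Real.exp_pos _⟩, ?_⟩
  · simp [hy, transport_zero, l₁, Real.exp_log S.c₁_pos]
  · simp [l₂, Real.exp_log S.c₂_pos]
  intro t ht
  have hX : Real.exp (u + t * (S.l₂ - u)) < S.r := by
    have : u + t * (S.l₂ - u) ≤ S.l₂ := by nlinarith [ht.2]
    calc Real.exp (u + t * (S.l₂ - u)) ≤ Real.exp S.l₂ := Real.exp_le_exp.2 this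
      _ = S.c₂ := Real.exp_log S.c₂_pos
      _ < S.r := S.c₂_lt.trans S.b_lt
  have hY : Real.exp (y t).re < S.r := by
    have h1 := S.transport_re_le hsec ht.1
    have h2 : 0 ≤ t * (S.α / 2 * (S.l₂ - u)) :=
      mul_nonneg ht.1 (mul_nonneg (by linarith [S.α_pos]) (by linarith))
    simp only [Complex.ofReal_re] at h1
    calc Real.exp (y t).re ≤ Real.exp S.l₁ := Real.exp_le_exp.2 (by linarith)
      _ = S.c₁ := Real.exp_log S.c₁_pos
      _ < S.r := S.c₁_lt.trans S.b_lt
  have hXn : ‖((Real.exp (u + t * (S.l₂ - u)) : ℝ) : ℂ)‖ < S.r := by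
    rwa [Complex.norm_of_nonneg (Real.exp_pos _).le]
  have hYn : ‖((Real.exp (y t).re : ℝ) : ℂ)‖ < S.r := by
    rwa [Complex.norm_of_nonneg (Real.exp_pos _).le]
  refine ⟨hXn, hYn, Complex.exp (u + t * (S.l₂ - u)) * (S.l₂ - u),
    Complex.exp (y t) * S.radialField t u (y t), ?_, ?_, ?_⟩
  · have h1 : HasDerivAt (fun t : ℝ => (u : ℂ) + t * (S.l₂ - u)) (S.l₂ - u) t := by
      simpa using ((Complex.ofRealCLM.hasDerivAt (x := t)).mul_const
        ((S.l₂ : ℂ) - u)).const_add (u : ℂ)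
    simp only [hXe]
    exact h1.cexp.hasDerivWithinAt
  · simp only [hYe]
    exact (S.hasDerivAt_transport _ t).cexp.hasDerivWithinAt
  · rw [h.form_iff _ _ _ _ hXn hYn, hXe, hYe]
    have hG : S.G (u + t * (S.l₂ - u)) (y t) =
        S.f (Complex.exp (u + t * (S.l₂ - u)), Complex.exp (y t)) := by
      have h1 := S.segment_mem_chart hsec ht
      unfold G
      rw [S.texp_eq h1.1.le, S.texp_eq h1.2.le]
    unfold radialField
    rw [hG]
    ring

/-- Differentiable paths of the holonomy of `{x = 0}` are determined by their initial point. -/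
lemma Represents.eqOn_of_isLeafPath (h : S.Represents F l) {X₁ X₂ : ℝ → ℂ} {T : ℝ}
    (h₁ : F.IsLeafPath l S.r (Icc 0 T) X₁
      (fun t => (S.c₁ : ℂ) * Complex.exp ((t : ℂ) * Complex.I)))
    (h₂ : F.IsLeafPath l S.r (Icc 0 T) X₂
      (fun t => (S.c₁ : ℂ) * Complex.exp ((t : ℂ) * Complex.I)))
    (h0 : X₁ 0 = X₂ 0) : EqOn X₁ X₂ (Icc 0 T) := by
  have hα := S.α_pos
  have hK := S.K_pos
  have hr := S.r_pos
  rcases le_or_gt T 0 with hT | hT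
  · intro t ht
    have : t = 0 := le_antisymm (ht.2.trans hT) ht.1
    rw [this, h0]
  set Y : ℝ → ℂ := fun t => (S.c₁ : ℂ) * Complex.exp ((t : ℂ) * Complex.I) with hY
  have hYn : ∀ t, ‖Y t‖ < S.r := by
    intro t
    simp only [hY]
    rw [norm_mul, Complex.norm_exp_ofReal_mul_I, mul_one, Complex.norm_of_nonneg S.c₁_pos.le]
    exact S.c₁_lt.trans S.b_lt
  have hYd : ∀ t, HasDerivAt Y (Y t * Complex.I) t := by
    intro t
    have h1 : HasDerivAt (fun t : ℝ => (t : ℂ) * Complex.I) Complex.I t := by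
      simpa using (Complex.ofRealCLM.hasDerivAt (x := t)).mul_const Complex.I
    have := h1.cexp.const_mul (S.c₁ : ℂ)
    rwa [← mul_assoc] at this
  have hY0 : ∀ t, Y t ≠ 0 := fun t =>
    mul_ne_zero (by exact_mod_cast S.c₁_pos.ne') (Complex.exp_ne_zero _)
  have key : ∀ X : ℝ → ℂ, F.IsLeafPath l S.r (Icc 0 T) X Y → ∀ t ∈ Icc 0 T,
      HasDerivWithinAt X (-(Complex.I * (X t * (S.f (X t, Y t))⁻¹))) (Icc 0 T) t := by
    intro X hX t ht
    obtain ⟨hXn, -, u, v, hu, hv, huv⟩ := hX t ht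
    have hv' : v = Y t * Complex.I :=
      (uniqueDiffOn_Icc hT t ht).eq_deriv _ hv (hYd t).hasDerivWithinAt
    rw [h.form_iff _ _ _ _ hXn (hYn t), hv'] at huv
    have hf := S.f_ne_zero hXn (hYn t)
    have hu' : u = -(Complex.I * (X t * (S.f (X t, Y t))⁻¹)) := by
      have h2 : Y t * (X t * Complex.I + S.f (X t, Y t) * u) = 0 := by linear_combination huv
      have h3 := (mul_eq_zero.1 h2).resolve_left (hY0 t)
      field_simp
      linear_combination h3
    rw [← hu']
    exact hu
  have hIci : ∀ (X : ℝ → ℂ) (d : ℂ) (t : ℝ), t ∈ Ico 0 T → HasDerivWithinAt X d (Icc 0 T) t →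
      HasDerivWithinAt X d (Ici t) t := fun X d t ht hd =>
    hd.mono_of_mem_nhdsWithin (Icc_mem_nhdsGE_of_mem ht)
  have hC : 0 ≤ 2 / S.α + S.r * (4 * S.K / S.α ^ 2) := by positivity
  refine ODE_solution_unique_of_mem_Icc_right
    (v := fun t x => -(Complex.I * (x * (S.f (x, Y t))⁻¹))) (s := fun _ => Metric.ball 0 S.r)
    (K := Real.toNNReal (2 / S.α + S.r * (4 * S.K / S.α ^ 2))) ?_
    (fun t ht => (key X₁ h₁ t ht).continuousWithinAt)
    (fun t ht => hIci _ _ t ht (key X₁ h₁ t (Ico_subset_Icc_self ht)))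
    (fun t ht => by simpa using (h₁ t (Ico_subset_Icc_self ht)).1)
    (fun t ht => (key X₂ h₂ t ht).continuousWithinAt)
    (fun t ht => hIci _ _ t ht (key X₂ h₂ t (Ico_subset_Icc_self ht)))
    (fun t ht => by simpa using (h₂ t (Ico_subset_Icc_self ht)).1) h0
  intro t _
  refine LipschitzOnWith.of_dist_le_mul fun x hx x' hx' => ?_
  rw [mem_ball_zero_iff] at hx hx'
  rw [Real.coe_toNNReal _ hC, dist_eq_norm, dist_eq_norm, ← neg_sub', norm_neg, ← mul_sub,
    norm_mul, Complex.norm_I, one_mul]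
  have e : x * (S.f (x, Y t))⁻¹ - x' * (S.f (x', Y t))⁻¹ =
      (x - x') * (S.f (x, Y t))⁻¹ + x' * ((S.f (x, Y t))⁻¹ - (S.f (x', Y t))⁻¹) := by ring
  rw [e]
  refine (norm_add_le _ _).trans ?_
  rw [norm_mul, norm_mul]
  have h1 := mul_le_mul_of_nonneg_left (S.norm_inv_f_le hx (hYn t)) (norm_nonneg (x - x'))
  have h2 := mul_le_mul hx'.le (S.norm_inv_f_sub_le hx (hYn t) hx' (hYn t)) (norm_nonneg _) hr.le
  rw [sub_self, norm_zero, add_zero] at h2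
  linarith

lemma Represents.isLeafPath_exp_flow (h : S.Represents F l) {w : ℂ} {T : ℝ} (hT : 0 ≤ T)
    (hw : w.re + 2 / S.α * T < Real.log S.b) :
    F.IsLeafPath l S.r (Icc 0 T) (fun t => Complex.exp (S.flow w t))
      (fun t => (S.c₁ : ℂ) * Complex.exp ((t : ℂ) * Complex.I)) := by
  intro t ht
  have hch := S.flow_mem_chart (w := w) (θ := T) (t := t) (by rwa [abs_of_nonneg hT])
    (by rw [abs_of_nonneg hT, abs_of_nonneg ht.1]; exact ht.2)
  have hX : ‖Complex.exp (S.flow w t)‖ < S.r := by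
    rw [← S.texp_eq hch.1.le]; exact S.norm_texp_lt _
  have hYn : ‖(S.c₁ : ℂ) * Complex.exp ((t : ℂ) * Complex.I)‖ < S.r := by
    rw [norm_mul, Complex.norm_exp_ofReal_mul_I, mul_one, Complex.norm_of_nonneg S.c₁_pos.le]
    exact S.c₁_lt.trans S.b_lt
  have h1 : HasDerivAt (fun t : ℝ => (t : ℂ) * Complex.I) Complex.I t := by
    simpa using (Complex.ofRealCLM.hasDerivAt (x := t)).mul_const Complex.I
  refine ⟨hX, hYn, _, _, (S.hasDerivAt_flow w t).cexp.hasDerivWithinAt,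
    (h1.cexp.const_mul (S.c₁ : ℂ)).hasDerivWithinAt, ?_⟩
  rw [h.form_iff _ _ _ _ hX hYn]
  have e : S.texp (S.l₁ + t * Complex.I) = (S.c₁ : ℂ) * Complex.exp ((t : ℂ) * Complex.I) := by
    rw [S.texp_eq hch.2.le, Complex.exp_add, ← Complex.ofReal_exp, l₁, Real.exp_log S.c₁_pos]
  have hf := S.f_ne_zero hX hYn
  unfold loopField G
  rw [S.texp_eq hch.1.le, e]
  field_simp
  ring

lemma Represents.holonomy_exp_iff (h : S.Represents F l) {w z' : ℂ}
    (hw : w.re + 2 / S.α * (2 * Real.pi) < Real.log S.b) :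
    F.Holonomy l S.r S.c₁ (Complex.exp w) z' ↔ z' = Complex.exp (S.flow w (2 * Real.pi)) := by
  have hpi : 0 ≤ 2 * Real.pi := by positivity
  have hp := h.isLeafPath_exp_flow hpi hw
  constructor
  · rintro ⟨X, hX0, hX1, hX⟩
    have := h.eqOn_of_isLeafPath hX hp (by simp [hX0, flow_zero])
    rw [← hX1]
    exact this ⟨hpi, le_rfl⟩
  · rintro rfl
    exact ⟨_, by simp [flow_zero], rfl, hp⟩

lemma Represents.isLeafPath_zero (h : S.Represents F l) {T : ℝ} :
    F.IsLeafPath l S.r (Icc 0 T) (fun _ => 0)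
      (fun t => (S.c₁ : ℂ) * Complex.exp ((t : ℂ) * Complex.I)) := by
  intro t _
  have hX : ‖(0 : ℂ)‖ < S.r := by simpa using S.r_pos
  have hYn : ‖(S.c₁ : ℂ) * Complex.exp ((t : ℂ) * Complex.I)‖ < S.r := by
    rw [norm_mul, Complex.norm_exp_ofReal_mul_I, mul_one, Complex.norm_of_nonneg S.c₁_pos.le]
    exact S.c₁_lt.trans S.b_lt
  have h1 : HasDerivAt (fun t : ℝ => (t : ℂ) * Complex.I) Complex.I t := by
    simpa using (Complex.ofRealCLM.hasDerivAt (x := t)).mul_const Complex.I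
  refine ⟨hX, hYn, 0, _, hasDerivWithinAt_const _ _ _,
    (h1.cexp.const_mul (S.c₁ : ℂ)).hasDerivWithinAt, ?_⟩
  rw [h.form_iff _ _ _ _ hX hYn]
  simp

lemma Represents.graphIterate_exp_iff (h : S.Represents F l) (n : ℕ) {w z' : ℂ}
    (hw : w.re + 2 / S.α * (n * (2 * Real.pi)) < Real.log S.b) :
    graphIterate (F.Holonomy l S.r S.c₁) n (Complex.exp w) z' ↔
      z' = Complex.exp (S.flow w (n * (2 * Real.pi))) := by
  have hα := S.α_pos
  have hpi := Real.pi_pos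
  induction n generalizing w with
  | zero =>
    simp only [graphIterate, Nat.cast_zero, zero_mul, flow_zero]
    exact eq_comm
  | succ n ih =>
    have e : 2 / S.α * ((n + 1 : ℕ) * (2 * Real.pi)) =
        2 / S.α * (n * (2 * Real.pi)) + 2 / S.α * (2 * Real.pi) := by push_cast; ring
    rw [e] at hw
    have h0 : 0 ≤ 2 / S.α * (n * (2 * Real.pi)) := by positivity
    have h1 : w.re + 2 / S.α * (2 * Real.pi) < Real.log S.b := by linarith
    have h2 := S.flow_re_le w (2 * Real.pi)
    rw [abs_of_pos (by positivity)] at h2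
    have h3 : S.flow (S.flow w (2 * Real.pi)) (n * (2 * Real.pi)) =
        S.flow w ((n + 1 : ℕ) * (2 * Real.pi)) := by
      have := S.flow_add_two_pi w 1 (n * (2 * Real.pi))
      rw [Int.cast_one, one_mul] at this
      rw [← this]
      congr 1
      push_cast; ring
    simp only [graphIterate, h.holonomy_exp_iff h1, exists_eq_left]
    have h4 : (S.flow w (2 * Real.pi)).re + 2 / S.α * (n * (2 * Real.pi)) < Real.log S.b := by
      linarith
    rw [← h3]
    exact ih h4

/-- Near the origin, the curve `C_{λ,k}` consists of the points that the holonomy over `k` half-turns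
maps to the real axis. -/
lemma Represents.exp_mem_holonomyLocus_iff (h : S.Represents F l) (k : ℤ) {w : ℂ}
    (hw : w.re + 4 / S.α * |k * Real.pi| < Real.log S.b) :
    Complex.exp w ∈ F.holonomyLocus l S.r S.c₁ k ↔
      ∃ m : ℤ, (S.flow w (k * Real.pi)).im = m * Real.pi := by
  have hpi := Real.pi_pos
  have key : Complex.exp (starRingEnd ℂ w) = Complex.exp (S.flow w (k * (2 * Real.pi))) ↔
      ∃ m : ℤ, (S.flow w (k * Real.pi)).im = m * Real.pi := by
    rw [eq_comm, Complex.exp_eq_exp_iff_exists_int]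
    exact exists_congr fun m => S.flow_two_pi_eq_conj_iff w k m
  rw [← key]
  show graphZIterate _ _ _ _ ↔ _
  unfold graphZIterate
  rw [abs_mul, abs_of_pos hpi] at hw
  have e4 : ∀ x : ℝ, 2 / S.α * (x * (2 * Real.pi)) = 4 / S.α * (x * Real.pi) := fun x => by ring
  split_ifs with hk
  · obtain ⟨n, rfl⟩ := Int.eq_ofNat_of_zero_le hk
    have h1 : |((n : ℤ) : ℝ)| = n := by simp
    rw [Int.toNat_natCast, h.graphIterate_exp_iff n (by rw [e4, ← h1]; exact hw),
      ← Complex.exp_conj]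
    simp
  · push Not at hk
    obtain ⟨n, hn⟩ := Int.eq_ofNat_of_zero_le (neg_nonneg.2 hk.le)
    have hk' : k = -(n : ℤ) := by omega
    have h1 : |(k : ℝ)| = n := by rw [hk']; simp
    rw [h1] at hw
    rw [hn, Int.toNat_natCast, ← Complex.exp_conj,
      h.graphIterate_exp_iff n (by rw [e4]; simpa using hw), flow_conj, hk']
    simp only [Complex.exp_conj]
    push_cast
    rw [← neg_mul]
    constructor
    · intro h2
      have := congrArg (starRingEnd ℂ) h2
      rwa [Complex.conj_conj] at this
    · intro h2
      have := congrArg (starRingEnd ℂ) h2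
      rwa [Complex.conj_conj] at this

lemma Represents.zero_mem_holonomyLocus (h : S.Represents F l) (k : ℤ) :
    (0 : ℂ) ∈ F.holonomyLocus l S.r S.c₁ k := by
  have hz : F.Holonomy l S.r S.c₁ 0 0 := ⟨fun _ => 0, rfl, rfl, h.isLeafPath_zero⟩
  have hit : ∀ n, graphIterate (F.Holonomy l S.r S.c₁) n 0 0 := by
    intro n
    induction n with
    | zero => rfl
    | succ n ih => exact ⟨0, hz, ih⟩
  show graphZIterate _ _ _ _
  unfold graphZIterate
  rw [map_zero]
  split_ifs <;> exact hit _

lemma Represents.mem_holonomyLocus_iff (h : S.Represents F l) (k : ℤ) {z : ℂ}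
    (hz : ‖z‖ < S.arcRadius (2 * (k * Real.pi))) :
    z ∈ F.holonomyLocus l S.r S.c₁ k ↔ (S.arcHolonomy (k * Real.pi) z).im = 0 := by
  rcases eq_or_ne z 0 with rfl | hz0
  · simp [h.zero_mem_holonomyLocus, arcHolonomy_zero]
  have e := Complex.exp_log hz0
  rw [← e, Complex.norm_exp, S.lt_arcRadius_iff, abs_mul, abs_two] at hz
  rw [← e, h.exp_mem_holonomyLocus_iff k (by
    have : 4 / S.α * |k * Real.pi| = 2 / S.α * (2 * |k * Real.pi|) := by ring
    rwa [this]), arcHolonomy_exp, Complex.exp_im, mul_eq_zero,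
    or_iff_right (Real.exp_pos _).ne', Real.sin_eq_zero_iff]
  exact exists_congr fun m => eq_comm

lemma Represents.isSmoothAnalyticCurveAtZero (h : S.Represents F l) (k : ℤ) :
    IsSmoothAnalyticCurveAtZero (F.holonomyLocus l S.r S.c₁ k) (direction (F.α l) k) := by
  rw [h.ratio]
  refine S.isSmoothAnalyticCurveAtZero_of_arcHolonomy ?_
  filter_upwards [Metric.ball_mem_nhds (0 : ℂ) (S.arcRadius_pos (2 * (k * Real.pi)))] with z hz
  exact h.mem_holonomyLocus_iff k (by simpa using hz)

end Saddle

/-! ### Preimages of the real axis under the holonomy over `k` half-turns -/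

namespace Saddle

variable (S : Saddle)

/-- A Lipschitz constant, in the coordinate `x`, of the displacement of the holonomy over `k`
half-turns. -/
noncomputable def shiftConst (k : ℤ) : ℝ :=
  4 * S.K / S.α ^ 2 * Real.exp (3 / S.α * |k * Real.pi|) * |k * Real.pi|

/-- The abscissae `u = log |x|` small enough for the holonomy over `k` half-turns to be controlled
and for the leaves that it reaches to be followed to `{x = c₂}`. In the first condition, the flow
over an angle `θ` moves `w` by at most `2|θ|/α` in each of the real and imaginary directions, and
the branch near `φ = kπ/α` has `|φ| ≤ |kπ|/α + 1`. -/
def Admissible (k : ℤ) (u : ℝ) : Prop :=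
  u + 5 / S.α * |k * Real.pi| + 1 < S.l₂ ∧ 4 * S.shiftConst k * Real.exp u ≤ 1

/-- The branch, near the half-line of argument `kπ/α`, of the set of points that are mapped by the
holonomy over `k` half-turns to the positive real axis. -/
def branch (k : ℤ) : Set ℂ :=
  {w | S.Admissible k w.re ∧ |w.im - k * Real.pi / S.α| ≤ 1 ∧ (S.flow w (k * Real.pi)).im = 0}

variable {S} {k : ℤ}

lemma shiftConst_nonneg : 0 ≤ S.shiftConst k := by
  have := S.K_pos
  have := S.α_pos
  unfold shiftConst; positivity

lemma Admissible.mono {u u' : ℝ} (h : S.Admissible k u) (hu : u' ≤ u) : S.Admissible k u' := by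
  have h1 := h.1
  refine ⟨by linarith, le_trans ?_ h.2⟩
  exact mul_le_mul_of_nonneg_left (Real.exp_le_exp.2 hu)
    (mul_nonneg (by norm_num) shiftConst_nonneg)

lemma Admissible.lt_log {u : ℝ} (h : S.Admissible k u) :
    u + 4 / S.α * |k * Real.pi| < Real.log S.b := by
  have h1 := h.1
  have h2 := S.l₂_lt
  have h3 : 4 / S.α * |k * Real.pi| ≤ 5 / S.α * |k * Real.pi| := by
    have := S.α_pos
    gcongr; norm_num
  linarith

lemma Admissible.le_log {u : ℝ} (h : S.Admissible k u) :
    u + 2 / S.α * |k * Real.pi| ≤ Real.log S.b := by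
  have h1 := h.lt_log
  have h3 : 2 / S.α * |k * Real.pi| ≤ 4 / S.α * |k * Real.pi| := by
    have := S.α_pos
    gcongr; norm_num
  linarith

lemma abs_flow_im_sub_le (w : ℂ) :
    |(S.flow w (k * Real.pi)).im - (w.im - k * Real.pi / S.α)| ≤
      S.shiftConst k * Real.exp w.re := by
  have h1 := (Complex.abs_im_le_norm _).trans
    (S.norm_displacement_sub_limitShift_le w (k * Real.pi))
  rw [Complex.sub_im, Complex.sub_im, S.limitShift_im] at h1
  rw [show (S.flow w (k * Real.pi)).im - (w.im - k * Real.pi / S.α) =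
    (S.flow w (k * Real.pi)).im - w.im - -(k * Real.pi / S.α) by ring]
  exact h1

lemma abs_im_sub_le_of_flow_im {w : ℂ} (h : (S.flow w (k * Real.pi)).im = 0) :
    |w.im - k * Real.pi / S.α| ≤ S.shiftConst k * Real.exp w.re := by
  have := abs_flow_im_sub_le (S := S) (k := k) w
  rwa [h, zero_sub, abs_neg] at this

lemma mem_branch_of_flow_im {w : ℂ} (hu : S.Admissible k w.re)
    (h : (S.flow w (k * Real.pi)).im = 0) : w ∈ S.branch k :=
  ⟨hu, (abs_im_sub_le_of_flow_im h).trans (by linarith [hu.2]), h⟩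

/-- Every admissible vertical line meets the branch, by the intermediate value theorem: on it the
imaginary part of the flow is within `1/4` of `φ - kπ/α`. -/
lemma exists_mem_branch {u : ℝ} (hu : S.Admissible k u) : ∃ φ : ℝ, (⟨u, φ⟩ : ℂ) ∈ S.branch k := by
  set c := k * Real.pi / S.α with hc
  have hmk : ∀ φ : ℝ, (⟨u, φ⟩ : ℂ) = u + φ * Complex.I := fun φ => by
    apply Complex.ext <;> simp
  have hcont : ContinuousOn (fun φ : ℝ => (S.flow ⟨u, φ⟩ (k * Real.pi)).im) (Icc (c - 1) (c + 1)) := by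
    refine continuousOn_of_forall_continuousAt fun φ _ => ?_
    have h1 : ContinuousAt (fun w => S.flow w (k * Real.pi)) (⟨u, φ⟩ : ℂ) := by
      refine (S.differentiableAt_flow ?_).continuousAt
      have h2 := hu.lt_log
      have h3 : 2 / S.α * |k * Real.pi| ≤ 4 / S.α * |k * Real.pi| := by
        have := S.α_pos
        gcongr; norm_num
      show u + _ < _
      linarith
    have h2 : ContinuousAt (fun φ : ℝ => (⟨u, φ⟩ : ℂ)) φ := by
      simp only [hmk]; fun_prop
    exact Complex.continuous_im.continuousAt.comp (ContinuousAt.comp (f := fun φ : ℝ => (⟨u, φ⟩ : ℂ))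
      (g := fun w => S.flow w (k * Real.pi)) h1 h2)
  have hb : ∀ φ : ℝ, |(S.flow ⟨u, φ⟩ (k * Real.pi)).im - (φ - c)| ≤ 1 / 4 := fun φ => by
    have h1 := abs_flow_im_sub_le (S := S) (k := k) ⟨u, φ⟩
    have h2 : 4 * S.shiftConst k * Real.exp u ≤ 1 := hu.2
    exact h1.trans (by show _ * Real.exp u ≤ _; linarith)
  have h1 := (abs_le.1 (hb (c - 1))).2
  have h2 := (abs_le.1 (hb (c + 1))).1
  obtain ⟨φ, hφ, h0⟩ := intermediate_value_Icc (by linarith : c - 1 ≤ c + 1) hcont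
    (show (0 : ℝ) ∈ Icc _ _ from ⟨by linarith, by linarith⟩)
  exact ⟨φ, hu, abs_le.2 ⟨by linarith [hφ.1], by linarith [hφ.2]⟩, h0⟩

/-- The branch is the graph of a function of `u = log |x|` which is Lipschitz in `exp u`. -/
lemma abs_im_sub_le_of_mem_branch {w w' : ℂ} (hw : w ∈ S.branch k) (hw' : w' ∈ S.branch k) :
    |w.im - w'.im| ≤ 2 * S.shiftConst k * |Real.exp w.re - Real.exp w'.re| := by
  have h1 := (Complex.abs_im_le_norm _).trans
    (S.norm_displacement_sub_le hw.1.le_log hw'.1.le_log)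
  simp only [Complex.sub_im, hw.2.2, hw'.2.2] at h1
  have h2 : |w.im - w'.im| ≤ S.shiftConst k * ‖Complex.exp w - Complex.exp w'‖ := by
    rw [abs_sub_comm]
    rwa [show (0 - w.im - (0 - w'.im)) = w'.im - w.im by ring] at h1
  have h3 : ‖Complex.exp w - Complex.exp w'‖ ≤
      |Real.exp w.re - Real.exp w'.re| + Real.exp w'.re * |w.im - w'.im| := by
    have e : Complex.exp w - Complex.exp w' =
        ((Real.exp w.re - Real.exp w'.re : ℝ) : ℂ) * Complex.exp (w.im * Complex.I) +
        (Real.exp w'.re : ℂ) * (Complex.exp (w.im * Complex.I) -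
          Complex.exp (w'.im * Complex.I)) := by
      have hx : ∀ v : ℂ, Complex.exp v = (Real.exp v.re : ℂ) * Complex.exp (v.im * Complex.I) := by
        intro v
        rw [Complex.ofReal_exp, ← Complex.exp_add, Complex.re_add_im]
      rw [hx w, hx w']
      push_cast
      ring
    rw [e]
    refine (norm_add_le _ _).trans ?_
    rw [norm_mul, norm_mul, Complex.norm_exp_ofReal_mul_I, mul_one, Complex.norm_real,
      Complex.norm_of_nonneg (Real.exp_pos _).le, Real.norm_eq_abs]
    refine add_le_add le_rfl (mul_le_mul_of_nonneg_left ?_ (Real.exp_pos _).le)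
    have := norm_exp_sub_exp_le (c := 0) (w := w.im * Complex.I) (w' := w'.im * Complex.I)
      (by simp) (by simp)
    rw [Real.exp_zero, one_mul, ← sub_mul, norm_mul, Complex.norm_I, mul_one,
      ← Complex.ofReal_sub, Complex.norm_real, Real.norm_eq_abs] at this
    exact this
  have h4 := mul_le_mul_of_nonneg_left h3 (shiftConst_nonneg (S := S) (k := k))
  have h5 := hw'.1.2
  have h6 : S.shiftConst k * (Real.exp w'.re * |w.im - w'.im|) ≤ 1 / 4 * |w.im - w'.im| := by
    rw [← mul_assoc]
    exact mul_le_mul_of_nonneg_right (by linarith) (abs_nonneg _)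
  have h7 : 0 ≤ S.shiftConst k * |Real.exp w.re - Real.exp w'.re| :=
    mul_nonneg shiftConst_nonneg (abs_nonneg _)
  linarith

lemma eq_of_mem_branch {w w' : ℂ} (hw : w ∈ S.branch k) (hw' : w' ∈ S.branch k)
    (h : w.re = w'.re) : w = w' := by
  have := abs_im_sub_le_of_mem_branch hw hw'
  rw [h, sub_self, abs_zero, mul_zero] at this
  exact Complex.ext h (sub_eq_zero.1 (abs_nonpos_iff.1 this))

/-- One half of the comparison of the zero locus with the holonomy; the converse,
`mem_branch_of_logDulac_im`, follows since on each vertical line the value `kπ` is attained only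
once. -/
lemma logDulac_im_of_mem_branch {w : ℂ} (hw : w ∈ S.branch k) :
    w ∈ S.wedge ∧ (S.logDulac w).im = k * Real.pi := by
  have hα := S.α_pos
  have h1 := hw.1.1
  have h2 : |w.im| ≤ 1 / S.α * |k * Real.pi| + 1 := by
    have h3 := abs_sub_abs_le_abs_sub w.im (k * Real.pi / S.α)
    rw [abs_div, abs_of_pos hα] at h3
    have h4 := hw.2.1
    have h5 : |k * Real.pi| / S.α = 1 / S.α * |k * Real.pi| := by ring
    linarith
  have h3 : 5 / S.α * |k * Real.pi| = 4 / S.α * |k * Real.pi| + 1 / S.α * |k * Real.pi| := by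
    ring
  have h4 : w.re + |w.im| + 4 / S.α * |k * Real.pi| < S.l₂ := by linarith
  refine ⟨?_, S.logDulac_im_of_flow_im h4 hw.2.2⟩
  have : 0 ≤ 4 / S.α * |k * Real.pi| := by positivity
  show w.re + |w.im| < S.l₂
  linarith

lemma mem_branch_of_logDulac_im {w : ℂ} (hu : S.Admissible k w.re) (hw : w ∈ S.wedge)
    (h : (S.logDulac w).im = k * Real.pi) : w ∈ S.branch k := by
  obtain ⟨φ, hφ⟩ := exists_mem_branch hu
  obtain ⟨h1, h2⟩ := logDulac_im_of_mem_branch hφ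
  have : w.im = φ := S.eq_of_logDulac_im_eq (u := w.re) hw h1 (h.trans h2.symm)
  have e : w = ⟨w.re, φ⟩ := Complex.ext rfl this
  rw [e]; exact hφ

variable (S) in
/-- The domains `0 < ρ < ρ(φ)` on which the branches of the zero locus are connected: `ρ` is small
with respect to the constants of the branches that enter the domain near the argument `φ`, and its
slope is small along each branch. -/
structure IsAdapted (ρ : ℝ → ℝ) : Prop where
  continuous : Continuous ρ
  pos : ∀ φ, 0 < ρ φ
  mem_wedge : ∀ w ∈ polarDomain ρ, w ∈ S.wedge
  admissible : ∀ w ∈ polarDomain ρ, ∀ k : ℤ, |k * Real.pi| ≤ 3 / 2 * S.α * |w.im| →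
    S.Admissible k w.re
  slope : ∀ (k : ℤ) (φ φ' : ℝ), |φ - k * Real.pi / S.α| ≤ 1 → |φ' - k * Real.pi / S.α| ≤ 1 →
    4 * S.shiftConst k * |ρ φ - ρ φ'| ≤ |φ - φ'|

end Saddle

/-! ### The connected components of the zero locus -/

namespace Saddle

variable {S : Saddle} {ρ : ℝ → ℝ} {k : ℤ}

variable (S ρ k) in
/-- The part of the zero locus of the imaginary part of the Dulac map on which the argument of its
values is `kπ`. -/
def zeroBranch : Set ℂ := {w | w ∈ polarDomain ρ ∧ (S.logDulac w).im = k * Real.pi}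

lemma IsAdapted.mem_branch (hρ : S.IsAdapted ρ) {w : ℂ} (hw : w ∈ S.zeroBranch ρ k) :
    w ∈ S.branch k := by
  have h1 := hρ.mem_wedge w hw.1
  have h2 := S.abs_logDulac_im_le h1
  rw [hw.2] at h2
  exact mem_branch_of_logDulac_im (hρ.admissible w hw.1 k h2) h1 hw.2

lemma IsAdapted.abs_sub_le (hρ : S.IsAdapted ρ) {w w' : ℂ} (hw : w ∈ S.branch k)
    (hw' : w' ∈ S.branch k) :
    |ρ w.im - ρ w'.im| ≤ 1 / 2 * |Real.exp w.re - Real.exp w'.re| := by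
  have h1 := hρ.slope k w.im w'.im hw.2.1 hw'.2.1
  have h2 := abs_im_sub_le_of_mem_branch hw hw'
  rcases (shiftConst_nonneg (S := S) (k := k)).eq_or_lt with h | h
  · rw [← h, mul_zero, zero_mul] at h2
    rw [sub_eq_zero.1 (abs_nonpos_iff.1 h2), sub_self, abs_zero]
    positivity
  · have h3 : S.shiftConst k * (4 * |ρ w.im - ρ w'.im|) ≤
        S.shiftConst k * (2 * |Real.exp w.re - Real.exp w'.re|) := by linarith
    have := le_of_mul_le_mul_left h3 h
    linarith

/-- Following a branch towards the origin does not leave an adapted domain. -/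
lemma IsAdapted.mem_zeroBranch_of_re_le (hρ : S.IsAdapted ρ) {w w' : ℂ}
    (hw : w ∈ S.zeroBranch ρ k) (hw' : w' ∈ S.branch k) (h : w'.re ≤ w.re) :
    w' ∈ S.zeroBranch ρ k := by
  refine ⟨?_, (logDulac_im_of_mem_branch hw').2⟩
  have h1 := hρ.abs_sub_le (hρ.mem_branch hw) hw'
  have h2 := Real.exp_le_exp.2 h
  rw [abs_of_nonneg (by linarith : 0 ≤ Real.exp w.re - Real.exp w'.re)] at h1
  have h3 := le_abs_self (ρ w.im - ρ w'.im)
  have h4 : Real.exp w.re < ρ w.im := hw.1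
  show Real.exp w'.re < ρ w'.im
  linarith

/-- A zero branch has no point of maximal radius. -/
lemma IsAdapted.exists_re_lt (hρ : S.IsAdapted ρ) {w : ℂ} (hw : w ∈ S.zeroBranch ρ k) :
    ∃ w' ∈ S.zeroBranch ρ k, w.re < w'.re := by
  have h4 : Real.exp w.re < ρ w.im := hw.1
  have hpos := Real.exp_pos w.re
  set e := (Real.exp w.re + ρ w.im) / 2 with he
  have hexp : Real.exp (Real.log e) = e := Real.exp_log (by linarith)
  have hdom : (⟨Real.log e, w.im⟩ : ℂ) ∈ polarDomain ρ := by
    show Real.exp (Real.log e) < ρ w.im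
    rw [hexp]; linarith
  have h2 := S.abs_logDulac_im_le (hρ.mem_wedge w hw.1)
  rw [hw.2] at h2
  obtain ⟨φ, hφ⟩ := exists_mem_branch (hρ.admissible _ hdom k h2)
  have h1 := hρ.abs_sub_le (hρ.mem_branch hw) hφ
  have hφ' : |Real.exp w.re - Real.exp (Real.log e)| = e - Real.exp w.re := by
    rw [hexp, abs_sub_comm, abs_of_nonneg (by linarith)]
  refine ⟨⟨Real.log e, φ⟩, ⟨?_, (logDulac_im_of_mem_branch hφ).2⟩, ?_⟩
  · show Real.exp (Real.log e) < ρ φ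
    have h3 : |ρ w.im - ρ φ| ≤ 1 / 2 * |Real.exp w.re - Real.exp (Real.log e)| := h1
    rw [hφ'] at h3
    have := le_abs_self (ρ w.im - ρ φ)
    rw [hexp]
    linarith
  · show w.re < Real.log e
    rw [Real.lt_log_iff_exp_lt (by linarith)]
    linarith

lemma exists_admissible (S : Saddle) (k : ℤ) : ∃ u, S.Admissible k u := by
  have h1 : Tendsto (fun u : ℝ => 4 * S.shiftConst k * Real.exp u) atBot (𝓝 0) := by
    simpa using Real.tendsto_exp_atBot.const_mul (4 * S.shiftConst k)
  have h2 := (h1.eventually (ge_mem_nhds one_pos)).and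
    (eventually_lt_atBot (S.l₂ - (5 / S.α * |k * Real.pi| + 1)))
  obtain ⟨u, hu⟩ := h2.exists
  exact ⟨u, by linarith [hu.2], hu.1⟩

lemma IsAdapted.nonempty_zeroBranch (hρ : S.IsAdapted ρ) (k : ℤ) :
    (S.zeroBranch ρ k).Nonempty := by
  obtain ⟨u₀, hu₀⟩ := S.exists_admissible k
  set c := k * Real.pi / S.α
  obtain ⟨φ₀, -, hmin⟩ := isCompact_Icc.exists_isMinOn
    (nonempty_Icc.2 (by linarith : c - 1 ≤ c + 1)) hρ.continuous.continuousOn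
  have hpos := hρ.pos φ₀
  set u := min u₀ (Real.log (ρ φ₀ / 2))
  have hu := hu₀.mono (min_le_left u₀ (Real.log (ρ φ₀ / 2)))
  obtain ⟨φ, hφ⟩ := exists_mem_branch hu
  refine ⟨_, ?_, (logDulac_im_of_mem_branch hφ).2⟩
  have h1 : Real.exp u ≤ ρ φ₀ / 2 := by
    calc Real.exp u ≤ Real.exp (Real.log (ρ φ₀ / 2)) := Real.exp_le_exp.2 (min_le_right _ _)
      _ = ρ φ₀ / 2 := Real.exp_log (by linarith)
  have h2 : φ ∈ Icc (c - 1) (c + 1) := by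
    have h3 : |φ - c| ≤ 1 := hφ.2.1
    have := abs_le.1 h3
    exact ⟨by linarith, by linarith⟩
  have h3 : ρ φ₀ ≤ ρ φ := hmin h2
  show Real.exp u < ρ φ
  linarith

/-- In an adapted domain the zero branch is a branch cut off at a certain radius. -/
lemma IsAdapted.exists_eq_re_lt (hρ : S.IsAdapted ρ) (k : ℤ) :
    ∃ U : ℝ, (∀ u < U, S.Admissible k u) ∧ S.zeroBranch ρ k = {w | w ∈ S.branch k ∧ w.re < U} := by
  set A := Complex.re '' S.zeroBranch ρ k
  have hne : A.Nonempty := (hρ.nonempty_zeroBranch k).image _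
  have hbd : BddAbove A := by
    refine ⟨S.l₂, ?_⟩
    rintro _ ⟨w, hw, rfl⟩
    have h1 := (hρ.mem_branch hw).1.1
    have h2 : 0 ≤ 5 / S.α * |k * Real.pi| := by have := S.α_pos; positivity
    linarith
  have hlt : ∀ u < sSup A, ∃ w ∈ S.zeroBranch ρ k, u < w.re := by
    intro u hu
    obtain ⟨_, ⟨w, hw, rfl⟩, hlt⟩ := exists_lt_of_lt_csSup hne hu
    exact ⟨w, hw, hlt⟩
  refine ⟨sSup A, fun u hu => ?_, Subset.antisymm (fun w hw => ⟨hρ.mem_branch hw, ?_⟩) ?_⟩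
  · obtain ⟨w, hw, h⟩ := hlt u hu
    exact (hρ.mem_branch hw).1.mono h.le
  · obtain ⟨w', hw', h⟩ := hρ.exists_re_lt hw
    exact h.trans_le (le_csSup hbd ⟨w', hw', rfl⟩)
  · rintro w ⟨hw, hu⟩
    obtain ⟨w', hw', h⟩ := hlt _ hu
    exact hρ.mem_zeroBranch_of_re_le hw' hw h.le

lemma IsAdapted.exists_mem_zeroBranch_re_lt (hρ : S.IsAdapted ρ) (k : ℤ) (u : ℝ) :
    ∃ w ∈ S.zeroBranch ρ k, w.re < u := by
  obtain ⟨U, hU, he⟩ := hρ.exists_eq_re_lt k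
  have h1 := min_le_left u U
  have h2 := min_le_right u U
  obtain ⟨φ, hφ⟩ := exists_mem_branch (hU (min u U - 1) (by linarith))
  refine ⟨⟨min u U - 1, φ⟩, ?_, ?_⟩
  · rw [he]
    refine ⟨hφ, ?_⟩
    show min u U - 1 < U; linarith
  · show min u U - 1 < u; linarith

lemma IsAdapted.isPreconnected_zeroBranch (hρ : S.IsAdapted ρ) (k : ℤ) :
    IsPreconnected (S.zeroBranch ρ k) := by
  obtain ⟨U, hU, he⟩ := hρ.exists_eq_re_lt k
  choose! g hg using fun u (hu : u < U) => exists_mem_branch (hU u hu)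
  have himg : S.zeroBranch ρ k = (fun u : ℝ => (⟨u, g u⟩ : ℂ)) '' Iio U := by
    rw [he]
    refine Subset.antisymm ?_ ?_
    · rintro w ⟨hw, hu⟩
      exact ⟨w.re, hu, (eq_of_mem_branch hw (hg _ hu) rfl).symm⟩
    · rintro _ ⟨u, hu, rfl⟩
      exact ⟨hg u hu, hu⟩
  rw [himg]
  refine isPreconnected_Iio.image _ ?_
  have hgc : ContinuousOn g (Iio U) := by
    intro u hu
    have hlim : Tendsto (fun u' => 2 * S.shiftConst k * |Real.exp u' - Real.exp u|)
        (𝓝[Iio U] u) (𝓝 0) := by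
      have : Tendsto (fun u' => 2 * S.shiftConst k * |Real.exp u' - Real.exp u|) (𝓝 u)
          (𝓝 (2 * S.shiftConst k * |Real.exp u - Real.exp u|)) :=
        Continuous.tendsto (by fun_prop) u
      rw [sub_self, abs_zero, mul_zero] at this
      exact this.mono_left nhdsWithin_le_nhds
    rw [ContinuousWithinAt, tendsto_iff_dist_tendsto_zero]
    refine squeeze_zero' (Eventually.of_forall fun _ => dist_nonneg) ?_ hlim
    filter_upwards [self_mem_nhdsWithin] with u' hu'
    exact abs_im_sub_le_of_mem_branch (hg u' hu') (hg u hu)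
  have e : (fun u : ℝ => (⟨u, g u⟩ : ℂ)) = fun u : ℝ => (u : ℂ) + g u * Complex.I := by
    ext u; apply Complex.ext <;> simp
  rw [e]
  exact Complex.continuous_ofReal.continuousOn.add
    ((Complex.continuous_ofReal.comp_continuousOn hgc).mul continuousOn_const)

/-- The zero locus is the disjoint union of the zero branches, since `Im exp V = 0` means that
`Im V` is a multiple of `π`. -/
lemma imZeroLocus_eq : imZeroLocus (fun w => Complex.exp (S.logDulac w)) ρ =
    ⋃ k, S.zeroBranch ρ k := by
  ext w
  simp only [imZeroLocus, zeroBranch, mem_ofPred_eq, mem_iUnion, exists_and_left]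
  refine and_congr_right fun _ => ?_
  rw [Complex.exp_im, mul_eq_zero, or_iff_right (Real.exp_pos _).ne', Real.sin_eq_zero_iff]
  exact exists_congr fun m => eq_comm

lemma IsAdapted.injective_zeroBranch (hρ : S.IsAdapted ρ) :
    Function.Injective (S.zeroBranch ρ) := by
  intro k k' h
  obtain ⟨w, hw⟩ := hρ.nonempty_zeroBranch k
  have hw' := hw
  rw [h] at hw'
  have h1 : (k : ℝ) * Real.pi = k' * Real.pi := hw.2.symm.trans hw'.2
  exact_mod_cast mul_right_cancel₀ Real.pi_ne_zero h1

lemma IsAdapted.exists_zeroBranch_eq_component (hρ : S.IsAdapted ρ) (k : ℤ) :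
    ∃ w ∈ imZeroLocus (fun w => Complex.exp (S.logDulac w)) ρ, S.zeroBranch ρ k =
      connectedComponentIn (imZeroLocus (fun w => Complex.exp (S.logDulac w)) ρ) w := by
  obtain ⟨w, hw⟩ := hρ.nonempty_zeroBranch k
  set Z := imZeroLocus (fun w => Complex.exp (S.logDulac w)) ρ with hZ
  have hsub : S.zeroBranch ρ k ⊆ Z := by
    rw [hZ, imZeroLocus_eq]; exact subset_iUnion _ k
  refine ⟨w, hsub hw, Subset.antisymm
    ((hρ.isPreconnected_zeroBranch k).subset_connectedComponentIn hw hsub) ?_⟩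
  -- on the component the continuous function `Im V` takes its values in the discrete set `πℤ`
  intro w' hw'
  set Q := connectedComponentIn Z w with hQ
  have hQZ : Q ⊆ Z := connectedComponentIn_subset _ _
  have hQd : Q ⊆ polarDomain ρ := fun x hx => (hQZ hx).1
  have hcont : ContinuousOn (fun w => (S.logDulac w).im / Real.pi) Q :=
    (Complex.continuous_im.comp_continuousOn
      (S.analyticOnNhd_logDulac.continuousOn.mono (hQd.trans hρ.mem_wedge))).div_const _
  have hpre : IsPreconnected Q := isPreconnected_connectedComponentIn
  have hint : MapsTo (fun w => (S.logDulac w).im / Real.pi) Q (range ((↑) : ℤ → ℝ)) := by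
    intro x hx
    have h1 := hQZ hx
    rw [hZ, imZeroLocus_eq] at h1
    obtain ⟨m, hm⟩ := mem_iUnion.1 h1
    exact ⟨m, by simp only [hm.2, mul_div_cancel_right₀ _ Real.pi_ne_zero]⟩
  have h2 := hpre.constant_of_mapsTo Int.isClosedEmbedding_coe_real.isInducing.isDiscrete_range
    hcont hint hw' (mem_connectedComponentIn (hsub hw))
  refine ⟨hQd hw', ?_⟩
  have h3 : (S.logDulac w').im / Real.pi = (S.logDulac w).im / Real.pi := h2
  rw [div_left_inj' Real.pi_ne_zero] at h3
  rw [h3, hw.2]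

lemma IsAdapted.tendsto_im (hρ : S.IsAdapted ρ) (k : ℤ) :
    Tendsto Complex.im (comap Complex.re atBot ⊓ 𝓟 (S.zeroBranch ρ k))
      (𝓝 ((k : ℝ) * Real.pi / S.α)) := by
  rw [tendsto_iff_dist_tendsto_zero]
  have h1 : Tendsto (fun w : ℂ => S.shiftConst k * Real.exp w.re)
      (comap Complex.re atBot ⊓ 𝓟 (S.zeroBranch ρ k)) (𝓝 0) := by
    have h2 : Tendsto (fun w : ℂ => Real.exp w.re) (comap Complex.re atBot) (𝓝 0) :=
      Real.tendsto_exp_atBot.comp tendsto_comap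
    simpa using (h2.mono_left inf_le_left).const_mul (S.shiftConst k)
  refine squeeze_zero' (Eventually.of_forall fun _ => dist_nonneg) ?_ h1
  refine eventually_inf_principal.2 (Eventually.of_forall fun w hw => ?_)
  exact abs_im_sub_le_of_flow_im (hρ.mem_branch hw).2.2

lemma IsAdapted.isTangentToHalfLine (hρ : S.IsAdapted ρ) (k : ℤ) :
    IsTangentToHalfLine (Complex.exp '' S.zeroBranch ρ k) (direction S.α k) := by
  constructor
  · rw [Metric.mem_closure_iff]
    intro ε hε
    obtain ⟨w, hw, hlt⟩ := hρ.exists_mem_zeroBranch_re_lt k (Real.log ε)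
    refine ⟨_, mem_image_of_mem _ hw, ?_⟩
    rw [dist_zero_left, Complex.norm_exp]
    exact (Real.lt_log_iff_exp_lt hε).1 hlt
  · have hlim : Tendsto (fun z : ℂ => S.shiftConst k * ‖z‖)
        (𝓝[Complex.exp '' S.zeroBranch ρ k] 0) (𝓝 0) := by
      have : Tendsto (fun z : ℂ => S.shiftConst k * ‖z‖) (𝓝 0) (𝓝 (S.shiftConst k * ‖(0 : ℂ)‖)) :=
        (continuous_const.mul continuous_norm).tendsto 0
      rw [norm_zero, mul_zero] at this
      exact this.mono_left nhdsWithin_le_nhds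
    rw [tendsto_iff_norm_sub_tendsto_zero]
    refine squeeze_zero' (Eventually.of_forall fun _ => norm_nonneg _) ?_ hlim
    filter_upwards [self_mem_nhdsWithin] with z hz
    obtain ⟨w, hw, rfl⟩ := hz
    have h1 := abs_im_sub_le_of_flow_im (hρ.mem_branch hw).2.2
    have e : Complex.exp w / (‖Complex.exp w‖ : ℂ) = Complex.exp (w.im * Complex.I) := by
      rw [Complex.norm_exp, Complex.ofReal_exp, ← Complex.exp_sub]
      congr 1
      apply Complex.ext <;> simp
    rw [e, direction, Complex.norm_exp]
    have := norm_exp_sub_exp_le (c := 0) (w := w.im * Complex.I)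
      (w' := ((k * Real.pi / S.α : ℝ) : ℂ) * Complex.I) (by simp) (by simp)
    rw [Real.exp_zero, one_mul, ← sub_mul, norm_mul, Complex.norm_I, mul_one,
      ← Complex.ofReal_sub, Complex.norm_real, Real.norm_eq_abs] at this
    exact this.trans h1

variable {N : ℕ} {F : SaddleFamily N} {l : Fin N → ℝ}

/-- The projection of a zero branch is one of the two components into which the origin divides the
curve `C_{λ,k}` in a disc, namely the one on which the holonomy over `k` half-turns is positive. -/
lemma IsAdapted.exists_image_eq_component (hρ : S.IsAdapted ρ) (h : S.Represents F l) (k : ℤ) :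
    ∃ R > 0, ∃ z ∈ (F.holonomyLocus l S.r S.c₁ k ∩ Metric.ball 0 R) \ {0},
      Complex.exp '' S.zeroBranch ρ k =
        connectedComponentIn ((F.holonomyLocus l S.r S.c₁ k ∩ Metric.ball 0 R) \ {0}) z := by
  obtain ⟨U, hU, he⟩ := hρ.exists_eq_re_lt k
  set C := (F.holonomyLocus l S.r S.c₁ k ∩ Metric.ball 0 (Real.exp U)) \ {0} with hC
  set T := S.arcHolonomy (k * Real.pi) with hT
  have hball : ∀ w : ℂ, Complex.exp w ∈ Metric.ball (0 : ℂ) (Real.exp U) ↔ w.re < U := by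
    intro w
    rw [mem_ball_zero_iff, Complex.norm_exp, Real.exp_lt_exp]
  have hiff : ∀ w : ℂ, w.re < U → (Complex.exp w ∈ F.holonomyLocus l S.r S.c₁ k ↔
      ∃ m : ℤ, (S.flow w (k * Real.pi)).im = m * Real.pi) := fun w hw =>
    h.exp_mem_holonomyLocus_iff k (hU _ hw).lt_log
  have hsub : Complex.exp '' S.zeroBranch ρ k ⊆ C := by
    rintro _ ⟨w, hw, rfl⟩
    rw [he] at hw
    refine ⟨⟨(hiff w hw.2).2 ⟨0, by rw [hw.1.2.2]; simp⟩, (hball w).2 hw.2⟩, Complex.exp_ne_zero w⟩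
  have hexists : ∀ z ∈ C, ∃ w : ℂ, Complex.exp w = z ∧ w.re < U ∧
      ∃ m : ℤ, (S.flow w (k * Real.pi)).im = m * Real.pi := by
    rintro z ⟨⟨hz, hzb⟩, hz0⟩
    have hz0' : z ≠ 0 := hz0
    rw [← Complex.exp_log hz0'] at hz hzb
    have h1 := (hball _).1 hzb
    exact ⟨_, Complex.exp_log hz0', h1, (hiff _ h1).1 hz⟩
  have hTne : ∀ z ∈ C, (T z).re ≠ 0 := by
    intro z hz h0
    obtain ⟨w, rfl, -, m, hm⟩ := hexists z hz
    rw [hT, arcHolonomy_exp, Complex.exp_re, mul_eq_zero, or_iff_right (Real.exp_pos _).ne',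
      hm] at h0
    have := Real.sin_sq_add_cos_sq (m * Real.pi)
    rw [Real.sin_int_mul_pi, h0] at this
    norm_num at this
  have hpos : ∀ z ∈ C, 0 < (T z).re → z ∈ Complex.exp '' S.zeroBranch ρ k := by
    intro z hz h0
    obtain ⟨w, rfl, hwU, m, hm⟩ := hexists z hz
    have him : (T (Complex.exp w)).im = 0 := by
      rw [hT, arcHolonomy_exp, Complex.exp_im, hm, Real.sin_int_mul_pi, mul_zero]
    -- a logarithm of the value of the holonomy that is real
    have h1 : Complex.exp (S.flow w (k * Real.pi)) =
        Complex.exp ((Real.log (T (Complex.exp w)).re : ℝ) : ℂ) := by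
      rw [← Complex.ofReal_exp, Real.exp_log h0, ← S.arcHolonomy_exp]
      apply Complex.ext <;> simp [him, ← hT]
    obtain ⟨n, hn⟩ := Complex.exp_eq_exp_iff_exists_int.1 h1
    refine ⟨w + (-n : ℤ) * (2 * Real.pi * Complex.I), ?_, Complex.exp_periodic.int_mul (-n) w⟩
    have hre : (w + (-n : ℤ) * (2 * Real.pi * Complex.I)).re = w.re := by simp
    rw [he]
    refine ⟨mem_branch_of_flow_im (by rw [hre]; exact hU _ hwU) ?_, by
      show (w + (-n : ℤ) * (2 * Real.pi * Complex.I)).re < U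
      rw [hre]; exact hwU⟩
    rw [flow_add_period]
    simp [hn]
  have hpos' : ∀ z ∈ Complex.exp '' S.zeroBranch ρ k, 0 < (T z).re := by
    rintro _ ⟨w, hw, rfl⟩
    rw [hT, arcHolonomy_exp, Complex.exp_re, (hρ.mem_branch hw).2.2, Real.cos_zero, mul_one]
    exact Real.exp_pos _
  obtain ⟨w, hw⟩ := hρ.nonempty_zeroBranch k
  have hz : Complex.exp w ∈ Complex.exp '' S.zeroBranch ρ k := mem_image_of_mem _ hw
  refine ⟨Real.exp U, Real.exp_pos U, Complex.exp w, hsub hz, Subset.antisymm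
    (((hρ.isPreconnected_zeroBranch k).image _
      Complex.continuous_exp.continuousOn).subset_connectedComponentIn hz hsub) ?_⟩
  intro z' hz'
  set Q := connectedComponentIn C (Complex.exp w) with hQ
  have hQC : Q ⊆ C := connectedComponentIn_subset _ _
  have hTc : ContinuousOn (fun z => (T z).re) Q := by
    intro z hz
    have hzC := hQC hz
    obtain ⟨w₁, rfl, hw₁, -⟩ := hexists z hzC
    refine (Complex.continuous_re.continuousAt.comp ?_).continuousWithinAt
    refine (S.differentiableAt_arcHolonomy (Complex.exp_ne_zero _) ?_).continuousAt
    rw [Complex.norm_exp, S.lt_arcRadius_iff]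
    have h1 := (hU _ hw₁).lt_log
    have h3 : 2 / S.α * |k * Real.pi| ≤ 4 / S.α * |k * Real.pi| := by
      have := S.α_pos
      gcongr; norm_num
    linarith
  have himg := (isPreconnected_connectedComponentIn (F := C) (x := Complex.exp w)).image _ hTc
  refine hpos z' (hQC hz') ?_
  by_contra hneg
  push Not at hneg
  have := himg.Icc_subset ⟨z', hz', rfl⟩ ⟨Complex.exp w, mem_connectedComponentIn (hsub hz), rfl⟩
    ⟨hneg, (hpos' _ hz).le⟩
  obtain ⟨z'', hz'', h0⟩ := this
  exact hTne z'' (hQC hz'') h0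

end Saddle

/-! ### Existence of adapted domains -/

/-- A continuous positive function on `ℝ` has a positive `1`-Lipschitz minorant. -/
lemma exists_lipschitz_minorant {m : ℝ → ℝ} (hm : Continuous m) (hpos : ∀ φ, 0 < m φ) :
    ∃ q : ℝ → ℝ, (∀ φ, 0 < q φ ∧ q φ ≤ m φ) ∧ ∀ φ φ', |q φ - q φ'| ≤ |φ - φ'| := by
  -- the distance to the epigraph of `m`
  set E : Set (ℝ × ℝ) := {p | m p.1 ≤ p.2} with hE
  have hclosed : IsClosed E := isClosed_le (hm.comp continuous_fst) continuous_snd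
  have hmem : ∀ φ, (φ, m φ) ∈ E := fun φ => le_refl (m φ)
  refine ⟨fun φ => Metric.infDist (φ, (0 : ℝ)) E, fun φ => ⟨?_, ?_⟩, fun φ φ' => ?_⟩
  · refine (hclosed.notMem_iff_infDist_pos ⟨_, hmem 0⟩).1 fun h => ?_
    have : m φ ≤ 0 := h
    linarith [hpos φ]
  · refine (Metric.infDist_le_dist_of_mem (hmem φ)).trans ?_
    rw [Prod.dist_eq, dist_self, Real.dist_eq, zero_sub, abs_neg, abs_of_pos (hpos φ)]
    exact max_le (hpos φ).le le_rfl
  · have := (Metric.lipschitz_infDist_pt E).dist_le_mul (φ, (0 : ℝ)) (φ', (0 : ℝ))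
    simpa [Prod.dist_eq, Real.dist_eq] using this

lemma abs_exp_neg_mul_abs_sub_le {M a φ φ' : ℝ} (hM : 0 ≤ M) (h : a ≤ |φ|) (h' : a ≤ |φ'|) :
    |Real.exp (-(M * |φ|)) - Real.exp (-(M * |φ'|))| ≤
      M * Real.exp (-(M * a)) * |φ - φ'| := by
  have h1 := Saddle.norm_exp_sub_exp_le (c := -(M * a)) (w := ((-(M * |φ|) : ℝ) : ℂ))
    (w' := ((-(M * |φ'|) : ℝ) : ℂ))
    (by rw [Complex.ofReal_re]; nlinarith) (by rw [Complex.ofReal_re]; nlinarith)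
  rw [← Complex.ofReal_exp, ← Complex.ofReal_exp, ← Complex.ofReal_sub, ← Complex.ofReal_sub,
    Complex.norm_real, Complex.norm_real, Real.norm_eq_abs, Real.norm_eq_abs,
    show -(M * |φ|) - -(M * |φ'|) = -(M * (|φ| - |φ'|)) by ring, abs_neg, abs_mul,
    abs_of_nonneg hM] at h1
  have h2 := mul_le_mul_of_nonneg_left (abs_abs_sub_abs_le φ φ')
    (mul_nonneg (Real.exp_pos (-(M * a))).le hM)
  linarith

/-- Adapted domains exist inside every given one, uniformly for all saddles with the same constants.
The function `ρ` is a Lipschitz function multiplied by an exponentially decreasing one, which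
dominates the exponential growth of the constants of the branches. -/
lemma exists_isAdapted {α₁ α₂ K c₂ : ℝ} (hα₁ : 0 < α₁) (hα₂ : α₁ ≤ α₂) (hK : 0 < K) (hc₂ : 0 < c₂)
    {ρ₁ : ℝ → ℝ} (hρ₁ : Continuous ρ₁) (hpos : ∀ φ, 0 < ρ₁ φ) :
    ∃ ρ : ℝ → ℝ, Continuous ρ ∧
      (∀ φ, 0 < ρ φ ∧ ρ φ ≤ c₂ * Real.exp (-|φ|) ∧ ρ φ ≤ ρ₁ φ) ∧
      ∀ S : Saddle, S.K = K → S.c₂ = c₂ → α₁ ≤ S.α → S.α ≤ α₂ → S.IsAdapted ρ := by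
  have hα₂' : 0 < α₂ := hα₁.trans_le hα₂
  -- the constant of the `k`-th branch is at most `A exp (B |kπ|)`; in the domain, the `k`-th branch
  -- lies where `|kπ| ≤ 3/2 α₂ |φ|`, and `M` is the decay rate that compensates its growth there
  set A := 4 * K / α₁ ^ 2 with hA
  set B := 3 / α₁ + 1 with hB
  set M := 1 + 15 / 2 * (α₂ / α₁) + 3 / 2 * (B * α₂) with hM
  have hApos : 0 < A := by positivity
  have hBpos : 0 < B := by positivity
  have hr : 0 < α₂ / α₁ := by positivity
  have hBα : 0 < B * α₂ := by positivity
  have hM1 : 1 ≤ M := by linarith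
  have hM0 : 0 < M := by linarith
  set ε := min (c₂ * Real.exp (-1)) (1 / (4 * A * (M + 1) * Real.exp M)) with hε
  have hεpos : 0 < ε := by positivity
  have hε1 : ε ≤ c₂ * Real.exp (-1) := min_le_left _ _
  have hε2 : 4 * A * (M + 1) * Real.exp M * ε ≤ 1 := by
    have := min_le_right (c₂ * Real.exp (-1)) (1 / (4 * A * (M + 1) * Real.exp M))
    rw [← hε, le_div_iff₀ (by positivity)] at this
    linarith
  have hεc : ε ≤ c₂ := hε1.trans (mul_le_of_le_one_right hc₂.le
    (Real.exp_le_one_iff.2 (by norm_num)))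
  have hε3 : 4 * A * ε ≤ 1 := by
    refine le_trans ?_ hε2
    have h1 : 1 ≤ (M + 1) * Real.exp M :=
      one_le_mul_of_one_le_of_one_le (by linarith) (Real.one_le_exp hM0.le)
    have h2 : 0 ≤ 4 * A * ε := by positivity
    nlinarith
  -- the `1`-Lipschitz factor brings `ρ` below `ρ₁` without spoiling its slope
  obtain ⟨q, hq, hqlip⟩ := exists_lipschitz_minorant
    (m := fun φ => min 1 (ρ₁ φ * Real.exp (M * |φ|) / ε)) (by fun_prop)
    (fun φ => by have := hpos φ; positivity)
  have hqc : Continuous q := by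
    have : LipschitzWith 1 q := LipschitzWith.of_dist_le_mul fun x y => by
      simpa [Real.dist_eq] using hqlip x y
    exact this.continuous
  have hq1 : ∀ φ, q φ ≤ 1 := fun φ => (hq φ).2.trans (min_le_left _ _)
  have hE0 : ∀ φ : ℝ, 0 < Real.exp (-(M * |φ|)) := fun φ => Real.exp_pos _
  set ρ : ℝ → ℝ := fun φ => ε * Real.exp (-(M * |φ|)) * q φ with hρ
  have hρle : ∀ φ, ρ φ ≤ ε * Real.exp (-(M * |φ|)) := fun φ =>
    mul_le_of_le_one_right (mul_pos hεpos (hE0 φ)).le (hq1 φ)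
  have hρpos : ∀ φ, 0 < ρ φ := fun φ => mul_pos (mul_pos hεpos (hE0 φ)) (hq φ).1
  have hρc₂ : ∀ φ, ρ φ ≤ c₂ * Real.exp (-|φ|) := fun φ => (hρle φ).trans
    (mul_le_mul hεc (Real.exp_le_exp.2 (by nlinarith [abs_nonneg φ])) (hE0 φ).le hc₂.le)
  have hρc : Continuous ρ := by fun_prop
  refine ⟨ρ, hρc, fun φ => ⟨hρpos φ, hρc₂ φ, ?_⟩, ?_⟩
  · have h1 : q φ ≤ ρ₁ φ * Real.exp (M * |φ|) / ε := (hq φ).2.trans (min_le_right _ _)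
    have h2 := mul_le_mul_of_nonneg_left h1 (mul_pos hεpos (hE0 φ)).le
    have h3 : ε * Real.exp (-(M * |φ|)) * (ρ₁ φ * Real.exp (M * |φ|) / ε) = ρ₁ φ := by
      rw [Real.exp_neg]
      have := (Real.exp_pos (M * |φ|)).ne'
      field_simp
    rwa [h3] at h2
  intro S hSK hSc hS1 hS2
  have hSα := S.α_pos
  have hC : ∀ k : ℤ, S.shiftConst k ≤ A * Real.exp (B * |k * Real.pi|) := by
    intro k
    set x := |k * Real.pi| with hx
    have hx0 : 0 ≤ x := abs_nonneg _
    have h1 : 4 * S.K / S.α ^ 2 ≤ A := by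
      rw [hSK, hA]; gcongr
    have h2 : 3 / S.α * x ≤ 3 / α₁ * x := by gcongr
    have h3 : x ≤ Real.exp x := by linarith [Real.add_one_le_exp x]
    have h4 : B * x = 3 / α₁ * x + x := by rw [hB]; ring
    unfold Saddle.shiftConst
    rw [h4, Real.exp_add, ← mul_assoc, ← hx]
    refine mul_le_mul (mul_le_mul h1 (Real.exp_le_exp.2 h2) (Real.exp_pos _).le hApos.le) h3 hx0
      (by positivity)
  refine ⟨hρc, hρpos, ?_, ?_, ?_⟩
  · intro w hw
    have h1 : Real.exp w.re < c₂ * Real.exp (-|w.im|) := lt_of_lt_of_le hw (hρc₂ _)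
    rw [← Real.exp_log hc₂, ← Real.exp_add, Real.exp_lt_exp] at h1
    show w.re + |w.im| < S.l₂
    rw [Saddle.l₂, hSc]
    linarith
  · intro w hw k hk
    set x := |k * Real.pi| with hx
    have hx0 : 0 ≤ x := abs_nonneg _
    have h0 : x ≤ 3 / 2 * α₂ * |w.im| :=
      hk.trans (by gcongr)
    have h1 : Real.exp w.re < ε * Real.exp (-(M * |w.im|)) := lt_of_lt_of_le hw (hρle _)
    have h3 : M * |w.im| = |w.im| + 15 / 2 * (α₂ / α₁) * |w.im| + 3 / 2 * (B * α₂) * |w.im| := by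
      rw [hM]; ring
    have h4 : 5 / α₁ * x ≤ 15 / 2 * (α₂ / α₁) * |w.im| := by
      have := mul_le_mul_of_nonneg_left h0 (by positivity : 0 ≤ 5 / α₁)
      refine this.trans_eq ?_
      ring
    have h5 : B * x ≤ 3 / 2 * (B * α₂) * |w.im| := by
      have := mul_le_mul_of_nonneg_left h0 hBpos.le
      linarith
    have h6 : 0 ≤ |w.im| := abs_nonneg _
    have h7 : 0 ≤ 15 / 2 * (α₂ / α₁) * |w.im| := by positivity
    have h8 : 0 ≤ 3 / 2 * (B * α₂) * |w.im| := by positivity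
    constructor
    · have h2 : Real.exp w.re < c₂ * Real.exp (-1) * Real.exp (-(M * |w.im|)) :=
        h1.trans_le (mul_le_mul_of_nonneg_right hε1 (hE0 _).le)
      rw [← Real.exp_log hc₂, ← Real.exp_add, ← Real.exp_add, Real.exp_lt_exp] at h2
      have h9 : 5 / S.α * x ≤ 5 / α₁ * x := by gcongr
      rw [Saddle.l₂, hSc]
      linarith
    · have h2 := mul_le_mul (hC k) h1.le (Real.exp_pos _).le (by positivity)
      have h9 : Real.exp (B * x) * Real.exp (-(M * |w.im|)) ≤ 1 := by
        rw [← Real.exp_add, Real.exp_le_one_iff]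
        linarith
      have h10 : A * Real.exp (B * x) * (ε * Real.exp (-(M * |w.im|))) =
        A * ε * (Real.exp (B * x) * Real.exp (-(M * |w.im|))) := by ring
      have h11 : A * ε * (Real.exp (B * x) * Real.exp (-(M * |w.im|))) ≤ A * ε :=
        mul_le_of_le_one_right (by positivity) h9
      linarith
  · intro k φ φ' hφ hφ'
    set x := |k * Real.pi| with hx
    have hx0 : 0 ≤ x := abs_nonneg _
    have hlow : ∀ ψ : ℝ, |ψ - k * Real.pi / S.α| ≤ 1 → x / α₂ - 1 ≤ |ψ| := by
      intro ψ hψ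
      have h1 := abs_sub_abs_le_abs_sub (k * Real.pi / S.α) ψ
      rw [abs_sub_comm, abs_div, abs_of_pos hSα, ← hx] at h1
      have h2 : x / α₂ ≤ x / S.α := by gcongr
      linarith
    set a := x / α₂ - 1 with ha
    have h1 := abs_exp_neg_mul_abs_sub_le hM0.le (hlow φ hφ) (hlow φ' hφ')
    have h2 : Real.exp (-(M * |φ'|)) ≤ Real.exp (-(M * a)) :=
      Real.exp_le_exp.2 (by nlinarith [hlow φ' hφ'])
    have hΔ : |ρ φ - ρ φ'| ≤ ε * ((M + 1) * Real.exp (-(M * a)) * |φ - φ'|) := by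
      have e : ρ φ - ρ φ' = ε * ((Real.exp (-(M * |φ|)) - Real.exp (-(M * |φ'|))) * q φ +
          Real.exp (-(M * |φ'|)) * (q φ - q φ')) := by simp only [hρ]; ring
      rw [e, abs_mul, abs_of_pos hεpos]
      refine mul_le_mul_of_nonneg_left ((abs_add_le _ _).trans ?_) hεpos.le
      rw [abs_mul, abs_mul, abs_of_pos (hq φ).1, abs_of_pos (hE0 φ')]
      have h3 := mul_le_of_le_one_right
        (abs_nonneg (Real.exp (-(M * |φ|)) - Real.exp (-(M * |φ'|)))) (hq1 φ)
      have h4 := mul_le_mul h2 (hqlip φ φ') (abs_nonneg _) (Real.exp_pos _).le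
      linarith
    have h3 : Real.exp (B * x) * Real.exp (-(M * a)) ≤ Real.exp M := by
      rw [← Real.exp_add, Real.exp_le_exp, ha]
      have h4 : B * x ≤ M * (x / α₂) := by
        have h5 : B * α₂ ≤ M := by linarith
        have := mul_le_mul_of_nonneg_right h5 (by positivity : 0 ≤ x / α₂)
        have h6 : B * α₂ * (x / α₂) = B * x := by field_simp
        linarith
      linarith
    have h4 := mul_le_mul (hC k) hΔ (abs_nonneg _) (by positivity)
    have h5 : A * Real.exp (B * x) * (ε * ((M + 1) * Real.exp (-(M * a)) * |φ - φ'|)) =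
        A * (M + 1) * ε * |φ - φ'| * (Real.exp (B * x) * Real.exp (-(M * a))) := by ring
    have h6 := mul_le_mul_of_nonneg_left h3
      (by positivity : 0 ≤ A * (M + 1) * ε * |φ - φ'|)
    have h7 := mul_le_mul_of_nonneg_right hε2 (abs_nonneg (φ - φ'))
    linarith

/-! ### Normalisation of the family near the origin -/

/-- Two holomorphic functions on a disc that agree at its real points are equal. -/
lemma eqOn_ball_of_eq_ofReal {f g : ℂ → ℂ} {r : ℝ} (hf : AnalyticOnNhd ℂ f (Metric.ball 0 r))
    (hg : AnalyticOnNhd ℂ g (Metric.ball 0 r)) (h : ∀ x : ℝ, |x| < r → f x = g x) :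
    EqOn f g (Metric.ball 0 r) := by
  rcases le_or_gt r 0 with hr | hr
  · simp [Metric.ball_eq_empty.2 hr]
  refine hf.eqOn_of_preconnected_of_frequently_eq hg (convex_ball 0 r).isPreconnected
    (Metric.mem_ball_self hr) ?_
  have hlim : Tendsto (fun x : ℝ => (x : ℂ)) (𝓝[≠] 0) (𝓝[≠] (0 : ℂ)) := by
    refine tendsto_nhdsWithin_iff.2 ⟨?_, ?_⟩
    · exact (Complex.continuous_ofReal.tendsto' 0 0 Complex.ofReal_zero).mono_left
        nhdsWithin_le_nhds
    · filter_upwards [self_mem_nhdsWithin] with x hx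
      simpa using hx
  refine hlim.frequently (Eventually.frequently ?_)
  refine nhdsWithin_le_nhds ?_
  filter_upwards [Metric.ball_mem_nhds (0 : ℝ) hr] with x hx
  exact h x (by simpa using hx)

lemma AnalyticOnNhd.conj_comp_conj {f : ℂ → ℂ} {r : ℝ}
    (hf : AnalyticOnNhd ℂ f (Metric.ball 0 r)) :
    AnalyticOnNhd ℂ (fun z => starRingEnd ℂ (f (starRingEnd ℂ z))) (Metric.ball 0 r) := by
  refine DifferentiableOn.analyticOnNhd (fun z hz => ?_) Metric.isOpen_ball
  refine DifferentiableAt.differentiableWithinAt ?_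
  have := (hf (starRingEnd ℂ z) (by simpa using hz)).differentiableAt.conj_conj
  rwa [Complex.conj_conj] at this

/-- Schwarz reflection in two variables: a holomorphic function on a bidisc which is real at real
points commutes with complex conjugation. -/
lemma map_conj_of_real {h : ℂ × ℂ → ℂ} {r : ℝ}
    (hh : AnalyticOnNhd ℂ h (Metric.ball 0 r ×ˢ Metric.ball 0 r))
    (hreal : ∀ x y : ℝ, |x| < r → |y| < r → (h (x, y)).im = 0) {x y : ℂ} (hx : ‖x‖ < r)
    (hy : ‖y‖ < r) :
    h (starRingEnd ℂ x, starRingEnd ℂ y) = starRingEnd ℂ (h (x, y)) := by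
  have slice₁ : ∀ x : ℂ, ‖x‖ < r → AnalyticOnNhd ℂ (fun y => h (x, y)) (Metric.ball 0 r) :=
    fun x hx y hy => (hh (x, y) ⟨by simpa using hx, hy⟩).comp
      (f := fun y => (x, y)) (analyticAt_const.prod analyticAt_id)
  have slice₂ : ∀ y : ℂ, ‖y‖ < r → AnalyticOnNhd ℂ (fun x => h (x, y)) (Metric.ball 0 r) :=
    fun y hy x hx => (hh (x, y) ⟨hx, by simpa using hy⟩).comp
      (f := fun x => (x, y)) (analyticAt_id.prod analyticAt_const)
  -- the case of a real `x`
  have step : ∀ x : ℝ, |x| < r → ∀ y : ℂ, ‖y‖ < r →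
      h (x, y) = starRingEnd ℂ (h (x, starRingEnd ℂ y)) := by
    intro x hx y hy
    have hx' : ‖(x : ℂ)‖ < r := by simpa using hx
    refine eqOn_ball_of_eq_ofReal (slice₁ x hx') (slice₁ x hx').conj_comp_conj
      (fun y hy => ?_) (by simpa using hy : y ∈ Metric.ball (0 : ℂ) r)
    simp only [Complex.conj_ofReal]
    exact (Complex.conj_eq_iff_im.2 (hreal x y hx hy)).symm
  have hy' : ‖starRingEnd ℂ y‖ < r := by simpa using hy
  have key := eqOn_ball_of_eq_ofReal (slice₂ _ hy') (slice₂ y hy).conj_comp_conj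
    (fun x hx => ?_) (by simpa using hx : starRingEnd ℂ x ∈ Metric.ball (0 : ℂ) r)
  · simpa using key
  · simpa using step x hx _ hy'

lemma norm_complexParam {N : ℕ} (l : Fin N → ℝ) : ‖complexParam l‖ = ‖l‖ := by
  simp [Pi.norm_def, complexParam]

namespace SaddleFamily

variable {N : ℕ} (F : SaddleFamily N)

/-- The quotient `(1 + b) / (1 + a)`. -/
noncomputable def quot (p : ℂ × ℂ × (Fin N → ℂ)) : ℂ := (1 + F.b p) / (1 + F.a p)

/-- A polydisc on which all local properties of the family hold, with a Lipschitz constant of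
`(1 + b) / (1 + a)`. -/
lemma exists_uniform_radius : ∃ δ > 0, ∃ K : ℝ, 0 < K ∧
    (∀ p : ℂ × ℂ × (Fin N → ℂ), ‖p‖ < δ → AnalyticAt ℂ F.quot p ∧ 1 + F.a p ≠ 0) ∧
    (∀ p q : ℂ × ℂ × (Fin N → ℂ), ‖p‖ < δ → ‖q‖ < δ → ‖F.quot p - F.quot q‖ ≤ K * ‖p - q‖) ∧
    (∀ p : ℝ × ℝ × (Fin N → ℝ), ‖p‖ < δ →
      (F.quot (p.1, p.2.1, complexParam p.2.2)).im = 0) ∧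
    ∀ l : Fin N → ℝ, ‖l‖ < δ → F.quot (0, 0, complexParam l) = 1 ∧
      F.α 0 / 2 ≤ F.α l ∧ F.α l ≤ 2 * F.α 0 := by
  have hzero : complexParam (0 : Fin N → ℝ) = 0 := by ext i; simp [complexParam]
  have ha0 : F.a 0 = 0 := by
    have := F.a_zero.self_of_nhds
    rwa [hzero] at this
  have hquot : AnalyticAt ℂ F.quot 0 :=
    (analyticAt_const.add F.b_analytic).div (analyticAt_const.add F.a_analytic) (by simp [ha0])
  have hne : ∀ᶠ p in 𝓝 (0 : ℂ × ℂ × (Fin N → ℂ)), 1 + F.a p ≠ 0 :=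
    (continuousAt_const.add F.a_analytic.continuousAt).eventually_ne (by simp [ha0])
  obtain ⟨K, t, ht, hK⟩ := ((hquot.contDiffAt (n := 1)).restrict_scalars
    ℝ).exists_lipschitzOnWith
  obtain ⟨δ₁, hδ₁, h₁⟩ := Metric.eventually_nhds_iff_ball.1
    ((hquot.eventually_analyticAt.and hne).and ht)
  obtain ⟨δ₂, hδ₂, h₂⟩ := Metric.eventually_nhds_iff_ball.1 (F.a_real.and F.b_real)
  have hα := F.α_analytic.continuousAt
  obtain ⟨δ₃, hδ₃, h₃⟩ := Metric.eventually_nhds_iff_ball.1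
    ((F.a_zero.and F.b_zero).and
      ((hα.eventually (lt_mem_nhds (half_lt_self F.α_pos))).and
        (hα.eventually (gt_mem_nhds (by linarith [F.α_pos] : F.α 0 < 2 * F.α 0)))))
  refine ⟨min δ₁ (min δ₂ δ₃), by positivity, K + 1, by positivity, fun p hp => ?_,
    fun p q hp hq => ?_, fun p hp => ?_, fun l hl => ?_⟩
  · exact (h₁ p (by simpa using hp.trans_le (min_le_left _ _))).1
  · have hp' := (h₁ p (by simpa using hp.trans_le (min_le_left _ _))).2
    have hq' := (h₁ q (by simpa using hq.trans_le (min_le_left _ _))).2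
    have := hK.dist_le_mul p hp' q hq'
    rw [dist_eq_norm, dist_eq_norm] at this
    nlinarith [norm_nonneg (p - q)]
  · obtain ⟨hra, hrb⟩ := h₂ p
      (by simpa using hp.trans_le ((min_le_right _ _).trans (min_le_left _ _)))
    rw [quot, ← Complex.conj_eq_iff_im]
    simp only [map_div₀, map_add, map_one, Complex.conj_eq_iff_im.2 hra,
      Complex.conj_eq_iff_im.2 hrb]
  · obtain ⟨⟨hla, hlb⟩, hl₁, hl₂⟩ := h₃ l
      (by simpa using hl.trans_le ((min_le_right _ _).trans (min_le_right _ _)))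
    exact ⟨by simp [quot, hla, hlb], hl₁.le, hl₂.le⟩

/-- On small bidiscs all members of the family with small parameter have a normalised form, with
the same Lipschitz constant and with ratios in a compact subset of `(0, ∞)`. -/
lemma exists_saddle : ∃ ε₀ > 0, ∃ K : ℝ, 0 < K ∧ ∀ᶠ r in 𝓝[>] (0 : ℝ),
    ∀ c₁ ∈ Ioo 0 r, ∀ c₂ ∈ Ioo 0 r, ∀ l : Fin N → ℝ, ‖l‖ < ε₀ →
      ∃ S : Saddle, S.Represents F l ∧ S.r = r ∧ S.c₁ = c₁ ∧ S.c₂ = c₂ ∧ S.K = K ∧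
        F.α 0 / 2 ≤ S.α ∧ S.α ≤ 2 * F.α 0 := by
  obtain ⟨δ, hδ, K, hK, han, hlip, hreal, hl⟩ := F.exists_uniform_radius
  have hα := F.α_pos
  refine ⟨δ, hδ, 2 * F.α 0 * K, by positivity, ?_⟩
  have hr₀ : 0 < min δ (1 / (256 * K)) := by positivity
  filter_upwards [Ioo_mem_nhdsGT hr₀] with r hr c₁ hc₁ c₂ hc₂ l hlδ
  obtain ⟨hone, hα₁, hα₂⟩ := hl l hlδ
  have hrδ : r < δ := hr.2.trans_le (min_le_left _ _)
  have hrK : K * r < 1 / 256 := by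
    have : r < 1 / (256 * K) := hr.2.trans_le (min_le_right _ _)
    rw [lt_div_iff₀ (by positivity)] at this
    linarith
  have hmem : ∀ x y : ℂ, ‖x‖ < r → ‖y‖ < r → ‖(x, y, complexParam l)‖ < δ := by
    intro x y hx hy
    simp only [Prod.norm_def, norm_complexParam, max_lt_iff]
    exact ⟨hx.trans hrδ, hy.trans hrδ, hlδ⟩
  have hanalytic : AnalyticOnNhd ℂ (fun p : ℂ × ℂ => F.α l * F.quot (p.1, p.2, complexParam l))
      (Metric.ball 0 r ×ˢ Metric.ball 0 r) := by
    intro p hp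
    have hp' := (han _ (hmem p.1 p.2 (by simpa using hp.1) (by simpa using hp.2))).1
    refine analyticAt_const.mul (hp'.comp (f := fun p : ℂ × ℂ => (p.1, p.2, complexParam l)) ?_)
    exact analyticAt_fst.prod (analyticAt_snd.prod analyticAt_const)
  refine ⟨{ f := fun p => F.α l * F.quot (p.1, p.2, complexParam l)
            α := F.α l
            r := r
            b := (max c₁ c₂ + r) / 2
            c₁ := c₁
            c₂ := c₂
            K := 2 * F.α 0 * K
            α_pos := by linarith
            c₁_pos := hc₁.1
            c₂_pos := hc₂.1
            c₁_lt := by linarith [le_max_left c₁ c₂, hc₁.2]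
            c₂_lt := by linarith [le_max_right c₁ c₂, hc₂.2]
            b_lt := by linarith [max_lt hc₁.2 hc₂.2]
            K_pos := by positivity
            K_small := by nlinarith
            analytic := hanalytic
            lip := ?_
            conj := fun x y hx hy => map_conj_of_real hanalytic (fun x y hx hy => ?_) hx hy
            zero := by simp [hone] }, ⟨rfl, ?_⟩, rfl, rfl, rfl, rfl, hα₁, hα₂⟩
  · intro x y x' y' hx hy hx' hy'
    have h := hlip _ _ (hmem x y hx hy) (hmem x' y' hx' hy')
    have hle : ‖(x, y, complexParam l) - (x', y', complexParam l)‖ ≤ ‖x - x'‖ + ‖y - y'‖ := by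
      simp only [Prod.norm_def, Prod.fst_sub, Prod.snd_sub, sub_self, norm_zero]
      have h₁ := norm_nonneg (x - x')
      have h₂ := norm_nonneg (y - y')
      exact max_le (by linarith) (max_le (by linarith) (by linarith))
    rw [← mul_sub, norm_mul, Complex.norm_real, Real.norm_of_nonneg (by linarith), mul_assoc]
    exact mul_le_mul hα₂ (h.trans (mul_le_mul_of_nonneg_left hle hK.le)) (norm_nonneg _)
      (by linarith)
  · have := hreal (x, y, l) (by
      simp only [Prod.norm_def, Real.norm_eq_abs, max_lt_iff]
      exact ⟨hx.trans hrδ, hy.trans hrδ, hlδ⟩)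
    rw [Complex.im_ofReal_mul]
    simp [this]
  · intro x y u v hx hy
    have hne := (han _ (hmem x y hx hy)).2
    have : F.form l x y u v = (1 + F.a (x, y, complexParam l)) *
        (x * v + y * (F.α l * F.quot (x, y, complexParam l)) * u) := by
      rw [form, quot]
      field_simp
    rw [this, mul_eq_zero, or_iff_right hne]

end SaddleFamily

/-! ### The Dulac map and its zero locus -/

theorem lemma2 {N : ℕ} (F : SaddleFamily N) :
    -- all sufficiently small polydiscs `|x| < r`, `|y| < r`, and all cross-sections in them
    ∀ᶠ r in 𝓝[>] (0 : ℝ), ∀ c₁ ∈ Ioo 0 r, ∀ c₂ ∈ Ioo 0 r,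
      ∃ ε₀ > 0, ∃ ρ₀ : ℝ → ℝ, ∃ D : (Fin N → ℝ) → ℂ → ℂ,
        Continuous ρ₀ ∧ (∀ φ, 0 < ρ₀ φ) ∧
        (∀ l : Fin N → ℝ, ‖l‖ < ε₀ →
          0 < F.α l ∧ F.IsDulacContinuation l r c₁ c₂ ρ₀ (D l) ∧
          ∀ k : ℤ, IsSmoothAnalyticCurveAtZero (F.holonomyLocus l r c₁ k)
            (direction (F.α l) k)) ∧
        -- for arbitrarily small domains `0 < ρ < ρ(φ)`
        ∀ ρ₁ : ℝ → ℝ, Continuous ρ₁ → (∀ φ, 0 < ρ₁ φ) →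
          ∃ ρ : ℝ → ℝ, Continuous ρ ∧ (∀ φ, 0 < ρ φ ∧ ρ φ ≤ ρ₀ φ ∧ ρ φ ≤ ρ₁ φ) ∧
            ∀ l : Fin N → ℝ, ‖l‖ < ε₀ →
              ∃ H : ℤ → Set ℂ,
                -- the connected components of the zero locus are the `H k`, without repetition
                imZeroLocus (D l) ρ = ⋃ k, H k ∧ Function.Injective H ∧
                (∀ k, ∃ w ∈ imZeroLocus (D l) ρ,
                  H k = connectedComponentIn (imZeroLocus (D l) ρ) w) ∧
                ∀ k : ℤ,
                  -- `φ → kπ/α(λ)` as `ρ → 0` along `H k`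
                  Tendsto Complex.im (comap Complex.re atBot ⊓ 𝓟 (H k))
                    (𝓝 ((k : ℝ) * Real.pi / F.α l)) ∧
                  -- `H k` is projected on the branch of the curve tangent to the half-line
                  (∃ R > 0, ∃ z ∈ (F.holonomyLocus l r c₁ k ∩ Metric.ball 0 R) \ {0},
                    Complex.exp '' H k =
                      connectedComponentIn
                        ((F.holonomyLocus l r c₁ k ∩ Metric.ball 0 R) \ {0}) z) ∧
                  IsTangentToHalfLine (Complex.exp '' H k) (direction (F.α l) k) := by
  obtain ⟨ε₀, hε₀, K, hK, hev⟩ := F.exists_saddle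
  filter_upwards [hev] with r hr c₁ hc₁ c₂ hc₂
  have : Nonempty Saddle := ⟨(hr c₁ hc₁ c₂ hc₂ 0 (by simpa using hε₀)).choose⟩
  choose! S hS using hr c₁ hc₁ c₂ hc₂
  have hα := F.α_pos
  refine ⟨ε₀, hε₀, fun φ => c₂ * Real.exp (-|φ|), fun l w => Complex.exp ((S l).logDulac w),
    by fun_prop, fun φ => mul_pos hc₂.1 (Real.exp_pos _), fun l hl => ?_, fun ρ₁ hρ₁ hpos => ?_⟩
  · obtain ⟨h, rfl, rfl, rfl, -⟩ := hS l hl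
    refine ⟨h.ratio ▸ (S l).α_pos, ⟨fun w hw => ?_, fun u hu => ?_⟩,
      fun k => h.isSmoothAnalyticCurveAtZero k⟩
    · refine ((S l).analyticOnNhd_logDulac w ?_).cexp
      have := Real.log_lt_log (Real.exp_pos _) hw
      rw [Real.log_mul (S l).c₂_pos.ne' (Real.exp_ne_zero _), Real.log_exp, Real.log_exp] at this
      change w.re + |w.im| < Real.log (S l).c₂
      linarith
    · refine ⟨_, h.isDulacValue ?_⟩
      beta_reduce at hu
      rw [abs_zero, neg_zero, Real.exp_zero, mul_one] at hu
      exact (Real.lt_log_iff_exp_lt (S l).c₂_pos).2 hu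
  · obtain ⟨ρ, hρ, hle, hadapted⟩ := exists_isAdapted (half_pos hα)
      (by linarith : F.α 0 / 2 ≤ 2 * F.α 0) hK hc₂.1 hρ₁ hpos
    refine ⟨ρ, hρ, hle, fun l hl => ?_⟩
    obtain ⟨h, rfl, rfl, h₂, hKl, hα₁, hα₂⟩ := hS l hl
    have had := hadapted (S l) hKl h₂ hα₁ hα₂
    refine ⟨(S l).zeroBranch ρ, Saddle.imZeroLocus_eq, had.injective_zeroBranch,
      had.exists_zeroBranch_eq_component, fun k => ?_⟩
    rw [h.ratio]
    exact ⟨had.tendsto_im k, had.exists_image_eq_component h k, had.isTangentToHalfLine k⟩
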